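/- Let $\mathbf{Z}^2$ denote the Cayley graph of $\mathbb Z^2$ for the generators $(\pm1,0),(0,\pm1)$, identify $\mathbb Z^2$ with $\mathbb Z[i]\subset\mathbb C$, and let $\mathcal T$ be the space of infinite connected subgraphs $T$ of $\mathbf{Z}^2$ containing $0$, with the Gromov–Hausdorff distance $d(T,T')=e^{-R(T,T')}$, where $R(T,T')$ is the supremum of the integers $N\ge 1$ such that the open balls of centre $0$ and radius $N$ of $T$ and $T'$ (for their path metrics) coincide, and $R(T,T')=0$ if there is no such $N$. Let $\mathcal R$ be the equivalence relation on $\mathcal T$ with $T\sim T-v$ for every vertex $v$ of $T$. Let $T_1$ be the tree whose edges are those of the segments $[-1,1]\times\{0\}$ and $\{0\}\times[-2,2]$; let $T_{n+1}$ be obtained from the union of the four images of $T_n+(0,2^n)$ under the rotations of centre $0$ and angles $0,\frac\pi2,\pi,\frac{3\pi}2$ by removing the two terminal edges contained in the horizontal axis (with their terminal vertices $(\pm 2^{n+1},0)$). Let $T_\infty=\bigcup_{n\ge1} T_n$ be the Kenyon tree, and let $X=\overline{\mathcal R[T_\infty]}\subset\mathcal T$. Let $X^{\le2}$ be the set of $T\in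 X$ in which $0$ has valency at most $2$, and let $Y^{\le 2}=X^{\le2}\setminus\mathcal R[T_\infty]$. For $\alpha\in S_4=\{0,1,2,3\}^{\mathbb N}$ put $x_0=0$, $x_{n+1}=x_n+2^n i^{\alpha_n}$, $P_0=\{0\}$, and let $P_{n+1}$ be the union of the images, under the four rotations of centre $x_{n+1}$ and angles $0,\frac\pi2,\pi,\frac{3\pi}2$, of the graph obtained from $P_n$ by adding the edge of $\mathbf{Z}^2$ joining $x_{n+1}$ to the vertex $x_{n+1}-i^{\alpha_n}$ of $P_n$. Put $\Phi(\alpha)=\bigcup_{n\ge0} P_n\in\mathcal T$. Let $\mathcal R_{\mathrm{cof}}$ be the relation on $S_4$ identifying two sequences which agree from some index on, and let $\mu_4$ be the uniform product probability measure on $S_4$. A discrete measurable equivalence relation is an equivalence relation on a standard Borel space with countable classes and Borel graph. A Borel measure $\mu$ is invariant for such a relation if $\mu(\varphi^{-1}(B'))=\mu(B')$ for every Borel isomorphism $\varphi:A\to B$ between Borel sets whose graph is contained in the relation and every Borel set $B'\subset B$. A map $\varphi:Y\to Y'$ defines an orbit equivalence between measured relations $(\mathcal R,Y,\mu)$ and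 $(\mathcal R',Y',\mu')$ if it restricts to a Borel isomorphism between saturated Borel sets $Z\subset Y$ and $Z'\subset Y'$ of full measure, with $\varphi(\mathcal R[x])=\mathcal R'[\varphi(x)]$ for $\mu$-almost every $x\in Z$ and $\varphi_*\mu$ equivalent to $\mu'$ (same null sets). A map $\varphi:Y\to Y'$ between Borel sets $Y\subset X$ and $Y'\subset X'$ defines a stable orbit equivalence between $(\mathcal R,X,\mu)$ and $(\mathcal R',X',\mu')$ if the saturations of $Y$ and $Y'$ have full measure and $\varphi$ defines an orbit equivalence between the induced relations on $Y$ and $Y'$ with the restricted measures. **Proposition.** The map $\Phi$ takes its values in $Y^{\le2}$. There is exactly one Borel probability measure $\mu$ on $X$ invariant for the restriction of $\mathcal R$ to $X$. It satisfies $\mu(X^{\le2})=\frac34$ and $\Phi_*\mu_4=\frac43\,\mu|_{Y^{\le2}}$. The relations $\mathcal R_{\mathrm{cof}}$ on $S_4$ and $\mathcal R$ on $X$ are discrete measurable, and the map $\Phi:S_4\to Y^{\le2}$ defines a stable orbit equivalence between the measured relations $(\mathcal R_{\mathrm{cof}},S_4,\mu_4)$ and $(\mathcal R,X,\mu)$.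 -/

import Mathlib

open MeasureTheory Set

namespace GhysKenyon

/-! ### The Cayley graph of `ℤ²` and its rooted infinite connected subgraphs -/

/-- The four unit vectors `1, i, -1, -i` of `ℤ² ⊂ ℂ`, indexed by `{0,1,2,3}`. -/
def dir : Fin 4 → ℤ × ℤ := ![(1, 0), (0, 1), (-1, 0), (0, -1)]

/-- The Cayley graph of `ℤ²` with generators `(±1,0), (0,±1)`. -/
def gridGraph : SimpleGraph (ℤ × ℤ) := SimpleGraph.addCayley (Set.range dir)

theorem dir_add_two (k : Fin 4) : dir (k + 2) = -dir k := by
  fin_cases k <;> rfl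

theorem dir_ne_zero (k : Fin 4) : dir k ≠ 0 := by
  fin_cases k <;> simp [dir]

theorem gridGraph_adj {p q : ℤ × ℤ} : gridGraph.Adj p q ↔ ∃ k, q = p + dir k := by
  simp only [gridGraph, SimpleGraph.addCayley_adj', Set.mem_range, exists_exists_eq_and]
  constructor
  · rintro ⟨-, k, h | h⟩
    · exact ⟨k, h.symm⟩
    · exact ⟨k + 2, by rw [dir_add_two, h]; abel⟩
  · rintro ⟨k, rfl⟩
    refine ⟨?_, k, Or.inl rfl⟩
    intro h
    exact dir_ne_zero k (by simpa using h)

/-- The translation `p ↦ p - v`. -/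
def shiftHom (v : ℤ × ℤ) : gridGraph →g gridGraph where
  toFun p := p - v
  map_rel' := by
    intro p q h
    rw [gridGraph_adj] at h ⊢
    obtain ⟨k, rfl⟩ := h
    exact ⟨k, by abel⟩

/-- The quarter turn about the origin. -/
def turn (p : ℤ × ℤ) : ℤ × ℤ := (-p.2, p.1)

theorem turn_add (p q : ℤ × ℤ) : turn (p + q) = turn p + turn q := by
  ext <;> simp [turn]; ring

theorem turn_dir (k : Fin 4) : turn (dir k) = dir (k + 1) := by
  fin_cases k <;> rfl

theorem turn_iterate_add (n : ℕ) (p q : ℤ × ℤ) :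
    turn^[n] (p + q) = turn^[n] p + turn^[n] q := by
  induction n generalizing p q with
  | zero => rfl
  | succ n ih => simp only [Function.iterate_succ, Function.comp_apply, turn_add, ih]

theorem turn_iterate_dir (n : ℕ) (k : Fin 4) : ∃ l, turn^[n] (dir k) = dir l := by
  induction n generalizing k with
  | zero => exact ⟨k, rfl⟩
  | succ n ih =>
    simp only [Function.iterate_succ, Function.comp_apply, turn_dir]
    exact ih _

/-- The rotation of angle `kπ/2` about `c`. -/
def rotHom (c : ℤ × ℤ) (k : ℕ) : gridGraph →g gridGraph where
  toFun p := c + turn^[k] (p - c)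
  map_rel' := by
    intro p q h
    rw [gridGraph_adj] at h ⊢
    obtain ⟨j, rfl⟩ := h
    obtain ⟨l, hl⟩ := turn_iterate_dir k j
    refine ⟨l, ?_⟩
    rw [← hl, show p + dir j - c = (p - c) + dir j by abel, turn_iterate_add]
    abel

/-- The points of the Gromov-Hausdorff space of `ℤ²`: infinite connected subgraphs of the Cayley
graph which contain the origin. -/
@[ext]
structure RootedGraph where
  graph : gridGraph.Subgraph
  zero_mem : 0 ∈ graph.verts
  /-- every vertex is joined to the origin by a path in the subgraph -/
  connected : ∀ v ∈ graph.verts, graph.spanningCoe.Reachable 0 v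
  infinite : graph.verts.Infinite

namespace RootedGraph

/-- The distance from the origin to `v` in the path metric of `T` (`⊤` if `v` is not in `T`). -/
noncomputable def height (T : RootedGraph) (v : ℤ × ℤ) : ℕ∞ := T.graph.spanningCoe.edist 0 v

/-- The open ball `B_T(0,N)` of radius `N ≥ 1` of the metric graph `T`, given by its vertices and
by the (oriented) edges which issue from one of them. -/
def openBall (T : RootedGraph) (N : ℕ) : Set (ℤ × ℤ) × Set ((ℤ × ℤ) × (ℤ × ℤ)) :=
  ({v | v ∈ T.graph.verts ∧ T.height v < N},
   {e | T.graph.Adj e.1 e.2 ∧ T.height e.1 < N})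

/-- `R(T,T')`, the supremum of the radii `N ≥ 1` for which the open balls coincide
(`0` if there are none). -/
noncomputable def agreement (T T' : RootedGraph) : ℕ∞ :=
  ⨆ (N : ℕ) (_ : 1 ≤ N ∧ T.openBall N = T'.openBall N), (N : ℕ∞)

theorem height_le_of_openBall_eq {T T' : RootedGraph} {N : ℕ}
    (h : T.openBall N = T'.openBall N) {u v : ℤ × ℤ} (p : T.graph.spanningCoe.Walk u v)
    (hp : T.height u + p.length ≤ N) : T'.height v ≤ T'.height u + p.length := by
  induction p with
  | nil => simp
  | @cons u w v huw p ih =>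
    rw [SimpleGraph.Walk.length_cons] at hp ⊢
    push_cast at hp ⊢
    have hu : T.height u < N := by
      refine lt_of_lt_of_le ?_ hp
      have hne : T.height u ≠ ⊤ := by
        intro ht
        rw [ht] at hp
        simp at hp
      refine (ENat.lt_add_one_iff hne).2 le_rfl |>.trans_le ?_
      gcongr
      exact le_add_self
    have hmem : (u, w) ∈ (T'.openBall N).2 := by
      rw [← h]
      exact ⟨by simpa using huw, hu⟩
    have e1 : T.height w ≤ T.height u + 1 := by
      refine (SimpleGraph.edist_triangle (v := u)).trans ?_
      unfold height
      gcongr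
      exact le_of_eq (SimpleGraph.edist_eq_one_iff_adj.2 huw)
    have e2 : T'.height w ≤ T'.height u + 1 := by
      refine (SimpleGraph.edist_triangle (v := u)).trans ?_
      unfold height
      gcongr
      refine le_of_eq (SimpleGraph.edist_eq_one_iff_adj.2 ?_)
      simpa using hmem.1
    calc T'.height v ≤ T'.height w + p.length := by
          apply ih
          calc T.height w + p.length ≤ (T.height u + 1) + p.length := by gcongr
            _ = T.height u + (p.length + 1) := by ring
            _ ≤ N := hp
      _ ≤ (T'.height u + 1) + p.length := by gcongr
      _ = T'.height u + (p.length + 1) := by ring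

theorem height_le_of_openBall_eq' {T T' : RootedGraph} {N : ℕ}
    (h : T.openBall N = T'.openBall N) {v : ℤ × ℤ} (hv : T.height v < N) :
    T'.height v ≤ T.height v := by
  obtain ⟨p, hp⟩ := SimpleGraph.exists_walk_of_edist_ne_top (ne_top_of_lt hv)
  have h0 : ∀ S : RootedGraph, S.height 0 = 0 := fun S => SimpleGraph.edist_self
  have := height_le_of_openBall_eq h p (by
    rw [h0, zero_add, hp]; exact hv.le)
  rwa [h0, zero_add, hp] at this

theorem openBall_eq_mono {T T' : RootedGraph} {M N : ℕ} (hMN : M ≤ N)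
    (h : T.openBall N = T'.openBall N) : T.openBall M = T'.openBall M := by
  have key : ∀ {S S' : RootedGraph}, S.openBall N = S'.openBall N →
      (S.openBall M).1 ⊆ (S'.openBall M).1 ∧ (S.openBall M).2 ⊆ (S'.openBall M).2 := by
    intro S S' h
    have hM : ∀ {v}, S.height v < M → S.height v < N := fun hv =>
      hv.trans_le (by exact_mod_cast hMN)
    constructor
    · rintro v ⟨hv, hvM⟩
      have : v ∈ (S'.openBall N).1 := h ▸ ⟨hv, hM hvM⟩
      exact ⟨this.1, (height_le_of_openBall_eq' h (hM hvM)).trans_lt hvM⟩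
    · rintro e ⟨he, heM⟩
      have : e ∈ (S'.openBall N).2 := h ▸ ⟨he, hM heM⟩
      exact ⟨this.1, (height_le_of_openBall_eq' h (hM heM)).trans_lt heM⟩
  exact Prod.ext (Set.Subset.antisymm (key h).1 (key h.symm).1)
    (Set.Subset.antisymm (key h).2 (key h.symm).2)

theorem agreement_self (T : RootedGraph) : agreement T T = ⊤ := by
  refine ENat.eq_top_iff_forall_ge.2 fun n => ?_
  exact le_trans (by exact_mod_cast Nat.le_succ n)
    (le_iSup₂_of_le (n + 1) ⟨by omega, rfl⟩ le_rfl)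

theorem agreement_comm (T T' : RootedGraph) : agreement T T' = agreement T' T := by
  unfold agreement
  simp only [eq_comm]

theorem exists_of_lt_agreement {T T' : RootedGraph} {n : ℕ∞} (h : n < agreement T T') :
    ∃ N : ℕ, n < N ∧ 1 ≤ N ∧ T.openBall N = T'.openBall N := by
  unfold agreement at h
  simp only [lt_iSup_iff] at h
  obtain ⟨N, hN, hlt⟩ := h
  exact ⟨N, hlt, hN⟩

theorem min_agreement_le (T₁ T₂ T₃ : RootedGraph) :
    min (agreement T₁ T₂) (agreement T₂ T₃) ≤ agreement T₁ T₃ := by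
  by_contra! h
  obtain ⟨h1, h2⟩ := lt_min_iff.1 h
  obtain ⟨N, hN, hN1, hN2⟩ := exists_of_lt_agreement h1
  obtain ⟨M, hM, hM1, hM2⟩ := exists_of_lt_agreement h2
  have : ((min N M : ℕ) : ℕ∞) ≤ agreement T₁ T₃ :=
    le_iSup₂_of_le (min N M) ⟨le_min hN1 hM1,
      (openBall_eq_mono (min_le_left _ _) hN2).trans (openBall_eq_mono (min_le_right _ _) hM2)⟩
      le_rfl
  rcases min_choice N M with e | e <;> rw [e] at this
  · exact absurd hN this.not_gt
  · exact absurd hM this.not_gt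

theorem height_ne_top (T : RootedGraph) {v : ℤ × ℤ} (hv : v ∈ T.graph.verts) :
    T.height v ≠ ⊤ := SimpleGraph.edist_ne_top_iff_reachable.2 (T.connected v hv)

theorem eq_of_agreement_eq_top {T T' : RootedGraph} (h : agreement T T' = ⊤) : T = T' := by
  have key : ∀ {S S' : RootedGraph}, agreement S S' = ⊤ → S.graph ≤ S'.graph := by
    intro S S' h
    have hb : ∀ v ∈ S.graph.verts, ∃ N : ℕ, S.height v < N ∧ S.openBall N = S'.openBall N := by
      intro v hv
      obtain ⟨N, h1, -, h2⟩ := exists_of_lt_agreement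
        (lt_of_lt_of_eq (S.height_ne_top hv).lt_top h.symm)
      exact ⟨N, h1, h2⟩
    constructor
    · intro v hv
      obtain ⟨N, h1, h2⟩ := hb v hv
      have : v ∈ (S'.openBall N).1 := h2 ▸ ⟨hv, h1⟩
      exact this.1
    · intro u v huv
      obtain ⟨N, h1, h2⟩ := hb u (S.graph.edge_vert huv)
      have : (u, v) ∈ (S'.openBall N).2 := h2 ▸ ⟨huv, h1⟩
      exact this.1
  exact RootedGraph.ext (le_antisymm (key h) (key (agreement_comm T T' ▸ h)))

/-- The Gromov-Hausdorff distance `e^{-R(T,T')}`. -/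
noncomputable instance : Dist RootedGraph where
  dist T T' := if agreement T T' = ⊤ then 0 else Real.exp (-((agreement T T').toNat : ℝ))

theorem dist_def (T T' : RootedGraph) : dist T T' =
    if agreement T T' = ⊤ then 0 else Real.exp (-((agreement T T').toNat : ℝ)) := rfl

theorem dist_nonneg' (T T' : RootedGraph) : 0 ≤ dist T T' := by
  rw [dist_def]; split_ifs <;> positivity

theorem dist_le_of_agreement_le {T₁ T₂ T₃ T₄ : RootedGraph}
    (h : agreement T₁ T₂ ≤ agreement T₃ T₄) : dist T₃ T₄ ≤ dist T₁ T₂ := by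
  by_cases h1 : agreement T₃ T₄ = ⊤
  · rw [dist_def T₃, if_pos h1]; exact dist_nonneg' _ _
  · have h2 : agreement T₁ T₂ ≠ ⊤ := ne_top_of_le_ne_top h1 h
    rw [dist_def, dist_def, if_neg h1, if_neg h2]
    gcongr

noncomputable instance : MetricSpace RootedGraph where
  dist_self T := by rw [dist_def, if_pos (agreement_self T)]
  dist_comm T T' := by rw [dist_def, dist_def, agreement_comm]
  dist_triangle T₁ T₂ T₃ := by
    have h1 := dist_nonneg' T₁ T₂
    have h2 := dist_nonneg' T₂ T₃
    rcases min_le_iff.1 (min_agreement_le T₁ T₂ T₃) with h | h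
    · linarith [dist_le_of_agreement_le h]
    · linarith [dist_le_of_agreement_le h]
  eq_of_dist_eq_zero := by
    intro T T' h
    apply eq_of_agreement_eq_top
    by_contra hne
    change dist T T' = 0 at h
    rw [dist_def, if_neg hne] at h
    exact (Real.exp_pos _).ne' h

noncomputable instance : MeasurableSpace RootedGraph := borel RootedGraph

instance : BorelSpace RootedGraph := ⟨rfl⟩

/-- The equivalence relation `R`: two graphs `T` and `T'` are equivalent if `T' = T - v` for some
vertex `v` of `T`. -/
def translationRel : Setoid RootedGraph where
  r T T' := ∃ v ∈ T.graph.verts, T'.graph = T.graph.map (shiftHom v)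
  iseqv := by
    have h0 : shiftHom 0 = SimpleGraph.Hom.id := by ext p <;> simp [shiftHom]
    have hc : ∀ u v, (shiftHom v).comp (shiftHom u) = shiftHom (u + v) := by
      intro u v
      ext p <;> simp [shiftHom] <;> ring
    refine ⟨fun T => ⟨0, T.zero_mem, ?_⟩, ?_, ?_⟩
    · rw [h0, SimpleGraph.Subgraph.map_id]
    · rintro T T' ⟨v, hv, h⟩
      refine ⟨-v, ?_, ?_⟩
      · rw [h]
        exact ⟨0, T.zero_mem, by simp [shiftHom]⟩
      · rw [h, ← SimpleGraph.Subgraph.map_comp, hc, add_neg_cancel, h0,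
          SimpleGraph.Subgraph.map_id]
    · rintro T T' T'' ⟨v, hv, h⟩ ⟨w, hw, h'⟩
      refine ⟨v + w, ?_, ?_⟩
      · rw [h] at hw
        obtain ⟨p, hp, hpw⟩ := hw
        have : v + w = p := by rw [← hpw]; simp [shiftHom]
        rwa [this]
      · rw [h', h, ← SimpleGraph.Subgraph.map_comp, hc]

/-- The valency of `T` at the origin. -/
noncomputable def valency (T : RootedGraph) : ℕ∞ := (T.graph.neighborSet 0).encard

end RootedGraph

open RootedGraph

/-! ### Reachability lemmas used in the two constructions -/

/-- Every vertex of `H` can be joined to `c` inside `H`. -/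
def ConnectedTo (H : gridGraph.Subgraph) (c : ℤ × ℤ) : Prop :=
  ∀ v ∈ H.verts, H.spanningCoe.Reachable c v

theorem reachable_mono {H K : gridGraph.Subgraph} (h : H ≤ K) {a b : ℤ × ℤ}
    (hab : H.spanningCoe.Reachable a b) : K.spanningCoe.Reachable a b :=
  hab.mono (SimpleGraph.Subgraph.spanningCoe_le_of_le h)

theorem reachable_map {H : gridGraph.Subgraph} (f : gridGraph →g gridGraph) {a b : ℤ × ℤ}
    (hab : H.spanningCoe.Reachable a b) :
    (H.map f).spanningCoe.Reachable (f a) (f b) := by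
  let g : H.spanningCoe →g (H.map f).spanningCoe :=
    { toFun := f
      map_rel' := by
        intro u v huv
        exact ⟨u, v, huv, rfl, rfl⟩ }
  exact hab.map g

theorem ConnectedTo.map {H : gridGraph.Subgraph} {c : ℤ × ℤ} (h : ConnectedTo H c)
    (f : gridGraph →g gridGraph) : ConnectedTo (H.map f) (f c) := by
  rintro _ ⟨v, hv, rfl⟩
  exact reachable_map f (h v hv)

theorem ConnectedTo.iSup {ι : Type*} {H : ι → gridGraph.Subgraph} {c : ℤ × ℤ}
    (h : ∀ i, ConnectedTo (H i) c) : ConnectedTo (⨆ i, H i) c := by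
  intro v hv
  rw [SimpleGraph.Subgraph.verts_iSup] at hv
  obtain ⟨i, hi⟩ := Set.mem_iUnion.1 hv
  exact reachable_mono (le_iSup H i) (h i v hi)

theorem ConnectedTo.change {H : gridGraph.Subgraph} {c d : ℤ × ℤ} (h : ConnectedTo H c)
    (hd : d ∈ H.verts) : ConnectedTo H d :=
  fun v hv => (h d hd).symm.trans (h v hv)

theorem rotHom_center (c : ℤ × ℤ) (k : ℕ) : rotHom c k c = c := by
  have : ∀ k : ℕ, turn^[k] (0 : ℤ × ℤ) = 0 := by
    intro k
    induction k with
    | zero => rfl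
    | succ k ih => rw [Function.iterate_succ_apply]; exact ih
  simp [rotHom, this]

theorem rotHom_zero (c : ℤ × ℤ) : rotHom c 0 = SimpleGraph.Hom.id := by
  ext p <;> simp [rotHom]

theorem le_iSup_rot (H : gridGraph.Subgraph) (c : ℤ × ℤ) :
    H ≤ ⨆ k : Fin 4, H.map (rotHom c k) := by
  refine le_trans (le_of_eq ?_) (le_iSup (fun k : Fin 4 => H.map (rotHom c k)) 0)
  rw [Fin.val_zero, rotHom_zero, SimpleGraph.Subgraph.map_id]

/-! ### The Kenyon tree and the Ghys-Kenyon minimal set -/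

/-- `kenyonTree n` is the finite tree `T_{n+1}`. The tree `T_1` is the cross with horizontal arms
of length `1` and vertical arms of length `2`. The next tree is obtained from `T_n` by translation
by the vector `(0, 2^n)`, taking the union of the images under the four rotations about the origin,
and removing the two terminal edges of the horizontal axis (with their terminal vertices
`(±2^{n+1}, 0)`). -/
def kenyonTree : ℕ → gridGraph.Subgraph
  | 0 => (⊤ : gridGraph.Subgraph).induce
      {(0, -2), (0, -1), (0, 0), (0, 1), (0, 2), (1, 0), (-1, 0)}
  | n + 1 => (⨆ k : Fin 4,
      ((kenyonTree n).map (shiftHom (0, -2 ^ (n + 1)))).map (rotHom 0 k)).deleteVerts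
        {(2 ^ (n + 2), 0), (-2 ^ (n + 2), 0)}

/-- The underlying graph of the Kenyon tree, the union of the finite trees. -/
def kenyonGraph : gridGraph.Subgraph := ⨆ n, kenyonTree n

/-! ### Coded trees -/

/-- The space of sequences in `{0,1,2,3}`. -/
abbrev Seq4 : Type := ℕ → Fin 4

/-- The skeleton `x_0 = 0`, `x_{n+1} = x_n + 2^n i^{α_n}`. -/
def skeleton (α : Seq4) : ℕ → ℤ × ℤ
  | 0 => 0
  | n + 1 => skeleton α n + (2 ^ n : ℤ) • dir (α n)

/-- The last edge of the segment from `x_n` to `x_{n+1}`: the edge of the grid which joins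
`x_{n+1}` to the patch `P_n`. -/
theorem adj_skeleton (α : Seq4) (n : ℕ) :
    gridGraph.Adj (skeleton α (n + 1) - dir (α n)) (skeleton α (n + 1)) :=
  gridGraph_adj.2 ⟨α n, by abel⟩

/-- The finite trees `P_n`: `P_0` is the origin and `P_{n+1}` is the union of the images of
`P_n`, enlarged by the edge which joins it to `x_{n+1}`, under the four rotations about
`x_{n+1}`. -/
def patch (α : Seq4) : ℕ → gridGraph.Subgraph
  | 0 => gridGraph.singletonSubgraph 0
  | n + 1 => ⨆ k : Fin 4,
      (patch α n ⊔ gridGraph.subgraphOfAdj (adj_skeleton α n)).map (rotHom (skeleton α (n + 1)) k)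

/-- The underlying graph of the coded tree of `α`, the union of the patches `P_n`. -/
def codedGraph (α : Seq4) : gridGraph.Subgraph := ⨆ n, patch α n

theorem skeleton_armEnd (α : Seq4) (n : ℕ) :
    skeleton α n + (2 ^ n - 1 : ℤ) • dir (α n) = skeleton α (n + 1) - dir (α n) := by
  rw [skeleton, sub_smul, one_smul]; abel

theorem patch_le_succ (α : Seq4) (n : ℕ) : patch α n ≤ patch α (n + 1) :=
  le_sup_left.trans (le_iSup_rot _ _)

theorem zero_mem_patch (α : Seq4) (n : ℕ) : 0 ∈ (patch α n).verts := by
  induction n with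
  | zero => simp [patch]
  | succ n ih => exact (patch_le_succ α n).1 ih

theorem turn_iterate_smul_dir (k : Fin 4) (m : ℤ) (j : Fin 4) :
    turn^[k.val] (m • dir j) = m • dir (j + k) := by
  fin_cases k <;> fin_cases j <;> simp [turn, dir, Function.iterate_succ_apply]

theorem armEnd_mem_patch (α : Seq4) (n : ℕ) (k : Fin 4) :
    skeleton α n + (2 ^ n - 1 : ℤ) • dir k ∈ (patch α n).verts := by
  induction n generalizing k with
  | zero => simp [patch, skeleton]
  | succ n ih =>
    have h1 := ih (α n + 2)
    rw [patch, SimpleGraph.Subgraph.verts_iSup]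
    refine Set.mem_iUnion.2 ⟨k - (α n + 2), ?_⟩
    refine ⟨_, Or.inl h1, ?_⟩
    have h2 : skeleton α n + (2 ^ n - 1 : ℤ) • dir (α n + 2) - skeleton α (n + 1)
        = (2 ^ (n + 1) - 1 : ℤ) • dir (α n + 2) := by
      rw [skeleton, dir_add_two, pow_succ, smul_neg, smul_neg]
      module
    change skeleton α (n + 1) + turn^[_] (_ - skeleton α (n + 1)) = _
    rw [h2, turn_iterate_smul_dir]
    congr 3
    simp

theorem skeleton_mem (α : Seq4) (n : ℕ) : skeleton α (n + 1) ∈ (patch α (n + 1)).verts :=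
  (le_iSup_rot _ _).1 (Or.inr (by simp))

theorem patch_connectedTo (α : Seq4) (n : ℕ) : ConnectedTo (patch α n) (skeleton α n) := by
  induction n with
  | zero =>
    intro v hv
    have : v = 0 := by simpa [patch] using hv
    rw [this]; exact SimpleGraph.Reachable.refl _
  | succ n ih =>
    rw [patch]
    refine ConnectedTo.iSup fun k => ?_
    have hA : ConnectedTo (patch α n ⊔ gridGraph.subgraphOfAdj (adj_skeleton α n))
        (skeleton α (n + 1)) := by
      have harm := armEnd_mem_patch α n (α n)
      rw [skeleton_armEnd] at harm
      have hedge : (patch α n ⊔ gridGraph.subgraphOfAdj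
          (adj_skeleton α n)).spanningCoe.Reachable (skeleton α (n + 1))
            (skeleton α (n + 1) - dir (α n)) := by
        refine SimpleGraph.Adj.reachable ?_
        rw [SimpleGraph.Subgraph.spanningCoe_adj, SimpleGraph.Subgraph.sup_adj]
        right
        simp
      rintro v (hv | hv)
      · exact hedge.trans (reachable_mono le_sup_left ((ih.change harm) v hv))
      · have : v = skeleton α (n + 1) - dir (α n) ∨ v = skeleton α (n + 1) := by simpa using hv
        rcases this with rfl | rfl
        · exact hedge
        · exact SimpleGraph.Reachable.refl _
    have := hA.map (rotHom (skeleton α (n + 1)) k)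
    rwa [rotHom_center] at this

theorem skeleton_injective (α : Seq4) : Function.Injective (skeleton α) := by
  have hs : ∀ k, ((dir k).1 + (dir k).2) % 2 = 1 := by
    intro k; fin_cases k <;> rfl
  have key : ∀ m d, ∃ c : ℤ, (skeleton α (m + d + 1)).1 + (skeleton α (m + d + 1)).2
      = (skeleton α m).1 + (skeleton α m).2 + 2 ^ m * (2 * c + 1) := by
    intro m d
    induction d with
    | zero =>
      refine ⟨((dir (α m)).1 + (dir (α m)).2) / 2, ?_⟩
      have := Int.mul_ediv_add_emod ((dir (α m)).1 + (dir (α m)).2) 2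
      rw [hs] at this
      rw [this, add_zero, skeleton]
      simp only [Prod.fst_add, Prod.snd_add, Prod.smul_fst, Prod.smul_snd, smul_eq_mul]
      ring
    | succ d ih =>
      obtain ⟨c, hc⟩ := ih
      refine ⟨c + 2 ^ d * ((dir (α (m + d + 1))).1 + (dir (α (m + d + 1))).2), ?_⟩
      rw [show m + (d + 1) + 1 = (m + d + 1) + 1 by ring, skeleton]
      simp only [Prod.fst_add, Prod.snd_add, Prod.smul_fst, Prod.smul_snd, smul_eq_mul]
      linear_combination hc
  have hlt : ∀ m n, m < n → skeleton α m ≠ skeleton α n := by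
    intro m n hmn h
    obtain ⟨d, rfl⟩ := Nat.exists_eq_add_of_lt hmn
    obtain ⟨c, hc⟩ := key m d
    rw [← h] at hc
    have h2 : (2 : ℤ) ^ m * (2 * c + 1) = 0 := by linarith
    rcases mul_eq_zero.1 h2 with h3 | h3
    · exact absurd h3 (by positivity)
    · omega
  intro m n h
  rcases lt_trichotomy m n with hmn | rfl | hmn
  · exact absurd h (hlt m n hmn)
  · rfl
  · exact absurd h.symm (hlt n m hmn)

/-- The coding map `Φ`, with values in the Gromov-Hausdorff space. -/
def codedTree (α : Seq4) : RootedGraph where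
  graph := codedGraph α
  zero_mem := (le_iSup (patch α) 0).1 (zero_mem_patch α 0)
  connected := ConnectedTo.iSup fun n => (patch_connectedTo α n).change (zero_mem_patch α n)
  infinite := by
    refine Set.Infinite.mono (s := Set.range fun n => skeleton α (n + 1)) ?_
      (Set.infinite_range_of_injective
        ((skeleton_injective α).comp (add_left_injective 1)))
    rintro _ ⟨n, rfl⟩
    exact (le_iSup (patch α) (n + 1)).1 (skeleton_mem α n)

/-! ### The Kenyon tree as a point of the Gromov-Hausdorff space -/

theorem kenyonTree_bound (n : ℕ) :
    ∀ p ∈ (kenyonTree n).verts, |p.1| + |p.2| ≤ 2 ^ (n + 1) := by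
  have hturn : ∀ (k : ℕ) (p : ℤ × ℤ), |(turn^[k] p).1| + |(turn^[k] p).2| = |p.1| + |p.2| := by
    intro k
    induction k with
    | zero => intro p; rfl
    | succ k ih =>
      intro p
      rw [Function.iterate_succ_apply, ih]
      simp [turn, add_comm]
  induction n with
  | zero =>
    intro p hp
    simp only [kenyonTree, SimpleGraph.Subgraph.induce_verts, Set.mem_insert_iff,
      Set.mem_singleton_iff] at hp
    rcases hp with rfl | rfl | rfl | rfl | rfl | rfl | rfl <;> norm_num
  | succ n ih =>
    intro p hp
    rw [kenyonTree, SimpleGraph.Subgraph.deleteVerts_verts, SimpleGraph.Subgraph.verts_iSup] at hp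
    obtain ⟨k, _, ⟨q, hq, rfl⟩, rfl⟩ := Set.mem_iUnion.1 hp.1
    have h1 := ih q hq
    change |(0 + turn^[k] (_ - 0) : ℤ × ℤ).1| + |(0 + turn^[k] (_ - 0) : ℤ × ℤ).2| ≤ _
    rw [zero_add, sub_zero, hturn]
    change |(q - (0, -2 ^ (n + 1))).1| + |(q - (0, -2 ^ (n + 1))).2| ≤ _
    simp only [Prod.fst_sub, Prod.snd_sub, sub_zero, sub_neg_eq_add]
    have h2 := abs_add_le q.2 (2 ^ (n + 1))
    rw [abs_of_nonneg (show (0 : ℤ) ≤ 2 ^ (n + 1) by positivity)] at h2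
    rw [pow_succ (2 : ℤ) (n + 1)]
    linarith

theorem deleteVerts_connectedTo {U : gridGraph.Subgraph} {a b a' b' c : ℤ × ℤ}
    (hU : ConnectedTo U c) (ha : ∀ v, U.Adj a v → v = a') (hb : ∀ v, U.Adj b v → v = b')
    (haa : a' ≠ a) (hab : a' ≠ b) (hba : b' ≠ a) (hbb : b' ≠ b) (hca : c ≠ a) (hcb : c ≠ b)
    (hne : b ≠ a) : ConnectedTo (U.deleteVerts {a, b}) c := by
  classical
  let f : ℤ × ℤ → ℤ × ℤ := fun v => if v = a then a' else if v = b then b' else v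
  have hf : ∀ v, f v ≠ a ∧ f v ≠ b := by
    intro v
    simp only [f]
    split_ifs with h1 h2
    · exact ⟨haa, hab⟩
    · exact ⟨hba, hbb⟩
    · exact ⟨h1, h2⟩
  have hid : ∀ v, v ≠ a → v ≠ b → f v = v := by
    intro v h1 h2
    simp [f, h1, h2]
  have hadj : ∀ u v, U.Adj u v → f u = f v ∨ U.Adj (f u) (f v) := by
    have hfa : f a = a' := by simp [f]
    have hfa' : f a' = a' := hid _ haa hab
    have hfb' : f b' = b' := hid _ hba hbb
    have hfb2 : f b = f b' := by rw [hfb']; simp [f, hne]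
    intro u v huv
    by_cases h1 : u = a
    · subst h1; left; rw [ha v huv, hfa, hfa']
    by_cases h2 : v = a
    · subst h2; left; rw [ha u huv.symm, hfa, hfa']
    by_cases h3 : u = b
    · subst h3; left; rw [hb v huv, hfb2]
    by_cases h4 : v = b
    · subst h4; left; rw [hb u huv.symm, hfb2]
    right
    rwa [hid u h1 h3, hid v h2 h4]
  have key : ∀ {u v}, U.spanningCoe.Walk u v →
      (U.deleteVerts {a, b}).spanningCoe.Reachable (f u) (f v) := by
    intro u v p
    induction p with
    | nil => exact SimpleGraph.Reachable.refl _
    | @cons u w v huw p ih =>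
      refine SimpleGraph.Reachable.trans ?_ ih
      rcases hadj u w huw with h | h
      · rw [h]
      · refine SimpleGraph.Adj.reachable ?_
        rw [SimpleGraph.Subgraph.spanningCoe_adj, SimpleGraph.Subgraph.deleteVerts_adj]
        have m1 := U.edge_vert h
        have m2 := U.edge_vert h.symm
        have := hf u
        have := hf w
        simp_all
  intro v hv
  rw [SimpleGraph.Subgraph.deleteVerts_verts] at hv
  obtain ⟨p⟩ := hU v hv.1
  have := key p
  rwa [hid c hca hcb, hid v (fun h => hv.2 (by simp [h])) (fun h => hv.2 (by simp [h]))] at this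

theorem kenyonTree_spec (n : ℕ) : ConnectedTo (kenyonTree n) 0 ∧
    (0, 2 ^ (n + 1)) ∈ (kenyonTree n).verts ∧ (0, -2 ^ (n + 1)) ∈ (kenyonTree n).verts := by
  induction n with
  | zero =>
    refine ⟨?_, by simp [kenyonTree], by simp [kenyonTree]⟩
    have hadj : ∀ p q : ℤ × ℤ, p ∈ (kenyonTree 0).verts → q ∈ (kenyonTree 0).verts →
        (∃ k, q = p + dir k) → (kenyonTree 0).spanningCoe.Reachable p q := by
      intro p q hp hq h
      refine SimpleGraph.Adj.reachable ?_
      exact ⟨hp, hq, gridGraph_adj.2 h⟩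
    have m : ∀ p ∈ ({(0, -2), (0, -1), (0, 0), (0, 1), (0, 2), (1, 0), (-1, 0)} : Set (ℤ × ℤ)),
        p ∈ (kenyonTree 0).verts := fun p hp => hp
    have r1 := hadj 0 (0, 1) (m _ (by simp [Prod.ext_iff])) (m _ (by simp)) ⟨1, rfl⟩
    have r2 := hadj (0, 1) (0, 2) (m _ (by simp)) (m _ (by simp)) ⟨1, rfl⟩
    have r3 := hadj 0 (0, -1) (m _ (by simp [Prod.ext_iff])) (m _ (by simp)) ⟨3, rfl⟩
    have r4 := hadj (0, -1) (0, -2) (m _ (by simp)) (m _ (by simp)) ⟨3, rfl⟩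
    have r5 := hadj 0 (1, 0) (m _ (by simp [Prod.ext_iff])) (m _ (by simp)) ⟨0, rfl⟩
    have r6 := hadj 0 (-1, 0) (m _ (by simp [Prod.ext_iff])) (m _ (by simp)) ⟨2, rfl⟩
    intro p hp
    simp only [kenyonTree, SimpleGraph.Subgraph.induce_verts, Set.mem_insert_iff,
      Set.mem_singleton_iff] at hp
    rcases hp with rfl | rfl | rfl | rfl | rfl | rfl | rfl
    · exact r3.trans r4
    · exact r3
    · exact SimpleGraph.Reachable.refl _
    · exact r1
    · exact r1.trans r2
    · exact r5
    · exact r6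
  | succ n ih =>
    obtain ⟨hc, hup, hdown⟩ := ih
    have hpos : (1 : ℤ) ≤ 2 ^ (n + 1) := one_le_pow₀ (by norm_num)
    have hpow : (2 : ℤ) ^ (n + 2) = 2 * 2 ^ (n + 1) := by ring
    set C := (kenyonTree n).map (shiftHom (0, -2 ^ (n + 1))) with hC
    set U := ⨆ k : Fin 4, C.map (rotHom 0 k) with hU
    have h0 : (0 : ℤ × ℤ) ∈ C.verts := ⟨_, hdown, by simp [shiftHom]⟩
    have htop : ((0, 2 ^ (n + 2)) : ℤ × ℤ) ∈ C.verts :=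
      ⟨_, hup, by simp [shiftHom]; ring⟩
    have hCc : ConnectedTo C 0 := (hc.map _).change h0
    have hUc : ConnectedTo U 0 := ConnectedTo.iSup fun k => by
      have := hCc.map (rotHom 0 k)
      rwa [rotHom_center] at this
    have mem : ∀ k : Fin 4, turn^[k.val] (0, 2 ^ (n + 2)) ∈ U.verts := by
      intro k
      rw [hU, SimpleGraph.Subgraph.verts_iSup]
      exact Set.mem_iUnion.2 ⟨k, _, htop, by simp [rotHom]⟩
    have hbound : ∀ p ∈ U.verts, |p.1| + |p.2| ≤ 2 ^ (n + 2) := by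
      intro p hp
      by_cases hpd : p ∈ ({(2 ^ (n + 2), 0), (-2 ^ (n + 2), 0)} : Set (ℤ × ℤ))
      · rcases hpd with rfl | rfl <;> simp
      · exact kenyonTree_bound (n + 1) p ⟨hp, hpd⟩
    refine ⟨?_, ?_, ?_⟩
    · rw [kenyonTree]
      refine deleteVerts_connectedTo (a' := (2 ^ (n + 2) - 1, 0)) (b' := (-2 ^ (n + 2) + 1, 0))
        hUc ?_ ?_ ?_ ?_ ?_ ?_ ?_ ?_ ?_
      · intro v hv
        obtain ⟨k, rfl⟩ := gridGraph_adj.1 (U.adj_sub hv)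
        have hb := hbound _ (U.edge_vert hv.symm)
        fin_cases k
        · simp [dir] at hb
          rw [abs_of_nonneg (by positivity)] at hb; omega
        · simp [dir] at hb
        · simp [dir]; ring
        · simp [dir] at hb
      · intro v hv
        obtain ⟨k, rfl⟩ := gridGraph_adj.1 (U.adj_sub hv)
        have hb := hbound _ (U.edge_vert hv.symm)
        fin_cases k
        · simp [dir]
        · simp [dir] at hb
        · simp [dir] at hb
          rw [abs_of_nonpos (by linarith)] at hb; omega
        · simp [dir] at hb
      all_goals
        simp only [ne_eq, Prod.mk.injEq, Prod.zero_eq_mk, and_true]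
        omega
    · refine ⟨mem 0, ?_⟩
      simp
    · refine ⟨mem 2, ?_⟩
      simp

/-- The Kenyon tree `T_∞` as a point of the Gromov-Hausdorff space. -/
def kenyon : RootedGraph where
  graph := kenyonGraph
  zero_mem := (le_iSup kenyonTree 0).1 (by simp [kenyonTree, Prod.ext_iff])
  connected := ConnectedTo.iSup fun n => (kenyonTree_spec n).1
  infinite := by
    refine Set.Infinite.mono (s := Set.range fun n : ℕ => ((0, 2 ^ (n + 1)) : ℤ × ℤ)) ?_
      (Set.infinite_range_of_injective ?_)
    · rintro _ ⟨n, rfl⟩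
      exact (le_iSup kenyonTree n).1 (kenyonTree_spec n).2.1
    · intro m n h
      simpa using h

/-- The Ghys-Kenyon minimal set `X`, the closure of the equivalence class of the Kenyon tree. -/
def hull : Set RootedGraph := closure {T | translationRel kenyon T}

/-- The relation `R` on `X`. -/
def hullRel : Setoid hull := translationRel.comap (↑)

/-- The set `X^{≤2}` of the trees of `X` with valency at most two at the origin. -/
def hullLe2 : Set hull := {T | T.1.valency ≤ 2}

/-- The set `Y^{≤2}` of the trees of `X^{≤2}` which are not equivalent to the Kenyon tree. -/
def codingRange : Set hull := {T | ¬ translationRel kenyon T} ∩ hullLe2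

/-! ### The cofinal relation -/

/-- Two sequences are cofinal if they agree from some index on. -/
def cofinalRel : Setoid Seq4 where
  r α β := ∃ n, ∀ m ≥ n, α m = β m
  iseqv := by
    refine ⟨fun α => ⟨0, fun _ _ => rfl⟩, ?_, ?_⟩
    · rintro α β ⟨n, h⟩
      exact ⟨n, fun m hm => (h m hm).symm⟩
    · rintro α β γ ⟨n, h⟩ ⟨k, h'⟩
      exact ⟨max n k, fun m hm =>
        (h m (le_trans (le_max_left _ _) hm)).trans (h' m (le_trans (le_max_right _ _) hm))⟩

/-- The uniform product measure on `{0,1,2,3}^ℕ`. -/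
noncomputable def mu4 : Measure Seq4 :=
  Measure.infinitePi fun _ : ℕ => (PMF.uniformOfFintype (Fin 4)).toMeasure

/-! ### Measured equivalence relations -/

section Measured

variable {α β : Type*} [MeasurableSpace α] [MeasurableSpace β]

/-- Discrete measurable equivalence relations: countable classes and Borel graph, on a standard
Borel space. -/
structure IsDiscreteMeasurable (r : Setoid α) : Prop where
  standardBorel : StandardBorelSpace α
  countable_class : ∀ x, {y | r x y}.Countable
  measurableSet_graph : MeasurableSet {p : α × α | r p.1 p.2}

/-- `μ` is invariant for `r`: for every Borel isomorphism `e : A → B` between Borel sets whose graph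
is contained in `r` and every Borel subset `B'` of `B`, one has `μ (e⁻¹ B') = μ B'`. -/
def IsInvariantMeasure (r : Setoid α) (μ : Measure α) : Prop :=
  ∀ (A B : Set α), MeasurableSet A → MeasurableSet B → ∀ e : A ≃ᵐ B, (∀ a : A, r a (e a)) →
    ∀ B' : Set α, MeasurableSet B' → B' ⊆ B → μ {x | ∃ h : x ∈ A, (e ⟨x, h⟩ : α) ∈ B'} = μ B'

/-- The union of the classes which meet `Y`. -/
def saturation (r : Setoid α) (Y : Set α) : Set α := {x | ∃ y ∈ Y, r x y}

/-- The map `φ` defines an orbit equivalence between `(r, α, μ)` and `(s, β, ν)`: it restricts to a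
Borel isomorphism `e` between saturated Borel sets `Z` and `Z'` of full measure which sends the
class of almost every point onto the class of its image, and the measure `μ` to a measure
equivalent to `ν`. -/
def IsOrbitEquivalence (r : Setoid α) (μ : Measure α) (s : Setoid β) (ν : Measure β)
    (φ : α → β) : Prop :=
  ∃ (Z : Set α) (Z' : Set β) (e : Z ≃ᵐ Z'),
    MeasurableSet Z ∧ saturation r Z = Z ∧ μ Zᶜ = 0 ∧
    MeasurableSet Z' ∧ saturation s Z' = Z' ∧ ν Z'ᶜ = 0 ∧
    (∀ z : Z, (e z : β) = φ z) ∧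
    (∀ᵐ x ∂μ, x ∈ Z → φ '' {y | r x y} = {y | s (φ x) y}) ∧
    (μ.comap ((↑) : Z → α)).map e ≪ ν.comap ((↑) : Z' → β) ∧
    ν.comap ((↑) : Z' → β) ≪ (μ.comap ((↑) : Z → α)).map e

/-- The map `φ : Y → Y'` defines a stable orbit equivalence between `(r, α, μ)` and `(s, β, ν)`:
`Y` and `Y'` are Borel sets whose saturations have full measure, and `φ` defines an orbit
equivalence between the relations (and measures) induced on `Y` and `Y'`. -/
structure IsStableOrbitEquivalence (r : Setoid α) (μ : Measure α) (s : Setoid β) (ν : Measure β)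
    {Y : Set α} {Y' : Set β} (φ : Y → Y') : Prop where
  discrete_left : IsDiscreteMeasurable r
  discrete_right : IsDiscreteMeasurable s
  measurableSet_left : MeasurableSet Y
  measurableSet_right : MeasurableSet Y'
  saturation_left : μ (saturation r Y)ᶜ = 0
  saturation_right : ν (saturation s Y')ᶜ = 0
  orbitEquivalence : IsOrbitEquivalence (r.comap ((↑) : Y → α)) (μ.comap (↑))
    (s.comap ((↑) : Y' → β)) (ν.comap (↑)) φ

end Measured

end GhysKenyon

open GhysKenyon

/-!
The proof rests on an arithmetic description of the trees. In the diagonal coordinates `U = x + y`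
and `W = x - y`, the Kenyon tree is the subgraph of the grid induced on the *balanced* points,
those for which `U` and `W` have the same 2-adic valuation (`kenyonTree_shape`, `mem_kenyonGraph`).
This common valuation is the level of the point. The patch `P_n` of a code is induced on the
balanced points of the open diamond `|U|, |W| < 2 ^ n`, translated to `x_n` (`patch_shape`), and
around a point of level `n` the Kenyon tree contains a copy of this diamond, which it can leave
only through its corners (`IsCenter.add_mem_balanced_iff`, `IsCenter.corner`).

As convergence in the Gromov-Hausdorff space is the coincidence of balls, these facts describe the
closure `X`. Coded trees belong to it, because the corners met by the Kenyon tree around a suitable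
centre are only the one prescribed by the code (`exists_center`, `codedTree_mem_hull`). Conversely,
let `T` be a limit of the Kenyon tree seen from points `v_N` of level zero. A limit `α` of the
codes of the `v_N` gives a coded tree contained in `T`; a vertex of `T` next to this coded tree but
outside it would be a limit of points whose levels tend to infinity, and then `T` would be
equivalent to the Kenyon tree. A vertex of positive level has neighbours of level zero in all
directions, so every point of `X` not equivalent to the Kenyon tree is a coded tree, with valency
at most two at its root, or the translate of a coded tree at the neighbour `dir 2` of its root,
with valency four (`hull_classification`). Since a coded tree determines its code
(`codedTree_injective`) and two coded trees are equivalent exactly when their codes are cofinal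
(`translationRel_codedTree_iff`), the complement in `X` of the countable class of the Kenyon tree
is parametrised, injectively, by the pairs of a code and of a mark in `Fin 2`, the mark `1` being
allowed when `dir 2` is a vertex of the coded tree (`markedTree`). As the Borel structure of `X` is
generated by the conditions `p ∈ T` (`measurable_of_mem_verts`), this parametrisation is Borel and
`X` is a standard Borel space.

The point `dir 2` is a vertex of the coded tree of `α` exactly when `α` begins with `0, …, 0, 2`;
this set has measure `4⁻¹ + 4⁻² + ⋯ = 1/3`, so the set of marked codes has measure `4/3` for the
product of `mu4` and of the counting measure. The normalised image of this measure is the invariant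
measure, and the trees of valency at most two, which correspond to the mark `0`, have measure
`3/4`. A partial Borel isomorphism contained in the relation becomes, on marked codes, countably
many translations by sequences of finite support and by marks, whence the invariance
(`isInvariantMeasure_hullMeasure`). Conversely, an invariant probability measure does not charge
the infinite class of the Kenyon tree; on the coded trees it is invariant by the translations of
finite support, hence proportional to `mu4` (`eq_smul_mu4`); and invariance determines it on the
other trees from its restriction to the coded trees (`eq_hullMeasure`).
-/

namespace GhysKenyon

/-! ### Dyadic valuations of integers -/

/-- The `2`-adic valuation of an integer, with value `⊤` at `0`. -/
noncomputable abbrev val2 (x : ℤ) : ℕ∞ := emultiplicity 2 x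

theorem val2_lt {n : ℕ} {x : ℤ} (h0 : x ≠ 0) (h : |x| < 2 ^ n) : val2 x < n := by
  rw [emultiplicity_lt_iff_not_dvd]
  exact fun hd => h0 (Int.eq_zero_of_abs_lt_dvd hd h)

theorem val2_eq_iff {n : ℕ} {x : ℤ} : val2 x = n ↔ ∃ k : ℤ, x = 2 ^ n * (2 * k + 1) := by
  rw [emultiplicity_eq_coe]
  constructor
  · rintro ⟨⟨y, rfl⟩, h⟩
    rcases Int.even_or_odd' y with ⟨k, rfl | rfl⟩
    · exact absurd ⟨k, by ring⟩ h
    · exact ⟨k, rfl⟩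
  · rintro ⟨k, rfl⟩
    refine ⟨dvd_mul_right _ _, ?_⟩
    rintro ⟨y, hy⟩
    rw [pow_succ, mul_assoc] at hy
    have := mul_left_cancel₀ (by positivity) hy
    omega

theorem le_val2_iff {n : ℕ} {x : ℤ} : (n : ℕ∞) ≤ val2 x ↔ ∃ k : ℤ, x = 2 ^ n * k := by
  rw [← pow_dvd_iff_le_emultiplicity]; rfl

theorem val2_zero : val2 0 = ⊤ := emultiplicity_zero _

theorem val2_eq_top {x : ℤ} (h : val2 x = ⊤) : x = 0 := by
  by_contra h0
  have : |x| < 2 ^ (|x|).toNat := by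
    have := Nat.lt_two_pow_self (n := |x|.toNat)
    zify at this
    rwa [Int.toNat_of_nonneg (abs_nonneg x)] at this
  have := val2_lt h0 this
  rw [h] at this
  exact absurd this (by simp)

theorem val2_neg (x : ℤ) : val2 (-x) = val2 x := emultiplicity_neg _ _

theorem val2_add_of_lt {x y : ℤ} (h : val2 y < val2 x) : val2 (x + y) = val2 y :=
  emultiplicity_add_of_gt h

theorem val2_add_of_lt' {x y : ℤ} (h : val2 x < val2 y) : val2 (x + y) = val2 x := by
  rw [add_comm]; exact val2_add_of_lt h

theorem lt_val2_add {n : ℕ} {x y : ℤ} (hx : val2 x = n) (hy : val2 y = n) :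
    ((n + 1 : ℕ) : ℕ∞) ≤ val2 (x + y) := by
  obtain ⟨a, rfl⟩ := val2_eq_iff.1 hx
  obtain ⟨b, rfl⟩ := val2_eq_iff.1 hy
  exact le_val2_iff.2 ⟨a + b + 1, by ring⟩

theorem val2_pow (n : ℕ) : val2 (2 ^ n) = n := val2_eq_iff.2 ⟨0, by ring⟩

/-- Near a point of valuation `n`, valuations are those of the displacement, truncated at `n`. -/
theorem val2_add_of_abs_lt {n : ℕ} {c x : ℤ} (hc : val2 c = n) (hx : |x| < 2 ^ n) :
    val2 (c + x) = min (n : ℕ∞) (val2 x) := by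
  rcases eq_or_ne x 0 with rfl | h0
  · rw [add_zero, val2_zero, hc, min_eq_left le_top]
  · have h := val2_lt h0 hx
    rw [val2_add_of_lt (by rwa [hc]), min_eq_right h.le]

theorem min_val2_eq_iff {n : ℕ} {x y : ℤ} (hx : |x| < 2 ^ n) (hy : |y| < 2 ^ n) :
    min (n : ℕ∞) (val2 x) = min (n : ℕ∞) (val2 y) ↔ val2 x = val2 y := by
  constructor
  · intro h
    rcases eq_or_ne x 0 with rfl | hx0 <;> rcases eq_or_ne y 0 with rfl | hy0
    · rfl
    · have := val2_lt hy0 hy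
      rw [val2_zero, min_eq_left le_top, min_eq_right this.le] at h
      exact absurd h.symm this.ne
    · have := val2_lt hx0 hx
      rw [val2_zero, min_eq_left le_top, min_eq_right this.le] at h
      exact absurd h this.ne
    · rwa [min_eq_right (val2_lt hx0 hx).le, min_eq_right (val2_lt hy0 hy).le] at h
  · intro h; rw [h]

/-! ### Diagonal coordinates -/

/-- The first diagonal coordinate of a point of `ℤ²`. -/
def diagU (p : ℤ × ℤ) : ℤ := p.1 + p.2

/-- The second diagonal coordinate of a point of `ℤ²`. -/
def diagW (p : ℤ × ℤ) : ℤ := p.1 - p.2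

theorem diagU_add (p q : ℤ × ℤ) : diagU (p + q) = diagU p + diagU q := by
  simp only [diagU, Prod.fst_add, Prod.snd_add]; ring

theorem diagW_add (p q : ℤ × ℤ) : diagW (p + q) = diagW p + diagW q := by
  simp only [diagW, Prod.fst_add, Prod.snd_add]; ring

theorem diagU_sub (p q : ℤ × ℤ) : diagU (p - q) = diagU p - diagU q := by
  simp only [diagU, Prod.fst_sub, Prod.snd_sub]; ring

theorem diagW_sub (p q : ℤ × ℤ) : diagW (p - q) = diagW p - diagW q := by
  simp only [diagW, Prod.fst_sub, Prod.snd_sub]; ring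

theorem diagU_neg (p : ℤ × ℤ) : diagU (-p) = -diagU p := by
  simp only [diagU, Prod.fst_neg, Prod.snd_neg]; ring

theorem diagW_neg (p : ℤ × ℤ) : diagW (-p) = -diagW p := by
  simp only [diagW, Prod.fst_neg, Prod.snd_neg]; ring

theorem diagU_smul (a : ℤ) (p : ℤ × ℤ) : diagU (a • p) = a * diagU p := by
  simp only [diagU, Prod.smul_fst, Prod.smul_snd, smul_eq_mul]; ring

theorem diagW_smul (a : ℤ) (p : ℤ × ℤ) : diagW (a • p) = a * diagW p := by
  simp only [diagW, Prod.smul_fst, Prod.smul_snd, smul_eq_mul]; ring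

theorem diag_ext {p q : ℤ × ℤ} (hu : diagU p = diagU q) (hw : diagW p = diagW q) : p = q := by
  simp only [diagU, diagW] at hu hw
  ext <;> omega

theorem diagU_turn (p : ℤ × ℤ) : diagU (turn p) = diagW p := by
  simp only [diagU, diagW, turn]; ring

theorem diagW_turn (p : ℤ × ℤ) : diagW (turn p) = -diagU p := by
  simp only [diagU, diagW, turn]; ring

theorem diagU_dir_mem (k : Fin 4) : diagU (dir k) = 1 ∨ diagU (dir k) = -1 := by
  fin_cases k <;> simp [diagU, dir]
theorem diagW_dir_mem (k : Fin 4) : diagW (dir k) = 1 ∨ diagW (dir k) = -1 := by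
  fin_cases k <;> simp [diagW, dir]

/-- The four unit vectors realise the four pairs of signs in diagonal coordinates. -/
theorem exists_dir {a b : ℤ} (ha : a = 1 ∨ a = -1) (hb : b = 1 ∨ b = -1) :
    ∃ k, diagU (dir k) = a ∧ diagW (dir k) = b := by
  rcases ha with rfl | rfl <;> rcases hb with rfl | rfl
  · exact ⟨0, rfl, rfl⟩
  · exact ⟨1, rfl, rfl⟩
  · exact ⟨3, rfl, rfl⟩
  · exact ⟨2, rfl, rfl⟩

theorem dir_injective : Function.Injective dir := by
  intro i j h
  fin_cases i <;> fin_cases j <;> simp_all [dir]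

/-- Points whose two diagonal coordinates have the same dyadic valuation: the vertex set of the
Kenyon tree. -/
def balanced : Set (ℤ × ℤ) := {p | val2 (diagU p) = val2 (diagW p)}

/-- The balanced points in the open diamond of radius `2 ^ n`. -/
def diamond (n : ℕ) : Set (ℤ × ℤ) :=
  {p | |diagU p| < 2 ^ n ∧ |diagW p| < 2 ^ n ∧ p ∈ balanced}

/-- Points whose two diagonal coordinates both have valuation `n`. They are the centres of the
patches of level `n` of the Kenyon tree, and they are called its points of level `n`; every nonzero
balanced point has a level. -/
def IsCenter (n : ℕ) (c : ℤ × ℤ) : Prop := val2 (diagU c) = n ∧ val2 (diagW c) = n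

theorem zero_mem_balanced : (0 : ℤ × ℤ) ∈ balanced := rfl

theorem IsCenter.mem_balanced {n : ℕ} {c : ℤ × ℤ} (h : IsCenter n c) : c ∈ balanced :=
  h.1.trans h.2.symm

theorem zero_mem_diamond (n : ℕ) : (0 : ℤ × ℤ) ∈ diamond n := by
  refine ⟨?_, ?_, zero_mem_balanced⟩ <;> simp [diagU, diagW]

theorem diamond_mono {m n : ℕ} (h : m ≤ n) : diamond m ⊆ diamond n := by
  have : (2 : ℤ) ^ m ≤ 2 ^ n := pow_le_pow_right₀ (by norm_num) h
  exact fun p hp => ⟨hp.1.trans_le this, hp.2.1.trans_le this, hp.2.2⟩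

theorem exists_mem_diamond {p : ℤ × ℤ} (hp : p ∈ balanced) : ∃ n, p ∈ diamond n := by
  have h : ∀ x : ℤ, |x| < 2 ^ (|x|).toNat := by
    intro x
    have := Nat.lt_two_pow_self (n := |x|.toNat)
    zify at this
    rwa [Int.toNat_of_nonneg (abs_nonneg x)] at this
  have hm : ∀ {m n : ℕ}, m ≤ n → (2 : ℤ) ^ m ≤ 2 ^ n := fun h => pow_le_pow_right₀ (by norm_num) h
  exact ⟨max (|diagU p|).toNat (|diagW p|).toNat, (h _).trans_le (hm (le_max_left _ _)),
    (h _).trans_le (hm (le_max_right _ _)), hp⟩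

theorem turn_mem_balanced {p : ℤ × ℤ} (h : p ∈ balanced) : turn p ∈ balanced := by
  simp only [balanced, mem_ofPred_eq, diagU_turn, diagW_turn, val2_neg] at h ⊢
  exact h.symm

theorem turn_mem_diamond {n : ℕ} {p : ℤ × ℤ} (h : p ∈ diamond n) : turn p ∈ diamond n := by
  refine ⟨?_, ?_, turn_mem_balanced h.2.2⟩
  · rw [diagU_turn]; exact h.2.1
  · rw [diagW_turn, abs_neg]; exact h.1

/-- In the open diamond of radius `2 ^ n` about a centre of level `n`, the Kenyon tree is a
translate of its central diamond. -/
theorem IsCenter.add_mem_balanced_iff {n : ℕ} {c q : ℤ × ℤ} (hc : IsCenter n c)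
    (hu : |diagU q| < 2 ^ n) (hw : |diagW q| < 2 ^ n) : c + q ∈ balanced ↔ q ∈ balanced := by
  simp only [balanced, mem_ofPred_eq, diagU_add, diagW_add]
  rw [val2_add_of_abs_lt hc.1 hu, val2_add_of_abs_lt hc.2 hw, min_val2_eq_iff hu hw]

/-- In the closed diamond about a centre of level `n`, the only possible boundary points of the
Kenyon tree are the four corners. -/
theorem IsCenter.corner {n : ℕ} {c q : ℤ × ℤ} (hc : IsCenter n c) (hcq : c + q ∈ balanced)
    (hu : |diagU q| ≤ 2 ^ n) (hw : |diagW q| ≤ 2 ^ n)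
    (h : ¬ (|diagU q| < 2 ^ n ∧ |diagW q| < 2 ^ n)) :
    |diagU q| = 2 ^ n ∧ |diagW q| = 2 ^ n := by
  have key : ∀ {a b x y : ℤ}, val2 a = n → val2 b = n → val2 (a + x) = val2 (b + y) →
      |x| = 2 ^ n → |y| ≤ 2 ^ n → |y| = 2 ^ n := by
    intro a b x y ha hb hab hx hy
    by_contra hne
    rw [val2_add_of_abs_lt hb (lt_of_le_of_ne hy hne)] at hab
    have h2 : val2 x = n := by
      rcases abs_eq (by positivity) |>.1 hx with rfl | rfl
      · exact val2_pow n
      · rw [val2_neg]; exact val2_pow n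
    have h1 := lt_val2_add ha h2
    rw [hab] at h1
    exact absurd (h1.trans (min_le_left _ _)) (by norm_cast; omega)
  simp only [balanced, mem_ofPred_eq, diagU_add, diagW_add] at hcq
  by_cases h1 : |diagU q| = 2 ^ n
  · exact ⟨h1, key hc.1 hc.2 hcq h1 hw⟩
  · have h2 : |diagW q| = 2 ^ n := by
      by_contra h2
      exact h ⟨lt_of_le_of_ne hu h1, lt_of_le_of_ne hw h2⟩
    exact ⟨key hc.2 hc.1 hcq.symm h2 hu, h2⟩

theorem abs_sub_two_pow_lt {n : ℕ} {x : ℤ} (h0 : x ≠ 0) (hx : |x| < 2 ^ (n + 1)) :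
    ∃ e : ℤ, (e = 1 ∨ e = -1) ∧ |x - 2 ^ n * e| < 2 ^ n := by
  rw [pow_succ, abs_lt] at hx
  have hp : (0 : ℤ) < 2 ^ n := by positivity
  rcases lt_or_gt_of_ne h0 with h | h
  · exact ⟨-1, Or.inr rfl, by rw [abs_lt]; constructor <;> omega⟩
  · exact ⟨1, Or.inl rfl, by rw [abs_lt]; constructor <;> omega⟩

theorem isCenter_smul_dir (n : ℕ) (k : Fin 4) : IsCenter n ((2 ^ n : ℤ) • dir k) := by
  constructor
  · rw [diagU_smul]
    rcases diagU_dir_mem k with h | h <;> rw [h]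
    · rw [mul_one]; exact val2_pow n
    · rw [mul_neg_one, val2_neg]; exact val2_pow n
  · rw [diagW_smul]
    rcases diagW_dir_mem k with h | h <;> rw [h]
    · rw [mul_one]; exact val2_pow n
    · rw [mul_neg_one, val2_neg]; exact val2_pow n

/-- A diamond consists of its centre and of four diamonds of half the radius. -/
theorem mem_diamond_succ {n : ℕ} {p : ℤ × ℤ} :
    p ∈ diamond (n + 1) ↔ p = 0 ∨ ∃ k, p - (2 ^ n : ℤ) • dir k ∈ diamond n := by
  constructor
  · rintro ⟨hu, hw, hb⟩
    by_cases h0 : diagU p = 0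
    · left
      have : diagW p = 0 := by
        apply val2_eq_top
        have : val2 (diagU p) = val2 (diagW p) := hb
        rw [← this, h0, val2_zero]
      exact diag_ext h0 this
    · right
      have h0' : diagW p ≠ 0 := by
        intro h
        apply h0
        apply val2_eq_top
        have : val2 (diagU p) = val2 (diagW p) := hb
        rw [this, h, val2_zero]
      obtain ⟨a, ha, hua⟩ := abs_sub_two_pow_lt h0 hu
      obtain ⟨b, hb', hwb⟩ := abs_sub_two_pow_lt h0' hw
      obtain ⟨k, rfl, rfl⟩ := exists_dir ha hb'
      rw [← diagU_smul, ← diagU_sub] at hua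
      rw [← diagW_smul, ← diagW_sub] at hwb
      refine ⟨k, hua, hwb, ?_⟩
      rw [← (isCenter_smul_dir n k).add_mem_balanced_iff hua hwb]
      rwa [add_sub_cancel]
  · rintro (rfl | ⟨k, hu, hw, hb⟩)
    · exact zero_mem_diamond _
    · have hc := isCenter_smul_dir n k
      rw [← hc.add_mem_balanced_iff hu hw, add_sub_cancel] at hb
      refine ⟨?_, ?_, hb⟩
      · rw [diagU_sub, diagU_smul, abs_lt] at hu
        rw [pow_succ, abs_lt]
        have := (show (0 : ℤ) < 2 ^ n by positivity)
        rcases diagU_dir_mem k with h | h <;> rw [h] at hu <;> constructor <;> linarith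
      · rw [diagW_sub, diagW_smul, abs_lt] at hw
        rw [pow_succ, abs_lt]
        have := (show (0 : ℤ) < 2 ^ n by positivity)
        rcases diagW_dir_mem k with h | h <;> rw [h] at hw <;> constructor <;> linarith

/-! ### Unions of rotated induced subgraphs -/

theorem turn_iterate_val_neg (k : Fin 4) (p : ℤ × ℤ) :
    turn^[k.val] (turn^[(-k).val] p) = p := by
  have h4 : ∀ p, turn (turn (turn (turn p))) = p := by intro p; simp [turn]
  match k with
  | 0 => rfl
  | 1 => exact h4 p
  | 2 => exact h4 p
  | 3 => exact h4 p

theorem turn_iterate_val_neg' (k : Fin 4) (p : ℤ × ℤ) :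
    turn^[(-k).val] (turn^[k.val] p) = p := by
  have := turn_iterate_val_neg (-k) p
  rwa [neg_neg] at this

theorem turn_iterate_zero (k : ℕ) : turn^[k] (0 : ℤ × ℤ) = 0 := by
  have := rotHom_center 0 k
  simpa [rotHom] using this

theorem turn_iterate_eq_zero {k : Fin 4} {p : ℤ × ℤ} (h : turn^[k.val] p = 0) : p = 0 := by
  rw [← turn_iterate_val_neg' k p, h, turn_iterate_zero]

theorem turn_iterate_mem_diamond {n : ℕ} {p : ℤ × ℤ} (h : p ∈ diamond n) (k : ℕ) :
    turn^[k] p ∈ diamond n := by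
  induction k with
  | zero => exact h
  | succ k ih => rw [Function.iterate_succ_apply']; exact turn_mem_diamond ih

theorem turn_iterate_mem_diamond_iff {n : ℕ} {p : ℤ × ℤ} (k : Fin 4) :
    turn^[k.val] p ∈ diamond n ↔ p ∈ diamond n := by
  refine ⟨fun h => ?_, fun h => turn_iterate_mem_diamond h _⟩
  rw [← turn_iterate_val_neg' k p]
  exact turn_iterate_mem_diamond h _

theorem rotHom_apply (c : ℤ × ℤ) (k : ℕ) (p : ℤ × ℤ) : rotHom c k p = c + turn^[k] (p - c) := rfl

theorem shiftHom_apply (v p : ℤ × ℤ) : shiftHom v p = p - v := rfl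

theorem rotHom_neg (c : ℤ × ℤ) (k : Fin 4) (p : ℤ × ℤ) :
    rotHom c k.val (rotHom c (-k).val p) = p := by
  rw [rotHom_apply, rotHom_apply, add_sub_cancel_left, turn_iterate_val_neg]; abel

theorem mem_iSup_rot {S : gridGraph.Subgraph} {c p : ℤ × ℤ} :
    p ∈ (⨆ k : Fin 4, S.map (rotHom c k)).verts ↔ ∃ k : Fin 4, rotHom c k p ∈ S.verts := by
  rw [SimpleGraph.Subgraph.verts_iSup, mem_iUnion]
  constructor
  · rintro ⟨k, q, hq, rfl⟩
    refine ⟨-k, ?_⟩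
    have := rotHom_neg c (-k) q
    rw [neg_neg] at this
    rwa [this]
  · rintro ⟨k, hk⟩
    refine ⟨-k, _, hk, ?_⟩
    have := rotHom_neg c (-k) p
    rwa [neg_neg] at this

/-- The open quadrant, in diagonal coordinates, which contains the unit vector `dir j`. -/
def quadrant (j : Fin 4) : Set (ℤ × ℤ) :=
  {p | 0 < diagU p * diagU (dir j) ∧ 0 < diagW p * diagW (dir j)}

theorem turn_mem_quadrant {j : Fin 4} {p : ℤ × ℤ} :
    turn p ∈ quadrant (j + 1) ↔ p ∈ quadrant j := by
  simp only [quadrant, mem_ofPred_eq, ← turn_dir, diagU_turn, diagW_turn, neg_mul_neg]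
  exact and_comm

theorem turn_iterate_mem_quadrant {j : Fin 4} {p : ℤ × ℤ} (k : Fin 4) :
    turn^[k.val] p ∈ quadrant (j + k) ↔ p ∈ quadrant j := by
  match k with
  | 0 => rw [add_zero]; rfl
  | 1 => exact turn_mem_quadrant
  | 2 =>
    rw [show j + 2 = j + 1 + 1 by abel]
    exact turn_mem_quadrant.trans turn_mem_quadrant
  | 3 =>
    rw [show j + 3 = j + 1 + 1 + 1 by abel]
    exact turn_mem_quadrant.trans (turn_mem_quadrant.trans turn_mem_quadrant)

/-- Adjacent points which lie off the diagonals, each in some quadrant, lie in the same one: in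
diagonal coordinates a unit step does not change a nonzero sign without passing by zero. -/
theorem quadrant_unique {i j m : Fin 4} {p : ℤ × ℤ} (hp : p ∈ quadrant i)
    (hq : p + dir m ∈ quadrant j) : i = j := by
  have key : ∀ {x e a b : ℤ}, (e = 1 ∨ e = -1) → (a = 1 ∨ a = -1) → (b = 1 ∨ b = -1) →
      0 < x * a → 0 < (x + e) * b → a = b := by
    rintro x e a b (rfl | rfl) (rfl | rfl) (rfl | rfl) h1 h2 <;> omega
  obtain ⟨h1, h2⟩ := hp
  obtain ⟨h3, h4⟩ := hq
  rw [diagU_add] at h3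
  rw [diagW_add] at h4
  exact dir_injective (diag_ext
    (key (diagU_dir_mem m) (diagU_dir_mem i) (diagU_dir_mem j) h1 h3)
    (key (diagW_dir_mem m) (diagW_dir_mem i) (diagW_dir_mem j) h2 h4))

/-- If an induced subgraph contains `c` and lies, apart from `c`, in one quadrant about `c`, then
the union of its four rotations about `c` is an induced subgraph: adjacent points distinct from `c`
lie in the same quadrant. -/
theorem isInduced_iSup_rot {S : gridGraph.Subgraph} {c : ℤ × ℤ} {j : Fin 4} (hS : S.IsInduced)
    (hc : c ∈ S.verts) (hq : ∀ p ∈ S.verts, p ≠ c → p - c ∈ quadrant j) :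
    (⨆ k : Fin 4, S.map (rotHom c k)).IsInduced := by
  have key : ∀ (k : Fin 4) (p q : ℤ × ℤ), gridGraph.Adj p q → rotHom c k p ∈ S.verts →
      rotHom c k q ∈ S.verts → (⨆ k : Fin 4, S.map (rotHom c k)).Adj p q := by
    intro k p q hpq hp hq
    rw [SimpleGraph.Subgraph.iSup_adj]
    refine ⟨-k, ?_⟩
    rw [SimpleGraph.Subgraph.map_adj]
    have h := rotHom_neg c (-k)
    simp only [neg_neg] at h
    exact ⟨_, _, hS hp hq ((rotHom c k).map_adj hpq), h p, h q⟩
  have hrot : ∀ (k : Fin 4) (p : ℤ × ℤ), p ≠ c → rotHom c k p ≠ c := by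
    intro k p hp h
    rw [rotHom_apply, add_eq_left] at h
    exact hp (sub_eq_zero.1 (turn_iterate_eq_zero h))
  intro p hp q hq' hpq
  obtain ⟨k, hk⟩ := mem_iSup_rot.1 hp
  obtain ⟨l, hl⟩ := mem_iSup_rot.1 hq'
  by_cases hpc : p = c
  · refine key l p q hpq ?_ hl
    rw [hpc, rotHom_center]; exact hc
  by_cases hqc : q = c
  · refine key k p q hpq hk ?_
    rw [hqc, rotHom_center]; exact hc
  have aux : ∀ (k : Fin 4) (p : ℤ × ℤ), p ≠ c → rotHom c k p ∈ S.verts →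
      p - c ∈ quadrant (j - k) := by
    intro k p hpc hk
    have := hq _ hk (hrot k p hpc)
    rw [rotHom_apply, add_sub_cancel_left] at this
    rwa [← turn_iterate_mem_quadrant k, sub_add_cancel]
  obtain ⟨m, rfl⟩ := gridGraph_adj.1 hpq
  have h1 := aux k _ hpc hk
  have h2 := aux l _ hqc hl
  rw [add_sub_right_comm] at h2
  have := sub_right_injective (quadrant_unique h1 h2)
  exact key k _ _ hpq hk (this ▸ hl)

theorem add_smul_dir_mem_quadrant {n : ℕ} {j : Fin 4} {q : ℤ × ℤ} (hu : |diagU q| < 2 ^ n)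
    (hw : |diagW q| < 2 ^ n) : q + (2 ^ n : ℤ) • dir j ∈ quadrant j := by
  rw [abs_lt] at hu hw
  constructor
  · rw [diagU_add, diagU_smul]
    rcases diagU_dir_mem j with h | h <;> rw [h] <;> linarith
  · rw [diagW_add, diagW_smul]
    rcases diagW_dir_mem j with h | h <;> rw [h] <;> linarith

/-! ### The shape of the patches and of the coded trees -/

theorem abs_diag_add_dir_le {n : ℕ} {q : ℤ × ℤ} (hq : q ∈ diamond n) {m : Fin 4} :
    |diagU (q + dir m)| ≤ 2 ^ n ∧ |diagW (q + dir m)| ≤ 2 ^ n := by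
  obtain ⟨hu, hw, -⟩ := hq
  rw [abs_lt] at hu hw
  rw [diagU_add, diagW_add, abs_le, abs_le]
  rcases diagU_dir_mem m with h | h <;> rcases diagW_dir_mem m with h' | h' <;> rw [h, h'] <;>
    refine ⟨⟨?_, ?_⟩, ?_, ?_⟩ <;> omega

/-- The patch of level `n` is the subgraph induced on a diamond about `x_n`. -/
theorem patch_shape (α : Seq4) (n : ℕ) :
    (∀ p, p ∈ (patch α n).verts ↔ p - skeleton α n ∈ diamond n) ∧ (patch α n).IsInduced := by
  induction n with
  | zero =>
    have h0 : ∀ p : ℤ × ℤ, p ∈ diamond 0 ↔ p = 0 := by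
      intro p
      refine ⟨fun h => diag_ext ?_ ?_, ?_⟩
      · have := h.1
        rw [pow_zero, Int.abs_lt_one_iff] at this
        exact this
      · have := h.2.1
        rw [pow_zero, Int.abs_lt_one_iff] at this
        exact this
      · rintro rfl; exact zero_mem_diamond 0
    constructor
    · intro p
      simp [patch, skeleton, h0]
    · intro p hp q hq hpq
      have h1 : p = 0 := by simpa [patch] using hp
      have h2 : q = 0 := by simpa [patch] using hq
      rw [h1, h2] at hpq
      exact absurd rfl hpq.ne
  | succ n ih =>
    obtain ⟨hv, hi⟩ := ih
    set c := skeleton α (n + 1) with hc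
    have hcn : skeleton α n = c - (2 ^ n : ℤ) • dir (α n) := by
      rw [hc, skeleton, add_sub_cancel_right]
    set S := patch α n ⊔ gridGraph.subgraphOfAdj (adj_skeleton α n) with hS
    have hSv : ∀ p, p ∈ S.verts ↔ p - skeleton α n ∈ diamond n ∨ p = c := by
      intro p
      rw [hS, SimpleGraph.Subgraph.verts_sup, mem_union, hv]
      simp only [SimpleGraph.subgraphOfAdj_verts, mem_insert_iff, mem_singleton_iff]
      constructor
      · rintro (h | rfl | h)
        · exact Or.inl h
        · left
          rw [← hv, ← skeleton_armEnd]
          exact armEnd_mem_patch α n (α n)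
        · exact Or.inr h
      · rintro (h | h)
        · exact Or.inl h
        · exact Or.inr (Or.inr h)
    -- the only point of the patch adjacent to the new centre is the end of the arm
    have hend : ∀ p, p - skeleton α n ∈ diamond n → gridGraph.Adj p c → S.Adj p c := by
      intro p hp hpc
      obtain ⟨m, hm⟩ := gridGraph_adj.1 hpc
      have hp2 : p = c - dir m := by rw [hm]; abel
      have : m = α n := by
        obtain ⟨hu, hw, -⟩ := hp
        rw [hp2, hcn, show c - dir m - (c - (2 ^ n : ℤ) • dir (α n))
          = (2 ^ n : ℤ) • dir (α n) - dir m by abel] at hu hw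
        rw [diagU_sub, diagU_smul, abs_lt] at hu
        rw [diagW_sub, diagW_smul, abs_lt] at hw
        refine dir_injective (diag_ext ?_ ?_)
        · rcases diagU_dir_mem m with h | h <;> rcases diagU_dir_mem (α n) with h' | h' <;>
            rw [h, h'] at hu ⊢ <;> omega
        · rcases diagW_dir_mem m with h | h <;> rcases diagW_dir_mem (α n) with h' | h' <;>
            rw [h, h'] at hw ⊢ <;> omega
      rw [hS, SimpleGraph.Subgraph.sup_adj]
      right
      rw [hp2, this]
      simp [hc]
    have hSi : S.IsInduced := by
      intro p hp q hq hpq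
      rcases (hSv p).1 hp with hp | rfl <;> rcases (hSv q).1 hq with hq | rfl
      · rw [hS, SimpleGraph.Subgraph.sup_adj]
        exact Or.inl (hi ((hv p).2 hp) ((hv q).2 hq) hpq)
      · exact hend p hp hpq
      · exact (hend q hq hpq.symm).symm
      · exact absurd rfl hpq.ne
    have hcS : c ∈ S.verts := (hSv c).2 (Or.inr rfl)
    constructor
    · intro p
      rw [patch, mem_iSup_rot, mem_diamond_succ]
      constructor
      · rintro ⟨k, hk⟩
        rcases (hSv _).1 hk with h | h
        · right
          refine ⟨α n - k + 2, ?_⟩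
          rw [← turn_iterate_mem_diamond_iff k]
          convert h using 1
          rw [rotHom_apply, hcn, dir_add_two, smul_neg, sub_neg_eq_add, turn_iterate_add,
            turn_iterate_smul_dir, sub_add_cancel]
          abel
        · left
          rw [rotHom_apply, add_eq_left] at h
          exact turn_iterate_eq_zero h
      · rintro (h | ⟨k, hk⟩)
        · exact ⟨0, (hSv _).2 (Or.inr (by rw [sub_eq_zero.1 h, rotHom_center]))⟩
        · refine ⟨α n + 2 - k, (hSv _).2 (Or.inl ?_)⟩
          rw [← turn_iterate_mem_diamond_iff (α n + 2 - k)] at hk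
          convert hk using 1
          rw [rotHom_apply, hcn, sub_eq_add_neg (p - c), ← smul_neg, ← dir_add_two,
            turn_iterate_add, turn_iterate_smul_dir]
          have : ∀ a k : Fin 4, k + 2 + (a + 2 - k) = a := by decide
          rw [this]
          abel
    · rw [patch]
      refine isInduced_iSup_rot (j := α n + 2) hSi hcS ?_
      intro p hp hpc
      rcases (hSv p).1 hp with h | h
      · have := add_smul_dir_mem_quadrant (j := α n + 2) h.1 h.2.1
        convert this using 1
        rw [hcn, dir_add_two, smul_neg]; abel
      · exact absurd h hpc

theorem mem_patch {α : Seq4} {n : ℕ} {p : ℤ × ℤ} :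
    p ∈ (patch α n).verts ↔ p - skeleton α n ∈ diamond n := (patch_shape α n).1 p

theorem patch_mono (α : Seq4) : Monotone (patch α) :=
  monotone_nat_of_le_succ (patch_le_succ α)

theorem mem_codedGraph {α : Seq4} {p : ℤ × ℤ} :
    p ∈ (codedGraph α).verts ↔ ∃ n, p - skeleton α n ∈ diamond n := by
  simp only [codedGraph, SimpleGraph.Subgraph.verts_iSup, mem_iUnion, mem_patch]

theorem codedGraph_isInduced (α : Seq4) : (codedGraph α).IsInduced := by
  intro p hp q hq hpq
  obtain ⟨m, hm⟩ := mem_codedGraph.1 hp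
  obtain ⟨n, hn⟩ := mem_codedGraph.1 hq
  rw [codedGraph, SimpleGraph.Subgraph.iSup_adj]
  refine ⟨max m n, (patch_shape α _).2 ?_ ?_ hpq⟩
  · exact (patch_mono α (le_max_left m n)).1 (mem_patch.2 hm)
  · exact (patch_mono α (le_max_right m n)).1 (mem_patch.2 hn)

/-! ### The shape of the Kenyon tree -/

theorem smul_dir_not_mem_diamond (n : ℕ) (k : Fin 4) : (2 ^ n : ℤ) • dir k ∉ diamond n := by
  intro h
  have := h.1
  rw [diagU_smul, abs_mul, abs_of_nonneg (by positivity)] at this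
  rcases diagU_dir_mem k with h | h <;> rw [h] at this <;> simp at this

theorem mem_diamond_one {p : ℤ × ℤ} : p ∈ diamond 1 ↔ p = 0 ∨ ∃ k, p = dir k := by
  have h0 : ∀ p : ℤ × ℤ, p ∈ diamond 0 ↔ p = 0 := by
    intro p
    have := mem_patch (α := fun _ => 0) (n := 0) (p := p)
    simpa [patch, skeleton] using this.symm
  rw [mem_diamond_succ]
  simp [h0, sub_eq_zero]

/-- The tree `T_{n+1}` is the subgraph induced on a diamond with its two vertical corners. -/
theorem kenyonTree_shape (n : ℕ) :
    (∀ p, p ∈ (kenyonTree n).verts ↔ p ∈ diamond (n + 1) ∨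
      p = (2 ^ (n + 1) : ℤ) • dir 1 ∨ p = (2 ^ (n + 1) : ℤ) • dir 3) ∧
    (kenyonTree n).IsInduced := by
  induction n with
  | zero =>
    constructor
    · rintro ⟨x, y⟩
      rw [zero_add, mem_diamond_one]
      simp only [kenyonTree, SimpleGraph.Subgraph.induce_verts, mem_insert_iff,
        mem_singleton_iff, Fin.exists_fin_succ, dir]
      simp [Prod.ext_iff]
      omega
    · intro p hp q hq hpq
      exact ⟨hp, hq, hpq⟩
  | succ n ih =>
    obtain ⟨hv, hi⟩ := ih
    set C := (kenyonTree n).map (shiftHom (0, -2 ^ (n + 1))) with hC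
    have hd : ((0, -2 ^ (n + 1)) : ℤ × ℤ) = -((2 ^ (n + 1) : ℤ) • dir 1) := by simp [dir]
    have hsh : ∀ p, shiftHom (0, -2 ^ (n + 1)) p = p + (2 ^ (n + 1) : ℤ) • dir 1 := by
      intro p; rw [shiftHom_apply, hd, sub_neg_eq_add]
    have hd3 : dir 3 = -dir 1 := by rw [← dir_add_two]; rfl
    have hCv : ∀ p, p ∈ C.verts ↔ p - (2 ^ (n + 1) : ℤ) • dir 1 ∈ diamond (n + 1) ∨
        p = (2 ^ (n + 2) : ℤ) • dir 1 ∨ p = 0 := by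
      intro p
      have : p ∈ C.verts ↔ p - (2 ^ (n + 1) : ℤ) • dir 1 ∈ (kenyonTree n).verts := by
        rw [hC, SimpleGraph.Subgraph.map_verts]
        constructor
        · rintro ⟨q, hq, rfl⟩
          rwa [hsh, add_sub_cancel_right]
        · intro h
          exact ⟨_, h, by rw [hsh, sub_add_cancel]⟩
      rw [this, hv, sub_eq_iff_eq_add, sub_eq_iff_eq_add, hd3, smul_neg, neg_add_cancel,
        ← add_smul, ← two_mul, ← pow_succ']
    have hCi : C.IsInduced := by
      rintro _ ⟨p, hp, rfl⟩ _ ⟨q, hq, rfl⟩ hpq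
      rw [hC, SimpleGraph.Subgraph.map_adj]
      refine ⟨p, q, hi hp hq ?_, rfl, rfl⟩
      obtain ⟨m, hm⟩ := gridGraph_adj.1 hpq
      rw [hsh, hsh] at hm
      refine gridGraph_adj.2 ⟨m, ?_⟩
      rw [add_right_comm] at hm
      exact add_right_cancel hm
    have hC0 : (0 : ℤ × ℤ) ∈ C.verts := (hCv 0).2 (Or.inr (Or.inr rfl))
    set U := ⨆ k : Fin 4, C.map (rotHom 0 k) with hU
    have hUi : U.IsInduced := by
      refine isInduced_iSup_rot (j := 1) hCi hC0 ?_
      intro p hp hp0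
      rw [sub_zero]
      rcases (hCv p).1 hp with h | rfl | h
      · have := add_smul_dir_mem_quadrant (j := 1) h.1 h.2.1
        rwa [sub_add_cancel] at this
      · have := add_smul_dir_mem_quadrant (j := 1) (zero_mem_diamond (n + 2)).1
          (zero_mem_diamond (n + 2)).2.1
        rwa [zero_add] at this
      · exact absurd h hp0
    have hUv : ∀ p, p ∈ U.verts ↔ p ∈ diamond (n + 2) ∨ ∃ k, p = (2 ^ (n + 2) : ℤ) • dir k := by
      intro p
      rw [hU, mem_iSup_rot]
      have hr : ∀ k : Fin 4, rotHom 0 k p = turn^[k.val] p := by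
        intro k; rw [rotHom_apply, sub_zero, zero_add]
      simp only [hr, hCv]
      constructor
      · rintro ⟨k, h | h | h⟩
        · left
          rw [mem_diamond_succ]
          right
          refine ⟨1 - k, ?_⟩
          rw [← turn_iterate_mem_diamond_iff k, sub_eq_add_neg, ← smul_neg, ← dir_add_two,
            turn_iterate_add, turn_iterate_smul_dir]
          convert h using 1
          rw [show 1 - k + 2 + k = 1 + 2 by abel, dir_add_two, smul_neg, sub_eq_add_neg]
        · right
          refine ⟨1 + -k, ?_⟩
          rw [← turn_iterate_val_neg' k p, h, turn_iterate_smul_dir]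
        · left
          rw [turn_iterate_eq_zero h]
          exact zero_mem_diamond _
      · rintro (h | ⟨k, rfl⟩)
        · rcases mem_diamond_succ.1 h with rfl | ⟨k, hk⟩
          · exact ⟨0, Or.inr (Or.inr rfl)⟩
          · refine ⟨1 - k, Or.inl ?_⟩
            rw [← turn_iterate_mem_diamond_iff (1 - k), sub_eq_add_neg p, ← smul_neg,
              ← dir_add_two, turn_iterate_add, turn_iterate_smul_dir] at hk
            convert hk using 1
            rw [show k + 2 + (1 - k) = 1 + 2 by abel, dir_add_two, smul_neg, sub_eq_add_neg]
        · refine ⟨1 - k, Or.inr (Or.inl ?_)⟩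
          rw [turn_iterate_smul_dir, add_sub_cancel]
    have e0 : ((2 ^ (n + 2), 0) : ℤ × ℤ) = (2 ^ (n + 2) : ℤ) • dir 0 := by simp [dir]
    have e2 : ((-2 ^ (n + 2), 0) : ℤ × ℤ) = (2 ^ (n + 2) : ℤ) • dir 2 := by simp [dir]
    have hinj : ∀ i j : Fin 4, (2 ^ (n + 2) : ℤ) • dir i = (2 ^ (n + 2) : ℤ) • dir j → i = j := by
      intro i j h
      exact dir_injective (smul_right_injective _ (by positivity : (2 ^ (n + 2) : ℤ) ≠ 0) h)
    constructor
    · intro p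
      rw [kenyonTree, SimpleGraph.Subgraph.deleteVerts_verts, mem_sdiff, ← hU, hUv, e0, e2]
      simp only [mem_insert_iff, mem_singleton_iff]
      constructor
      · rintro ⟨h | ⟨k, rfl⟩, hn⟩
        · exact Or.inl h
        · right
          fin_cases k
          · exact absurd (Or.inl rfl) hn
          · exact Or.inl rfl
          · exact absurd (Or.inr rfl) hn
          · exact Or.inr rfl
      · rintro (h | rfl | rfl)
        · refine ⟨Or.inl h, ?_⟩
          rintro (rfl | rfl) <;> exact smul_dir_not_mem_diamond _ _ h
        · refine ⟨Or.inr ⟨1, rfl⟩, ?_⟩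
          rintro (h | h) <;> exact absurd (hinj _ _ h) (by decide)
        · refine ⟨Or.inr ⟨3, rfl⟩, ?_⟩
          rintro (h | h) <;> exact absurd (hinj _ _ h) (by decide)
    · rw [kenyonTree]
      intro p hp q hq hpq
      rw [SimpleGraph.Subgraph.deleteVerts_verts] at hp hq
      rw [SimpleGraph.Subgraph.deleteVerts_adj]
      exact ⟨hp.1, hp.2, hq.1, hq.2, hUi hp.1 hq.1 hpq⟩

theorem mem_kenyonGraph {p : ℤ × ℤ} : p ∈ kenyonGraph.verts ↔ p ∈ balanced := by
  simp only [kenyonGraph, SimpleGraph.Subgraph.verts_iSup, mem_iUnion, (kenyonTree_shape _).1]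
  constructor
  · rintro ⟨n, h | rfl | rfl⟩
    · exact h.2.2
    · exact (isCenter_smul_dir _ _).mem_balanced
    · exact (isCenter_smul_dir _ _).mem_balanced
  · intro h
    obtain ⟨n, hn⟩ := exists_mem_diamond h
    exact ⟨n, Or.inl (diamond_mono (Nat.le_succ n) hn)⟩

theorem kenyonGraph_isInduced : kenyonGraph.IsInduced := by
  intro p hp q hq hpq
  obtain ⟨m, hm⟩ := exists_mem_diamond (mem_kenyonGraph.1 hp)
  obtain ⟨n, hn⟩ := exists_mem_diamond (mem_kenyonGraph.1 hq)
  rw [kenyonGraph, SimpleGraph.Subgraph.iSup_adj]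
  refine ⟨max m n, (kenyonTree_shape _).2 ?_ ?_ hpq⟩
  · exact ((kenyonTree_shape _).1 p).2 (Or.inl (diamond_mono (by omega) hm))
  · exact ((kenyonTree_shape _).1 q).2 (Or.inl (diamond_mono (by omega) hn))

open RootedGraph

/-! ### Balls and translates of rooted graphs -/

theorem adj_iff_of_isInduced {H : gridGraph.Subgraph} (h : H.IsInduced) {p q : ℤ × ℤ} :
    H.Adj p q ↔ p ∈ H.verts ∧ q ∈ H.verts ∧ gridGraph.Adj p q :=
  ⟨fun hpq => ⟨H.edge_vert hpq, H.edge_vert hpq.symm, H.adj_sub hpq⟩,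
    fun hpq => h hpq.1 hpq.2.1 hpq.2.2⟩

namespace RootedGraph

theorem height_zero (T : RootedGraph) : T.height 0 = 0 := SimpleGraph.edist_self

theorem height_lt_succ {T : RootedGraph} {v : ℤ × ℤ} {n : ℕ} :
    T.height v < (n + 1 : ℕ) ↔ v = 0 ∨ ∃ u, T.height u < n ∧ T.graph.Adj u v := by
  constructor
  · intro h
    obtain ⟨p, hp⟩ := SimpleGraph.exists_walk_of_edist_ne_top (ne_top_of_lt h)
    have hlen : p.reverse.length < n + 1 := by
      rw [SimpleGraph.Walk.length_reverse]
      have : (p.length : ℕ∞) < (n + 1 : ℕ) := by rw [hp]; exact h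
      exact_mod_cast this
    generalize p.reverse = q at hlen
    cases q with
    | nil => exact Or.inl rfl
    | @cons _ u _ hvu q =>
      right
      refine ⟨u, ?_, by simpa using hvu.symm⟩
      rw [SimpleGraph.Walk.length_cons] at hlen
      calc T.height u ≤ q.reverse.length := SimpleGraph.edist_le _
        _ < n := by rw [SimpleGraph.Walk.length_reverse]; exact_mod_cast (by omega)
  · rintro (rfl | ⟨u, hu, huv⟩)
    · rw [height_zero]; exact_mod_cast Nat.succ_pos n
    · have h1 : T.height v ≤ T.height u + 1 := by
        refine (SimpleGraph.edist_triangle (v := u)).trans ?_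
        unfold height
        gcongr
        exact le_of_eq (SimpleGraph.edist_eq_one_iff_adj.2 (by simpa using huv))
      refine h1.trans_lt ?_
      push_cast
      exact (ENat.add_lt_add_iff_right (by simp)).2 hu

theorem not_height_lt_zero {T : RootedGraph} {v : ℤ × ℤ} : ¬ T.height v < (0 : ℕ) := by simp

theorem mem_verts_of_height_lt {T : RootedGraph} {v : ℤ × ℤ} {n : ℕ} (h : T.height v < n) :
    v ∈ T.graph.verts := by
  cases n with
  | zero => exact absurd h not_height_lt_zero
  | succ n =>
    rcases height_lt_succ.1 h with rfl | ⟨u, -, hu⟩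
    · exact T.zero_mem
    · exact T.graph.edge_vert hu.symm

theorem exists_height_lt {T : RootedGraph} {v : ℤ × ℤ} (h : v ∈ T.graph.verts) :
    ∃ n : ℕ, T.height v < n := by
  obtain ⟨n, hn⟩ := ENat.ne_top_iff_exists.1 (T.height_ne_top h)
  exact ⟨n + 1, by rw [← hn]; exact_mod_cast Nat.lt_succ_self n⟩

/-- If two graphs have the same edges at the points of a set which contains the ball of radius `N`
of the first, then their balls of radius `N` coincide. -/
theorem openBall_eq_of_adj_iff {T T' : RootedGraph} {N : ℕ} (S : Set (ℤ × ℤ))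
    (hS : ∀ v, T.height v < N → v ∈ S) (hadj : ∀ v ∈ S, ∀ p, T.graph.Adj v p ↔ T'.graph.Adj v p) :
    T.openBall N = T'.openBall N := by
  have key : ∀ n ≤ N, ∀ v, T.height v < n ↔ T'.height v < n := by
    intro n
    induction n with
    | zero => intro _ v; exact iff_of_false not_height_lt_zero not_height_lt_zero
    | succ n ih =>
      intro hn v
      rw [height_lt_succ, height_lt_succ]
      refine or_congr_right (exists_congr fun u => ?_)
      rw [← ih (by omega) u]
      refine and_congr_right fun hu => hadj u (hS u (hu.trans_le ?_)) v
      exact_mod_cast (by omega)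
  refine Prod.ext (Set.ext fun v => ?_) (Set.ext fun e => ?_)
  · exact ⟨fun h => ⟨mem_verts_of_height_lt ((key N le_rfl v).1 h.2), (key N le_rfl v).1 h.2⟩,
      fun h => ⟨mem_verts_of_height_lt ((key N le_rfl v).2 h.2), (key N le_rfl v).2 h.2⟩⟩
  · exact ⟨fun h => ⟨(hadj _ (hS _ h.2) _).1 h.1, (key N le_rfl _).1 h.2⟩,
      fun h => ⟨(hadj _ (hS _ ((key N le_rfl _).2 h.2)) _).2 h.1, (key N le_rfl _).2 h.2⟩⟩

theorem height_lt_iff_of_openBall_eq {T T' : RootedGraph} {N : ℕ} (h : T.openBall N = T'.openBall N)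
    (v : ℤ × ℤ) : T.height v < N ↔ T'.height v < N := by
  have key : ∀ {S S' : RootedGraph}, S.openBall N = S'.openBall N → S.height v < N →
      S'.height v < N := by
    intro S S' h hv
    have : v ∈ (S'.openBall N).1 := h ▸ ⟨mem_verts_of_height_lt hv, hv⟩
    exact this.2
  exact ⟨key h, key h.symm⟩

theorem adj_iff_of_openBall_eq {T T' : RootedGraph} {N : ℕ} (h : T.openBall N = T'.openBall N)
    {v : ℤ × ℤ} (hv : T.height v < N) (p : ℤ × ℤ) : T.graph.Adj v p ↔ T'.graph.Adj v p := by
  constructor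
  · intro hp
    have : (v, p) ∈ (T'.openBall N).2 := h ▸ ⟨hp, hv⟩
    exact this.1
  · intro hp
    have : (v, p) ∈ (T.openBall N).2 := h ▸ ⟨hp, (height_lt_iff_of_openBall_eq h v).1 hv⟩
    exact this.1

/-- The translate `T - v` of `T` at one of its vertices. -/
def shift (T : RootedGraph) (v : ℤ × ℤ) (hv : v ∈ T.graph.verts) : RootedGraph where
  graph := T.graph.map (shiftHom v)
  zero_mem := ⟨v, hv, sub_self v⟩
  connected := by
    have h : ConnectedTo T.graph 0 := T.connected
    have := (h.change hv).map (shiftHom v)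
    rwa [shiftHom_apply, sub_self] at this
  infinite := T.infinite.image (sub_left_injective (b := v)).injOn

variable {T T' : RootedGraph} {v : ℤ × ℤ}

theorem mem_shift {hv : v ∈ T.graph.verts} {p : ℤ × ℤ} :
    p ∈ (T.shift v hv).graph.verts ↔ p + v ∈ T.graph.verts := by
  constructor
  · rintro ⟨q, hq, rfl⟩
    rwa [shiftHom_apply, sub_add_cancel]
  · intro h
    exact ⟨_, h, by rw [shiftHom_apply, add_sub_cancel_right]⟩

theorem shift_adj {hv : v ∈ T.graph.verts} {p q : ℤ × ℤ} :
    (T.shift v hv).graph.Adj p q ↔ T.graph.Adj (p + v) (q + v) := by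
  constructor
  · rintro ⟨a, b, hab, rfl, rfl⟩
    rwa [shiftHom_apply, shiftHom_apply, sub_add_cancel, sub_add_cancel]
  · intro h
    exact ⟨_, _, h, by rw [shiftHom_apply, add_sub_cancel_right],
      by rw [shiftHom_apply, add_sub_cancel_right]⟩

theorem translationRel_iff : translationRel T T' ↔ ∃ v hv, T' = T.shift v hv :=
  ⟨fun ⟨v, hv, h⟩ => ⟨v, hv, RootedGraph.ext h⟩, fun ⟨v, hv, h⟩ => ⟨v, hv, by rw [h]; rfl⟩⟩

theorem translationRel_shift (hv : v ∈ T.graph.verts) : translationRel T (T.shift v hv) :=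
  ⟨v, hv, rfl⟩

theorem shift_shift {w : ℤ × ℤ} (hv : v ∈ T.graph.verts) (hw : w ∈ (T.shift v hv).graph.verts) :
    (T.shift v hv).shift w hw = T.shift (w + v) (mem_shift.1 hw) := by
  apply RootedGraph.ext
  refine SimpleGraph.Subgraph.ext ?_ ?_
  · ext p
    rw [mem_shift, mem_shift, mem_shift, add_assoc]
  · ext p q
    rw [shift_adj, shift_adj, shift_adj, add_assoc, add_assoc]

theorem shift_zero (T : RootedGraph) : T.shift 0 T.zero_mem = T := by
  apply RootedGraph.ext
  refine SimpleGraph.Subgraph.ext ?_ ?_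
  · ext p
    rw [mem_shift, add_zero]
  · ext p q
    rw [shift_adj, add_zero, add_zero]

theorem shift_congr {w : ℤ × ℤ} {hv : v ∈ T.graph.verts} (h : v = w) :
    T.shift v hv = T.shift w (h ▸ hv) := by
  subst h; rfl

theorem shift_isInduced {hv : v ∈ T.graph.verts} (h : T.graph.IsInduced) :
    (T.shift v hv).graph.IsInduced := by
  intro p hp q hq hpq
  rw [shift_adj]
  refine h (mem_shift.1 hp) (mem_shift.1 hq) ?_
  obtain ⟨m, rfl⟩ := gridGraph_adj.1 hpq
  exact gridGraph_adj.2 ⟨m, by abel⟩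

theorem ext_of_isInduced (h : T.graph.IsInduced) (h' : T'.graph.IsInduced)
    (hv : ∀ p, p ∈ T.graph.verts ↔ p ∈ T'.graph.verts) : T = T' := by
  apply RootedGraph.ext
  refine SimpleGraph.Subgraph.ext (Set.ext hv) ?_
  ext p q
  rw [adj_iff_of_isInduced h, adj_iff_of_isInduced h', hv, hv]

theorem height_lt_of_shift {hv : v ∈ T.graph.verts} {k : ℕ} (hk : T.height v ≤ k) {N : ℕ}
    {p : ℤ × ℤ} (hp : (T.shift v hv).height p < N) : T.height (p + v) < (N + k : ℕ) := by
  induction N generalizing p with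
  | zero => exact absurd hp not_height_lt_zero
  | succ N ih =>
    rcases height_lt_succ.1 hp with rfl | ⟨u, hu, hup⟩
    · rw [zero_add]
      exact hk.trans_lt (by exact_mod_cast (by omega))
    · rw [show N + 1 + k = N + k + 1 by ring]
      exact height_lt_succ.2 (Or.inr ⟨_, ih hu, shift_adj.1 hup⟩)

theorem shift_openBall_eq {hv : v ∈ T.graph.verts} {hv' : v ∈ T'.graph.verts} {N k : ℕ}
    (hk : T.height v ≤ k) (h : T.openBall (N + k) = T'.openBall (N + k)) :
    (T.shift v hv).openBall N = (T'.shift v hv').openBall N := by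
  refine openBall_eq_of_adj_iff {p | T.height (p + v) < (N + k : ℕ)}
    (fun p hp => height_lt_of_shift hk hp) ?_
  intro p hp q
  rw [shift_adj, shift_adj, adj_iff_of_openBall_eq h hp]

theorem dist_le_of_openBall_eq {N : ℕ} (hN : 1 ≤ N) (h : T.openBall N = T'.openBall N) :
    dist T T' ≤ Real.exp (-(N : ℝ)) := by
  have hle : (N : ℕ∞) ≤ agreement T T' := le_iSup₂_of_le N ⟨hN, h⟩ le_rfl
  rw [dist_def]
  split_ifs with htop
  · positivity
  · rw [Real.exp_le_exp, neg_le_neg_iff]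
    rw [← ENat.natCast_toNat htop] at hle
    exact_mod_cast hle

theorem openBall_eq_of_dist_lt {N : ℕ} (h : dist T T' < Real.exp (-(N : ℝ))) :
    T.openBall N = T'.openBall N := by
  have hlt : (N : ℕ∞) < agreement T T' := by
    rw [dist_def] at h
    split_ifs at h with htop
    · rw [htop]; exact ENat.natCast_lt_top N
    · rw [Real.exp_lt_exp, neg_lt_neg_iff] at h
      rw [← ENat.natCast_toNat htop]
      exact_mod_cast h
  obtain ⟨M, hM, -, hb⟩ := exists_of_lt_agreement hlt
  exact openBall_eq_mono (by exact_mod_cast hM.le) hb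

theorem mem_closure_iff_openBall {A : Set RootedGraph} :
    T ∈ closure A ↔ ∀ N : ℕ, ∃ T' ∈ A, T.openBall N = T'.openBall N := by
  rw [Metric.mem_closure_iff]
  constructor
  · intro h N
    obtain ⟨T', hT', hd⟩ := h _ (Real.exp_pos (-(N : ℝ)))
    exact ⟨T', hT', openBall_eq_of_dist_lt hd⟩
  · intro h e he
    obtain ⟨n, hn⟩ := exists_nat_gt (-Real.log e)
    obtain ⟨T', hT', hb⟩ := h (n + 1)
    refine ⟨T', hT', (dist_le_of_openBall_eq (by omega) hb).trans_lt ?_⟩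
    rw [← Real.lt_log_iff_exp_lt he]
    push_cast
    linarith

end RootedGraph

/-! ### The hull of the Kenyon tree -/

/-- The Kenyon tree, seen from one of its vertices. -/
def kenyonAt (v : ℤ × ℤ) (hv : v ∈ balanced) : RootedGraph :=
  kenyon.shift v (mem_kenyonGraph.2 hv)

theorem mem_kenyonAt {v : ℤ × ℤ} {hv : v ∈ balanced} {p : ℤ × ℤ} :
    p ∈ (kenyonAt v hv).graph.verts ↔ p + v ∈ balanced :=
  mem_shift.trans mem_kenyonGraph

theorem kenyonAt_isInduced (v : ℤ × ℤ) (hv : v ∈ balanced) : (kenyonAt v hv).graph.IsInduced :=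
  shift_isInduced kenyonGraph_isInduced

theorem kenyonAt_adj {v : ℤ × ℤ} {hv : v ∈ balanced} {p q : ℤ × ℤ} :
    (kenyonAt v hv).graph.Adj p q ↔ p + v ∈ balanced ∧ q + v ∈ balanced ∧ gridGraph.Adj p q := by
  rw [adj_iff_of_isInduced (kenyonAt_isInduced v hv), mem_kenyonAt, mem_kenyonAt]

theorem translationRel_kenyon_iff {T : RootedGraph} :
    translationRel kenyon T ↔ ∃ v hv, T = kenyonAt v hv := by
  rw [translationRel_iff]
  exact ⟨fun ⟨v, hv, h⟩ => ⟨v, mem_kenyonGraph.1 hv, h⟩,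
    fun ⟨v, hv, h⟩ => ⟨v, mem_kenyonGraph.2 hv, h⟩⟩

theorem mem_hull_iff {T : RootedGraph} :
    T ∈ hull ↔ ∀ N : ℕ, ∃ v hv, T.openBall N = (kenyonAt v hv).openBall N := by
  rw [hull, mem_closure_iff_openBall]
  refine forall_congr' fun N => ?_
  constructor
  · rintro ⟨T', hT', h⟩
    obtain ⟨v, hv, rfl⟩ := translationRel_kenyon_iff.1 hT'
    exact ⟨v, hv, h⟩
  · rintro ⟨v, hv, h⟩
    exact ⟨_, translationRel_kenyon_iff.2 ⟨v, hv, rfl⟩, h⟩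

theorem hull_isInduced {T : RootedGraph} (hT : T ∈ hull) : T.graph.IsInduced := by
  intro p hp q hq hpq
  obtain ⟨m, hm⟩ := exists_height_lt hp
  obtain ⟨n, hn⟩ := exists_height_lt hq
  obtain ⟨v, hv, h⟩ := mem_hull_iff.1 hT (max m n)
  have hm' : T.height p < (max m n : ℕ) := hm.trans_le (by exact_mod_cast le_max_left m n)
  have hn' : T.height q < (max m n : ℕ) := hn.trans_le (by exact_mod_cast le_max_right m n)
  rw [adj_iff_of_openBall_eq h hm']
  refine kenyonAt_isInduced v hv ?_ ?_ hpq
  · exact mem_verts_of_height_lt ((height_lt_iff_of_openBall_eq h p).1 hm')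
  · exact mem_verts_of_height_lt ((height_lt_iff_of_openBall_eq h q).1 hn')

theorem shift_mem_hull {T : RootedGraph} (hT : T ∈ hull) {v : ℤ × ℤ} (hv : v ∈ T.graph.verts) :
    T.shift v hv ∈ hull := by
  rw [mem_hull_iff] at hT ⊢
  intro N
  obtain ⟨k, hk⟩ := exists_height_lt hv
  obtain ⟨w, hw, h⟩ := hT (N + k)
  have hv' : v ∈ (kenyonAt w hw).graph.verts := by
    refine mem_verts_of_height_lt ((height_lt_iff_of_openBall_eq h v).1 (hk.trans_le ?_))
    exact_mod_cast (by omega)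
  refine ⟨v + w, mem_kenyonAt.1 hv', ?_⟩
  rw [shift_openBall_eq (hv' := hv') hk.le h]
  exact congrArg (fun S => S.openBall N) (shift_shift _ _)

theorem codedTree_isInduced (α : Seq4) : (codedTree α).graph.IsInduced := codedGraph_isInduced α

theorem mem_codedTree {α : Seq4} {p : ℤ × ℤ} :
    p ∈ (codedTree α).graph.verts ↔ ∃ n, p - skeleton α n ∈ diamond n := mem_codedGraph

/-! ### Skeletons and membership in coded trees -/

theorem IsCenter.neg {n : ℕ} {c : ℤ × ℤ} (h : IsCenter n c) : IsCenter n (-c) := by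
  unfold IsCenter
  rw [diagU_neg, diagW_neg, val2_neg, val2_neg]
  exact h

theorem IsCenter.add {n : ℕ} {c d : ℤ × ℤ} (h : IsCenter n c) (hu : n < val2 (diagU d))
    (hw : n < val2 (diagW d)) : IsCenter n (c + d) := by
  unfold IsCenter
  rw [diagU_add, diagW_add, val2_add_of_lt' (by rwa [h.1]), val2_add_of_lt' (by rwa [h.2])]
  exact h

theorem isCenter_skeleton_sub (α : Seq4) {k m : ℕ} (h : k < m) :
    IsCenter k (skeleton α m - skeleton α k) := by
  obtain ⟨d, rfl⟩ := Nat.exists_eq_add_of_lt h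
  clear h
  induction d with
  | zero =>
    rw [add_zero, skeleton, add_sub_cancel_left]
    exact isCenter_smul_dir _ _
  | succ d ih =>
    rw [← add_assoc, skeleton, add_sub_right_comm]
    have hc := isCenter_smul_dir (k + d + 1) (α (k + d + 1))
    refine ih.add ?_ ?_
    · rw [hc.1]; exact_mod_cast (by omega)
    · rw [hc.2]; exact_mod_cast (by omega)

/-- The level of a vertex `p` of the coded tree of `α` is the level of `p - skeleton α m` for all
large `m`; the centre `x_k` has level `k`. -/
theorem isCenter_sub_skeleton (α : Seq4) {k m : ℕ} (h : k < m) :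
    IsCenter k (skeleton α k - skeleton α m) := by
  rw [← neg_sub]
  exact (isCenter_skeleton_sub α h).neg

theorem sub_skeleton_mem_diamond_mono {α : Seq4} {m n : ℕ} (h : m ≤ n) {p : ℤ × ℤ}
    (hp : p - skeleton α m ∈ diamond m) : p - skeleton α n ∈ diamond n :=
  mem_patch.1 ((patch_mono α h).1 (mem_patch.2 hp))

theorem eventually_mem_diamond {α : Seq4} {p : ℤ × ℤ} (hp : p ∈ (codedTree α).graph.verts) :
    ∃ m, ∀ n ≥ m, p - skeleton α n ∈ diamond n := by
  obtain ⟨m, hm⟩ := mem_codedTree.1 hp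
  exact ⟨m, fun n hn => sub_skeleton_mem_diamond_mono hn hm⟩

theorem zero_sub_skeleton_mem_diamond (α : Seq4) (n : ℕ) : 0 - skeleton α n ∈ diamond n :=
  mem_patch.1 (zero_mem_patch α n)

theorem skeleton_congr {α β : Seq4} {n : ℕ} (h : ∀ j < n, α j = β j) :
    skeleton α n = skeleton β n := by
  induction n with
  | zero => rfl
  | succ n ih =>
    rw [skeleton, skeleton, ih fun j hj => h j (by omega), h n (Nat.lt_succ_self n)]

theorem skeleton_sub_skeleton {α β : Seq4} {n : ℕ} (h : ∀ j ≥ n, α j = β j) {m : ℕ} (hm : n ≤ m) :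
    skeleton α m - skeleton β m = skeleton α n - skeleton β n := by
  induction m, hm using Nat.le_induction with
  | base => rfl
  | succ m hm ih => rw [skeleton, skeleton, h m hm, ← ih]; abel

theorem exists_diag (a b : ℤ) : ∃ t : ℤ × ℤ, diagU t = 2 * a ∧ diagW t = 2 * b :=
  ⟨(a + b, a - b), by simp only [diagU]; ring, by simp only [diagW]; ring⟩

theorem exists_val2_abs_add_lt {x : ℤ} {k m : ℕ} (hx : |x| < 2 ^ m) (hk : k + 1 < m) :
    ∃ y : ℤ, val2 (2 * y) = (k + 1 : ℕ) ∧ |x + 2 * y| < 2 ^ m := by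
  have hp : (0 : ℤ) < 2 ^ k := by positivity
  have h1 : (2 : ℤ) * 2 ^ k = 2 ^ (k + 1) := by ring
  have hlt : (2 : ℤ) ^ (k + 1) < 2 ^ m := pow_lt_pow_right₀ (by norm_num) hk
  rw [abs_lt] at hx
  rcases le_or_gt 0 x with h | h
  · refine ⟨-2 ^ k, ?_, ?_⟩
    · rw [mul_neg, val2_neg, h1]; exact val2_pow _
    · rw [abs_lt]; constructor <;> linarith
  · refine ⟨2 ^ k, ?_, ?_⟩
    · rw [h1]; exact val2_pow _
    · rw [abs_lt]; constructor <;> linarith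

/-- A coded tree is not equivalent to the Kenyon tree: the origin of the Kenyon tree has infinite
level, whereas every vertex of a coded tree has a finite level `l`. A displacement whose diagonal
coordinates have valuations `l + 1` and `l + 2` leads from a vertex of level `l` to another vertex,
but it leads out of the Kenyon tree when it starts from the origin. -/
theorem not_translationRel_codedTree (α : Seq4) : ¬ translationRel kenyon (codedTree α) := by
  intro h
  obtain ⟨v, hv, h⟩ := translationRel_kenyon_iff.1 h
  have hmem : ∀ p, p ∈ (codedTree α).graph.verts ↔ p + v ∈ balanced := by
    intro p; rw [h, mem_kenyonAt]
  have h0 : -v ∈ (codedTree α).graph.verts := (hmem _).2 (by simpa using zero_mem_balanced)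
  obtain ⟨m₀, hm₀⟩ := eventually_mem_diamond h0
  -- the position of the origin of the Kenyon tree is a point of finite level `l` of the coded tree
  obtain ⟨l, hl, hc⟩ : ∃ l ≤ m₀, IsCenter l (-v - skeleton α (m₀ + 3)) := by
    have hd := hm₀ m₀ le_rfl
    have hs := isCenter_sub_skeleton α (show m₀ < m₀ + 3 by omega)
    have hb : val2 (diagU (-v - skeleton α m₀)) = val2 (diagW (-v - skeleton α m₀)) := hd.2.2
    have hu := val2_add_of_abs_lt hs.1 hd.1
    have hw := val2_add_of_abs_lt hs.2 hd.2.1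
    rw [← hb] at hw
    have hle : min (m₀ : ℕ∞) (val2 (diagU (-v - skeleton α m₀))) ≤ m₀ := min_le_left _ _
    obtain ⟨l, hl⟩ := ENat.ne_top_iff_exists.1 (ne_top_of_le_ne_top (ENat.natCast_ne_top m₀) hle)
    rw [← hl] at hu hw hle
    refine ⟨l, by exact_mod_cast hle, ?_⟩
    rw [show -v - skeleton α (m₀ + 3)
      = (skeleton α m₀ - skeleton α (m₀ + 3)) + (-v - skeleton α m₀) by abel]
    exact ⟨by rw [diagU_add]; exact hu, by rw [diagW_add]; exact hw⟩
  obtain ⟨hdu, hdw, -⟩ := hm₀ (m₀ + 3) (by omega)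
  obtain ⟨a, ha, hau⟩ := exists_val2_abs_add_lt (k := l) hdu (by omega)
  obtain ⟨b, hb, hbw⟩ := exists_val2_abs_add_lt (k := l + 1) hdw (by omega)
  obtain ⟨t, htu, htw⟩ := exists_diag a b
  have ht : -v + t ∈ (codedTree α).graph.verts := by
    refine mem_codedTree.2 ⟨m₀ + 3, ?_⟩
    rw [add_sub_right_comm]
    refine ⟨?_, ?_, (hc.add ?_ ?_).mem_balanced⟩
    · rw [diagU_add, htu]; exact hau
    · rw [diagW_add, htw]; exact hbw
    · rw [htu, ha]; exact_mod_cast (by omega)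
    · rw [htw, hb]; exact_mod_cast (by omega)
  rw [hmem, neg_add_cancel_comm] at ht
  have : val2 (diagU t) = val2 (diagW t) := ht
  rw [htu, htw, ha, hb] at this
  have : l + 1 = l + 1 + 1 := by exact_mod_cast this
  omega

/-- The translates of the Kenyon tree at its vertices are pairwise distinct. -/
theorem kenyonAt_injective {v w : ℤ × ℤ} {hv : v ∈ balanced} {hw : w ∈ balanced}
    (h : kenyonAt v hv = kenyonAt w hw) : v = w := by
  have hmem : ∀ p, p + v ∈ balanced ↔ p + w ∈ balanced := by
    intro p; rw [← mem_kenyonAt (hv := hv), h, mem_kenyonAt]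
  have h0 : w - v ∈ balanced := by
    have := (hmem (-v)).1 (by simpa using zero_mem_balanced)
    rwa [neg_add_eq_sub] at this
  have hb : val2 (diagU (w - v)) = val2 (diagW (w - v)) := h0
  by_cases htop : val2 (diagU (w - v)) = ⊤
  · refine (sub_eq_zero.1 (diag_ext (p := w - v) (q := 0) (val2_eq_top htop) ?_)).symm
    exact val2_eq_top (hb ▸ htop)
  · exfalso
    obtain ⟨l, hl⟩ := ENat.ne_top_iff_exists.1 htop
    have hc : IsCenter l (w - v) := ⟨hl.symm, by rw [← hb, hl]⟩
    obtain ⟨t, htu, htw⟩ := exists_diag (2 ^ l) (2 ^ (l + 1))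
    rw [← pow_succ'] at htu htw
    have h1 : t + (w - v) ∈ balanced := by
      rw [add_comm]
      refine (hc.add ?_ ?_).mem_balanced
      · rw [htu, val2_pow]; exact_mod_cast (by omega)
      · rw [htw, val2_pow]; exact_mod_cast (by omega)
    have h2 : t ∈ balanced := by
      have := (hmem (t - v)).2 (by convert h1 using 1; abel)
      rwa [sub_add_cancel] at this
    have : val2 (diagU t) = val2 (diagW t) := h2
    rw [htu, htw, val2_pow, val2_pow] at this
    have : l + 1 = l + 1 + 1 := by exact_mod_cast this
    omega

theorem val2_add_ne {k : ℕ} {x y : ℤ} (hx : (k : ℕ∞) ≤ val2 x) (hy : val2 y = k) :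
    val2 (x + y) ≠ val2 x := by
  intro h
  rcases hx.lt_or_eq with hlt | heq
  · rw [val2_add_of_lt (by rwa [hy]), hy] at h
    exact hlt.ne h
  · have := lt_val2_add heq.symm hy
    rw [h, ← heq] at this
    have : k + 1 ≤ k := by exact_mod_cast this
    omega

/-- If two codes differ for the first time at the index `n`, then the centre `x_{n+1}` of the first
has level `n + 1` in the first coded tree but, if it is a vertex of the second one, a higher level
there. A displacement whose diagonal coordinates have valuations `n + 1` and `⊤` distinguishes the
two cases. -/
theorem codedTree_injective : Function.Injective codedTree := by
  intro α β h
  by_contra hne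
  classical
  have hex : ∃ n, α n ≠ β n := Function.ne_iff.1 hne
  obtain ⟨n, hn, hmin⟩ : ∃ n, α n ≠ β n ∧ ∀ j < n, α j = β j :=
    ⟨Nat.find hex, Nat.find_spec hex, fun j hj => not_not.1 (Nat.find_min hex hj)⟩
  have hx := skeleton_congr hmin
  -- `p` is a vertex of level exactly `n + 1` for the code `α`
  set p := skeleton α (n + 1) with hp
  have hc := isCenter_sub_skeleton α (show n + 1 < n + 4 by omega)
  have hpα : ∀ m ≥ n + 1, p - skeleton α m ∈ diamond m := fun m hm =>
    sub_skeleton_mem_diamond_mono hm (by rw [hp, sub_self]; exact zero_mem_diamond _)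
  have hpm : p ∈ (codedTree α).graph.verts := mem_codedTree.2 ⟨n + 1, hpα _ le_rfl⟩
  obtain ⟨hdu, hdw, -⟩ := hpα (n + 4) (by omega)
  obtain ⟨a, ha, hau⟩ := exists_val2_abs_add_lt (k := n + 1) hdu (by omega)
  obtain ⟨t, htu, htw⟩ := exists_diag a 0
  have htm : p + t ∈ (codedTree α).graph.verts := by
    refine mem_codedTree.2 ⟨n + 4, ?_⟩
    rw [add_sub_right_comm]
    refine ⟨?_, ?_, (hc.add ?_ ?_).mem_balanced⟩
    · rw [diagU_add, htu]; exact hau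
    · rw [diagW_add, htw, mul_zero, add_zero]; exact hdw
    · rw [htu, ha]; exact_mod_cast (by omega)
    · rw [htw, mul_zero, val2_zero]; exact ENat.natCast_lt_top _
  rw [h] at hpm htm
  obtain ⟨m₁, h₁⟩ := eventually_mem_diamond hpm
  obtain ⟨m₂, h₂⟩ := eventually_mem_diamond htm
  set m := max (n + 2) (max m₁ m₂) with hm
  have hb₁ := (h₁ m (by omega)).2.2
  have hb₂ := (h₂ m (by omega)).2.2
  have hcβ := isCenter_sub_skeleton β (show n + 1 < m by omega)
  have hsplit : p - skeleton β m = (2 ^ n : ℤ) • (dir (α n) - dir (β n))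
      + (skeleton β (n + 1) - skeleton β m) := by
    rw [hp, skeleton, skeleton, hx, smul_sub]; abel
  -- for the code `β` it would have a higher level
  have hlevel : ((n + 2 : ℕ) : ℕ∞) ≤ val2 (diagU (p - skeleton β m)) := by
    have hstep : ∀ {x y z : ℤ}, (x = 1 ∨ x = -1) → (y = 1 ∨ y = -1) → val2 z = (n + 1 : ℕ) →
        (x = y ∧ val2 (2 ^ n * (x - y) + z) = (n + 1 : ℕ)) ∨
          ((n + 2 : ℕ) : ℕ∞) ≤ val2 (2 ^ n * (x - y) + z) := by
      have h2 : ((2 : ℤ) ^ n * 2) = 2 ^ (n + 1) := by ring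
      rintro x y z (rfl | rfl) (rfl | rfl) hz
      · left; simpa using hz
      · right
        refine lt_val2_add ?_ hz
        rw [sub_neg_eq_add, one_add_one_eq_two, h2]; exact val2_pow _
      · right
        refine lt_val2_add ?_ hz
        rw [show (-1 - 1 : ℤ) = -2 by norm_num, mul_neg, val2_neg, h2]; exact val2_pow _
      · left; simpa using hz
    have hu := hstep (diagU_dir_mem (α n)) (diagU_dir_mem (β n)) hcβ.1
    have hw := hstep (diagW_dir_mem (α n)) (diagW_dir_mem (β n)) hcβ.2
    rw [← diagU_sub, ← diagU_smul, ← diagU_add, ← hsplit] at hu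
    rw [← diagW_sub, ← diagW_smul, ← diagW_add, ← hsplit] at hw
    have hb : val2 (diagU (p - skeleton β m)) = val2 (diagW (p - skeleton β m)) := hb₁
    rcases hu with ⟨hu, hu'⟩ | hu
    · rcases hw with ⟨hw, -⟩ | hw
      · exact absurd (dir_injective (diag_ext hu hw)) hn
      · rw [hb]; exact hw
    · exact hu
  have hb : val2 (diagU (p + t - skeleton β m)) = val2 (diagW (p + t - skeleton β m)) := hb₂
  rw [add_sub_right_comm, diagU_add, diagW_add, htw, mul_zero, add_zero, htu] at hb
  have hb' : val2 (diagU (p - skeleton β m)) = val2 (diagW (p - skeleton β m)) := hb₁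
  rw [← hb'] at hb
  exact val2_add_ne hlevel ha hb

/-! ### Cofinal codes -/

theorem isInduced_shift_codedTree {α : Seq4} {v : ℤ × ℤ} (hv : v ∈ (codedTree α).graph.verts) :
    ((codedTree α).shift v hv).graph.IsInduced := shift_isInduced (codedTree_isInduced α)

/-- Two codes which agree from the index `n` on are codes of the same tree, seen from two of its
points. -/
theorem codedTree_shift_of_cofinal {α β : Seq4} {n : ℕ} (h : ∀ j ≥ n, α j = β j) :
    ∃ hv : skeleton α n - skeleton β n ∈ (codedTree α).graph.verts,
      codedTree β = (codedTree α).shift (skeleton α n - skeleton β n) hv := by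
  have key : ∀ p, p ∈ (codedTree β).graph.verts ↔
      p + (skeleton α n - skeleton β n) ∈ (codedTree α).graph.verts := by
    intro p
    have hsub : ∀ m ≥ n, p + (skeleton α n - skeleton β n) - skeleton α m = p - skeleton β m := by
      intro m hm
      rw [← skeleton_sub_skeleton h hm]; abel
    constructor
    · intro hp
      obtain ⟨m, hm⟩ := eventually_mem_diamond hp
      refine mem_codedTree.2 ⟨max m n, ?_⟩
      rw [hsub _ (le_max_right _ _)]
      exact hm _ (le_max_left _ _)
    · intro hp
      obtain ⟨m, hm⟩ := eventually_mem_diamond hp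
      refine mem_codedTree.2 ⟨max m n, ?_⟩
      rw [← hsub _ (le_max_right _ _)]
      exact hm _ (le_max_left _ _)
  have hv := (key 0).1 (codedTree β).zero_mem
  rw [zero_add] at hv
  refine ⟨hv, ext_of_isInduced (codedTree_isInduced β) (isInduced_shift_codedTree hv) ?_⟩
  intro p
  rw [mem_shift, key]

theorem diagU_odd_iff_diagW_odd (p : ℤ × ℤ) : Odd (diagU p) ↔ Odd (diagW p) := by
  rw [Int.odd_iff, Int.odd_iff, diagU, diagW]; omega

theorem val2_eq_zero_iff {x : ℤ} : val2 x = 0 ↔ Odd x := by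
  have := val2_eq_iff (n := 0) (x := x)
  rw [Nat.cast_zero] at this
  rw [this]
  simp [Odd]

theorem isCenter_zero_iff {p : ℤ × ℤ} : IsCenter 0 p ↔ Odd (diagU p) := by
  unfold IsCenter
  rw [Nat.cast_zero, val2_eq_zero_iff, val2_eq_zero_iff, ← diagU_odd_iff_diagW_odd, and_self]

theorem odd_diagU_skeleton (α : Seq4) {n : ℕ} (hn : 0 < n) : Odd (diagU (skeleton α n)) := by
  have := isCenter_skeleton_sub α hn
  rw [isCenter_zero_iff] at this
  simpa [skeleton] using this

/-- The points of level zero of a diamond of radius `2 ^ n` are the opposites of the end points of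
the skeletons of the words of length `n`. -/
theorem exists_skeleton_eq_neg {n : ℕ} {q : ℤ × ℤ} (hq : q ∈ diamond n)
    (hodd : 0 < n → Odd (diagU q)) : ∃ γ, skeleton γ n = -q := by
  induction n generalizing q with
  | zero =>
    have h := mem_patch (α := fun _ => 0) (n := 0) (p := q)
    have h0 : q = 0 := by simpa [patch] using h.2 (by simpa [skeleton] using hq)
    exact ⟨fun _ => 0, by rw [h0]; simp [skeleton]⟩
  | succ n ih =>
    rcases mem_diamond_succ.1 hq with rfl | ⟨k, hk⟩
    · have := hodd (Nat.succ_pos n)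
      simp [diagU] at this
    · obtain ⟨γ, hγ⟩ := ih hk (by
        intro hn
        rw [diagU_sub, diagU_smul]
        refine (hodd (Nat.succ_pos n)).sub_even ?_
        exact (Even.mul_right (by
          rw [Int.even_pow]; exact ⟨even_two, hn.ne'⟩) _))
      classical
      refine ⟨Function.update γ n (k + 2), ?_⟩
      rw [skeleton, Function.update_self, dir_add_two]
      rw [skeleton_congr (β := γ) fun j hj => Function.update_of_ne hj.ne _ _, hγ]
      rw [smul_neg]; abel

/-- The translate of a coded tree at a vertex of level zero is the tree of a cofinal code. -/
theorem exists_cofinal_of_even {α : Seq4} {v : ℤ × ℤ} (hv : v ∈ (codedTree α).graph.verts)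
    (heven : Even (diagU v)) :
    ∃ γ, cofinalRel α γ ∧ codedTree γ = (codedTree α).shift v hv := by
  obtain ⟨n, hn⟩ := mem_codedTree.1 hv
  obtain ⟨γ₀, hγ₀⟩ := exists_skeleton_eq_neg hn (by
    intro h
    rw [diagU_sub]
    exact heven.sub_odd (odd_diagU_skeleton α h))
  let γ : Seq4 := fun j => if j < n then γ₀ j else α j
  have hα : ∀ j ≥ n, α j = γ j := fun j hj => by simp [γ, not_lt.2 hj]
  have hs : skeleton γ n = -(v - skeleton α n) := by
    rw [← hγ₀]
    exact skeleton_congr fun j hj => by simp [γ, hj]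
  obtain ⟨hv', h⟩ := codedTree_shift_of_cofinal hα
  refine ⟨γ, ⟨n, hα⟩, ?_⟩
  rw [h]
  exact shift_congr (by rw [hs]; abel)

/-! ### Valencies -/

theorem diagU_add_dir_odd {p : ℤ × ℤ} {k : Fin 4} : Odd (diagU (p + dir k)) ↔ Even (diagU p) := by
  rw [diagU_add, Int.even_iff, Int.odd_iff]
  rcases diagU_dir_mem k with h | h <;> rw [h] <;> omega

/-- The neighbours in the grid of a vertex `p` of positive level of a coded tree are vertices. The
root has level zero, so that `p` has positive level when `diagU p` is odd. -/
theorem add_dir_mem_codedTree {α : Seq4} {p : ℤ × ℤ} (hp : p ∈ (codedTree α).graph.verts)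
    (hodd : Odd (diagU p)) (k : Fin 4) : p + dir k ∈ (codedTree α).graph.verts := by
  obtain ⟨m, hm⟩ := eventually_mem_diamond hp
  obtain ⟨hu, hw, -⟩ := hm (m + 1) (by omega)
  have hs := odd_diagU_skeleton α (Nat.succ_pos m)
  have heu : Even (diagU (p - skeleton α (m + 1))) := by
    rw [diagU_sub]; exact hodd.sub_odd hs
  have hew : Even (diagW (p - skeleton α (m + 1))) := by
    rw [diagW_sub]
    exact ((diagU_odd_iff_diagW_odd p).1 hodd).sub_odd ((diagU_odd_iff_diagW_odd _).1 hs)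
  have key : ∀ {x e : ℤ}, Even x → (e = 1 ∨ e = -1) → |x| < 2 ^ (m + 1) →
      |x + e| < 2 ^ (m + 1) := by
    intro x e hx he h
    rw [pow_succ] at h ⊢
    rw [Int.even_iff] at hx
    rw [abs_lt] at h ⊢
    rcases he with rfl | rfl <;> constructor <;> omega
  refine mem_codedTree.2 ⟨m + 1, ?_⟩
  rw [add_sub_right_comm]
  refine ⟨?_, ?_, (isCenter_zero_iff.2 (diagU_add_dir_odd.2 heu)).mem_balanced⟩
  · rw [diagU_add]; exact key heu (diagU_dir_mem k) hu
  · rw [diagW_add]; exact key hew (diagW_dir_mem k) hw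

/-- At the root of a coded tree, a neighbour is determined by its first diagonal coordinate. -/
theorem dir_eq_of_mem_codedTree {α : Seq4} {i j : Fin 4}
    (hi : dir i ∈ (codedTree α).graph.verts) (hj : dir j ∈ (codedTree α).graph.verts)
    (hu : diagU (dir i) = diagU (dir j)) : i = j := by
  obtain ⟨m₁, h₁⟩ := eventually_mem_diamond hi
  obtain ⟨m₂, h₂⟩ := eventually_mem_diamond hj
  set m := max 1 (max m₁ m₂)
  have hb₁ : val2 (diagU (dir i - skeleton α m)) = val2 (diagW (dir i - skeleton α m)) :=
    (h₁ m (by omega)).2.2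
  have hb₂ : val2 (diagU (dir j - skeleton α m)) = val2 (diagW (dir j - skeleton α m)) :=
    (h₂ m (by omega)).2.2
  rw [diagU_sub, diagW_sub] at hb₁ hb₂
  rw [← hu, hb₁] at hb₂
  have hs : Odd (diagW (skeleton α m)) :=
    (diagU_odd_iff_diagW_odd _).1 (odd_diagU_skeleton α (by omega))
  refine dir_injective (diag_ext hu ?_)
  by_contra hne
  have hev : ∀ {e : ℤ}, (e = 1 ∨ e = -1) → (1 : ℕ) ≤ val2 (e - diagW (skeleton α m)) := by
    intro e he
    rw [le_val2_iff]
    obtain ⟨k, hk⟩ := hs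
    rw [hk]
    rcases he with rfl | rfl
    · exact ⟨-k, by ring⟩
    · exact ⟨-k - 1, by ring⟩
  have h2 : val2 2 = (1 : ℕ) := by simpa using val2_pow 1
  have h2' : val2 (-2) = (1 : ℕ) := by rw [val2_neg, h2]
  rcases diagW_dir_mem i with hi' | hi' <;> rcases diagW_dir_mem j with hj' | hj' <;>
    rw [hi', hj'] at hb₂ hne
  · exact hne rfl
  · refine val2_add_ne (hev (Or.inl rfl)) h2' ?_
    rw [hb₂]; congr 1; ring
  · refine val2_add_ne (hev (Or.inr rfl)) h2 ?_
    rw [hb₂]; congr 1; ring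
  · exact hne rfl

theorem mem_neighborSet_zero {T : RootedGraph} (hT : T.graph.IsInduced) {p : ℤ × ℤ} :
    p ∈ T.graph.neighborSet 0 ↔ ∃ k, p = dir k ∧ dir k ∈ T.graph.verts := by
  rw [SimpleGraph.Subgraph.mem_neighborSet, adj_iff_of_isInduced hT, gridGraph_adj]
  constructor
  · rintro ⟨-, hp, k, rfl⟩
    rw [zero_add] at hp
    exact ⟨k, zero_add _, hp⟩
  · rintro ⟨k, rfl, hp⟩
    exact ⟨T.zero_mem, hp, k, (zero_add _).symm⟩

theorem valency_codedTree_le (α : Seq4) : (codedTree α).valency ≤ 2 := by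
  have hmaps : MapsTo diagU ((codedTree α).graph.neighborSet 0) ({1, -1} : Set ℤ) := by
    intro p hp
    obtain ⟨k, rfl, -⟩ := (mem_neighborSet_zero (codedTree_isInduced α)).1 hp
    exact diagU_dir_mem k
  have hinj : InjOn diagU ((codedTree α).graph.neighborSet 0) := by
    intro p hp q hq h
    obtain ⟨i, rfl, hi⟩ := (mem_neighborSet_zero (codedTree_isInduced α)).1 hp
    obtain ⟨j, rfl, hj⟩ := (mem_neighborSet_zero (codedTree_isInduced α)).1 hq
    rw [dir_eq_of_mem_codedTree hi hj h]
  refine (encard_le_encard_of_injOn hmaps hinj).trans ?_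
  rw [encard_pair (by norm_num)]

theorem not_valency_le_two {T : RootedGraph} (hT : T.graph.IsInduced)
    (h : ∀ k, dir k ∈ T.graph.verts) : ¬ T.valency ≤ 2 := by
  have hsub : ({dir 0, dir 1, dir 2} : Set (ℤ × ℤ)) ⊆ T.graph.neighborSet 0 := by
    rintro p (rfl | rfl | rfl) <;> exact (mem_neighborSet_zero hT).2 ⟨_, rfl, h _⟩
  have h3 : ({dir 0, dir 1, dir 2} : Set (ℤ × ℤ)).encard = 3 := by
    refine encard_eq_three.2 ⟨_, _, _, ?_, ?_, ?_, rfl⟩ <;>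
      exact fun h => absurd (dir_injective h) (by decide)
  intro hle
  have := (encard_le_encard hsub).trans hle
  rw [h3] at this
  exact absurd this (by decide)

open Filter

/-! ### Coded trees belong to the hull -/

theorem finite_height_lt (T : RootedGraph) (n : ℕ) : {v | T.height v < n}.Finite := by
  induction n with
  | zero =>
    refine Set.finite_empty.subset fun v hv => ?_
    exact not_height_lt_zero hv
  | succ n ih =>
    refine ((finite_singleton 0).union
      (ih.biUnion fun u _ => finite_range fun k => u + dir k)).subset fun v hv => ?_
    rcases height_lt_succ.1 hv with rfl | ⟨u, hu, huv⟩
    · exact Or.inl rfl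
    · obtain ⟨k, rfl⟩ := gridGraph_adj.1 (T.graph.adj_sub huv)
      exact Or.inr (mem_iUnion₂.2 ⟨u, hu, k, rfl⟩)

/-- The Kenyon tree contains translates of the patches of level `m` such that the only point of the
Kenyon tree at a corner of the patch is the one prescribed by the code; such a translate is centred
at `2 ^ m • (dir k + (6, -2))`, where `k` is the letter of index `m`. -/
theorem exists_center (m : ℕ) (k : Fin 4) : ∃ c, IsCenter m c ∧ ∀ e, c + e ∈ balanced →
    |diagU e| = 2 ^ m → |diagW e| = 2 ^ m → e = (2 ^ m : ℤ) • dir k := by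
  have hp : (0 : ℤ) < 2 ^ m := by positivity
  refine ⟨(2 ^ m : ℤ) • (dir k + (6, -2)), ⟨?_, ?_⟩, ?_⟩
  · rw [diagU_smul, diagU_add, val2_eq_iff]
    rcases diagU_dir_mem k with h | h <;> rw [h]
    · exact ⟨2, by norm_num [diagU]⟩
    · exact ⟨1, by norm_num [diagU]⟩
  · rw [diagW_smul, diagW_add, val2_eq_iff]
    rcases diagW_dir_mem k with h | h <;> rw [h]
    · exact ⟨4, by norm_num [diagW]⟩
    · exact ⟨3, by norm_num [diagW]⟩
  · intro e he hu hw
    have he' : val2 (diagU ((2 ^ m : ℤ) • (dir k + (6, -2)) + e))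
      = val2 (diagW ((2 ^ m : ℤ) • (dir k + (6, -2)) + e)) := he
    rw [diagU_add, diagU_smul, diagU_add, diagW_add, diagW_smul, diagW_add,
      show diagU (6, -2) = 4 from rfl, show diagW (6, -2) = 8 from rfl] at he'
    -- the valuation at a corner, according to the sign of the displacement
    have hU : ∀ {x a : ℤ}, (a = 1 ∨ a = -1) → |x| = 2 ^ m →
        (x = 2 ^ m * a ∧ val2 (2 ^ m * (a + 4) + x) = (m + 1 : ℕ)) ∨
          val2 (2 ^ m * (a + 4) + x) = (m + 2 : ℕ) := by
      intro x a ha hx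
      rcases ha with rfl | rfl <;> rcases (abs_eq hp.le).1 hx with rfl | rfl
      · exact Or.inl ⟨by ring, val2_eq_iff.2 ⟨1, by ring⟩⟩
      · exact Or.inr (val2_eq_iff.2 ⟨0, by ring⟩)
      · exact Or.inr (val2_eq_iff.2 ⟨0, by ring⟩)
      · exact Or.inl ⟨by ring, val2_eq_iff.2 ⟨0, by ring⟩⟩
    have hW : ∀ {x a : ℤ}, (a = 1 ∨ a = -1) → |x| = 2 ^ m →
        (x = 2 ^ m * a ∧ val2 (2 ^ m * (a + 8) + x) = (m + 1 : ℕ)) ∨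
          val2 (2 ^ m * (a + 8) + x) = (m + 3 : ℕ) := by
      intro x a ha hx
      rcases ha with rfl | rfl <;> rcases (abs_eq hp.le).1 hx with rfl | rfl
      · exact Or.inl ⟨by ring, val2_eq_iff.2 ⟨2, by ring⟩⟩
      · exact Or.inr (val2_eq_iff.2 ⟨0, by ring⟩)
      · exact Or.inr (val2_eq_iff.2 ⟨0, by ring⟩)
      · exact Or.inl ⟨by ring, val2_eq_iff.2 ⟨1, by ring⟩⟩
    rcases hU (diagU_dir_mem k) hu with ⟨h1, h1'⟩ | h1 <;>
      rcases hW (diagW_dir_mem k) hw with ⟨h2, h2'⟩ | h2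
    · exact diag_ext (by rw [h1, diagU_smul]) (by rw [h2, diagW_smul])
    · rw [h1', h2] at he'
      have : m + 1 = m + 3 := by exact_mod_cast he'
      omega
    · rw [h1, h2'] at he'
      have : m + 2 = m + 1 := by exact_mod_cast he'
      omega
    · rw [h1, h2] at he'
      have : m + 2 = m + 3 := by exact_mod_cast he'
      omega

theorem codedTree_mem_hull (α : Seq4) : codedTree α ∈ hull := by
  rw [mem_hull_iff]
  intro N
  obtain ⟨m, hm⟩ : ∃ m, ∀ v, (codedTree α).height v < (N + 1 : ℕ) →
      v - skeleton α m ∈ diamond m := by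
    have : ∀ᶠ m in atTop, ∀ v ∈ {v | (codedTree α).height v < (N + 1 : ℕ)},
        v - skeleton α m ∈ diamond m := by
      rw [Filter.eventually_all_finite (finite_height_lt _ _)]
      intro v hv
      obtain ⟨m, hm⟩ := eventually_mem_diamond (mem_verts_of_height_lt hv)
      exact eventually_atTop.2 ⟨m, hm⟩
    exact this.exists
  obtain ⟨c, hc, hcorner⟩ := exists_center m (α m)
  have hbal : ∀ {p}, p - skeleton α m ∈ diamond m → p + (c - skeleton α m) ∈ balanced := by
    intro p hp
    rw [show p + (c - skeleton α m) = c + (p - skeleton α m) by abel,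
      hc.add_mem_balanced_iff hp.1 hp.2.1]
    exact hp.2.2
  have hv : c - skeleton α m ∈ balanced := by
    have := hbal (zero_sub_skeleton_mem_diamond α m)
    rwa [zero_add] at this
  refine ⟨c - skeleton α m, hv, ?_⟩
  refine openBall_eq_of_adj_iff {q | (codedTree α).height q < N} (fun _ h => h) ?_
  intro q hq p
  have hq' : q - skeleton α m ∈ diamond m := hm q (lt_trans hq (by exact_mod_cast (by omega)))
  rw [kenyonAt_adj]
  constructor
  · intro h
    exact ⟨hbal hq', hbal (hm p (height_lt_succ.2 (Or.inr ⟨q, hq, h⟩))),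
      (codedTree α).graph.adj_sub h⟩
  · rintro ⟨-, hp, hqp⟩
    refine codedTree_isInduced α (mem_verts_of_height_lt hq) ?_ hqp
    obtain ⟨k, rfl⟩ := gridGraph_adj.1 hqp
    obtain ⟨hu, hw⟩ := abs_diag_add_dir_le hq' (m := k)
    rw [← add_sub_right_comm] at hu hw
    rw [show q + dir k + (c - skeleton α m) = c + (q + dir k - skeleton α m) by abel] at hp
    by_cases hlt : |diagU (q + dir k - skeleton α m)| < 2 ^ m ∧
        |diagW (q + dir k - skeleton α m)| < 2 ^ m
    · exact mem_codedTree.2 ⟨m, hlt.1, hlt.2, (hc.add_mem_balanced_iff hlt.1 hlt.2).1 hp⟩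
    · obtain ⟨hu', hw'⟩ := hc.corner hp hu hw hlt
      have he := hcorner _ hp hu' hw'
      refine mem_codedTree.2 ⟨m + 1, ?_⟩
      rw [skeleton, ← he, add_sub_cancel, sub_self]
      exact zero_mem_diamond _

/-! ### Classification of the points of the hull -/

/-- About a point of the Kenyon tree whose diagonal coordinates have high valuations, the tree
looks as it does about the origin. -/
theorem add_mem_balanced_iff_of_le {n : ℕ} {c r : ℤ × ℤ} (hc : c ∈ balanced)
    (hcu : (n : ℕ∞) ≤ val2 (diagU c)) (hu : |diagU r| < 2 ^ n) (hw : |diagW r| < 2 ^ n) :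
    c + r ∈ balanced ↔ r ∈ balanced := by
  have hc' : val2 (diagU c) = val2 (diagW c) := hc
  have hcw : (n : ℕ∞) ≤ val2 (diagW c) := hc' ▸ hcu
  have key : ∀ {a x : ℤ}, (n : ℕ∞) ≤ val2 a → x ≠ 0 → |x| < 2 ^ n →
      val2 (a + x) = val2 x ∧ val2 x < n := by
    intro a x ha h0 hx
    have := val2_lt h0 hx
    exact ⟨val2_add_of_lt (this.trans_le ha), this⟩
  simp only [balanced, mem_ofPred_eq, diagU_add, diagW_add]
  by_cases h1 : diagU r = 0 <;> by_cases h2 : diagW r = 0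
  · simp [h1, h2, hc']
  · obtain ⟨e, hlt⟩ := key hcw h2 hw
    rw [e, h1, add_zero, val2_zero]
    exact iff_of_false (hlt.trans_le hcu).ne' (ne_top_of_lt hlt).symm
  · obtain ⟨e, hlt⟩ := key hcu h1 hu
    rw [e, h2, add_zero, val2_zero]
    exact iff_of_false (hlt.trans_le hcw).ne (ne_top_of_lt hlt)
  · rw [(key hcu h1 hu).1, (key hcw h2 hw).1]

/-- The code of the Kenyon tree at a point of level zero: the patches of this code, placed at that
point, are centred at centres of all levels. -/
theorem exists_code {v : ℤ × ℤ} (hv : Odd (diagU v)) :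
    ∃ α : Seq4, ∀ n, IsCenter n (skeleton α n + v) := by
  have hstep : ∀ (n : ℕ) (c : ℤ × ℤ), ∃ k : Fin 4,
      IsCenter n c → IsCenter (n + 1) (c + (2 ^ n : ℤ) • dir k) := by
    intro n c
    by_cases hc : IsCenter n c
    · have h1 : ∀ {x : ℤ}, val2 x = n →
          ∃ e : ℤ, (e = 1 ∨ e = -1) ∧ val2 (x + 2 ^ n * e) = (n + 1 : ℕ) := by
        intro x hx
        obtain ⟨j, rfl⟩ := val2_eq_iff.1 hx
        rcases Int.even_or_odd' j with ⟨i, rfl | rfl⟩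
        · exact ⟨1, Or.inl rfl, val2_eq_iff.2 ⟨i, by ring⟩⟩
        · exact ⟨-1, Or.inr rfl, val2_eq_iff.2 ⟨i, by ring⟩⟩
      obtain ⟨a, ha, hu⟩ := h1 hc.1
      obtain ⟨b, hb, hw⟩ := h1 hc.2
      obtain ⟨k, rfl, rfl⟩ := exists_dir ha hb
      exact ⟨k, fun _ => ⟨by rwa [diagU_add, diagU_smul], by rwa [diagW_add, diagW_smul]⟩⟩
    · exact ⟨0, fun h => absurd h hc⟩
  choose f hf using hstep
  let c : ℕ → ℤ × ℤ := fun n => Nat.rec v (fun n c => c + (2 ^ n : ℤ) • dir (f n c)) n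
  have hs : ∀ n, skeleton (fun n => f n (c n)) n + v = c n := by
    intro n
    induction n with
    | zero => simp [skeleton, c]
    | succ n ih =>
      rw [skeleton, add_right_comm, ih]
  refine ⟨fun n => f n (c n), fun n => ?_⟩
  rw [hs]
  induction n with
  | zero => exact isCenter_zero_iff.2 hv
  | succ n ih => exact hf n (c n) ih

/-- A limit of translates of the Kenyon tree at points of level zero is either a coded tree or a
translate of the Kenyon tree. The codes of the approximating translates have a limit `α`, and the
coded tree of `α` is contained in the limit tree. A point of the limit tree adjacent to the coded
tree but not in it must be a corner of all large patches, so it is a limit of centres whose levels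
tend to infinity, and the limit tree is the Kenyon tree seen from another point. -/
theorem translationRel_or_codedTree_of_approx {T : RootedGraph} (hT : T ∈ hull)
    (h : ∀ N : ℕ, ∃ v hv, Odd (diagU v) ∧ T.openBall N = (kenyonAt v hv).openBall N) :
    translationRel kenyon T ∨ ∃ α, T = codedTree α := by
  choose v hv hodd hball using h
  choose code hcode using fun N => exists_code (hodd N)
  have hlim : ∀ n, ∃ a, ∀ᶠ N in (hyperfilter ℕ : Filter ℕ), code N n = a := by
    intro n
    exact Ultrafilter.eventually_exists_iff.1 (Eventually.of_forall fun N => ⟨_, rfl⟩)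
  choose α hα using hlim
  have hlarge : ∀ {p}, p ∈ T.graph.verts →
      ∀ᶠ N : ℕ in (hyperfilter ℕ : Filter ℕ), T.height p < N := by
    intro p hp
    obtain ⟨n, hn⟩ := exists_height_lt hp
    refine Nat.hyperfilter_le_atTop (eventually_atTop.2 ⟨n, fun N hN => hn.trans_le ?_⟩)
    exact_mod_cast hN
  have hmem : ∀ {p}, p ∈ T.graph.verts →
      ∀ᶠ N in (hyperfilter ℕ : Filter ℕ), p + v N ∈ balanced := by
    intro p hp
    filter_upwards [hlarge hp] with N hN
    exact mem_kenyonAt.1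
      (mem_verts_of_height_lt ((height_lt_iff_of_openBall_eq (hball N) p).1 hN))
  have hadj : ∀ {p q}, p ∈ T.graph.verts → gridGraph.Adj p q →
      (∀ᶠ N in (hyperfilter ℕ : Filter ℕ), q + v N ∈ balanced) → q ∈ T.graph.verts := by
    intro p q hp hpq hq
    obtain ⟨N, h1, h2, h3⟩ := ((hlarge hp).and ((hmem hp).and hq)).exists
    exact T.graph.edge_vert ((adj_iff_of_openBall_eq (hball N) h1 q).2
      (kenyonAt_adj.2 ⟨h2, h3, hpq⟩)).symm
  have hskel : ∀ m, ∀ᶠ N in (hyperfilter ℕ : Filter ℕ), IsCenter m (skeleton α m + v N) := by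
    intro m
    have : ∀ᶠ N in (hyperfilter ℕ : Filter ℕ), ∀ j ∈ Set.Iio m, code N j = α j := by
      rw [Filter.eventually_all_finite (finite_Iio m)]
      exact fun j _ => hα j
    filter_upwards [this] with N hN
    rw [← skeleton_congr fun j hj => hN j hj]
    exact hcode N m
  have hsub : ∀ (n : ℕ) (p), (codedTree α).height p < n → p ∈ T.graph.verts := by
    intro n
    induction n with
    | zero => intro p hp; exact absurd hp not_height_lt_zero
    | succ n ih =>
      intro p hp
      rcases height_lt_succ.1 hp with rfl | ⟨u, hu, hup⟩
      · exact T.zero_mem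
      · refine hadj (ih u hu) ((codedTree α).graph.adj_sub hup) ?_
        obtain ⟨m, hm⟩ := mem_codedTree.1 (mem_verts_of_height_lt hp)
        filter_upwards [hskel m] with N hN
        rw [show p + v N = skeleton α m + v N + (p - skeleton α m) by abel,
          hN.add_mem_balanced_iff hm.1 hm.2.1]
        exact hm.2.2
  by_cases hall : ∀ p ∈ T.graph.verts, p ∈ (codedTree α).graph.verts
  · right
    refine ⟨α, ext_of_isInduced (hull_isInduced hT) (codedTree_isInduced α) fun p => ⟨hall p, ?_⟩⟩
    intro hp
    obtain ⟨n, hn⟩ := exists_height_lt hp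
    exact hsub n p hn
  · left
    obtain ⟨p, q, hp, hq, hqp⟩ : ∃ p q, p ∉ (codedTree α).graph.verts ∧
        q ∈ (codedTree α).graph.verts ∧ T.graph.Adj q p := by
      by_contra hno
      push Not at hno
      refine hall fun p hp => ?_
      obtain ⟨n, hn⟩ := exists_height_lt hp
      clear hp
      induction n generalizing p with
      | zero => exact absurd hn not_height_lt_zero
      | succ n ih =>
        rcases height_lt_succ.1 hn with rfl | ⟨u, hu, hup⟩
        · exact (codedTree α).zero_mem
        · by_contra hp
          exact hno p u hp (ih u hu) hup
    have hpT := T.graph.edge_vert hqp.symm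
    obtain ⟨k, rfl⟩ := gridGraph_adj.1 (T.graph.adj_sub hqp)
    obtain ⟨m₀, hm₀⟩ := eventually_mem_diamond hq
    -- `p = q + dir k` is a corner of all large patches
    have hval : ∀ m ≥ m₀, ∀ᶠ N in (hyperfilter ℕ : Filter ℕ),
        ((m + 1 : ℕ) : ℕ∞) ≤ val2 (diagU (q + dir k + v N)) := by
      intro m hm
      filter_upwards [hskel m, hmem hpT] with N hN hpN
      obtain ⟨hu, hw⟩ := abs_diag_add_dir_le (hm₀ m hm) (m := k)
      rw [← add_sub_right_comm] at hu hw
      rw [show q + dir k + v N = skeleton α m + v N + (q + dir k - skeleton α m) by abel] at hpN ⊢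
      by_cases hlt : |diagU (q + dir k - skeleton α m)| < 2 ^ m ∧
          |diagW (q + dir k - skeleton α m)| < 2 ^ m
      · exact absurd (mem_codedTree.2
          ⟨m, hlt.1, hlt.2, (hN.add_mem_balanced_iff hlt.1 hlt.2).1 hpN⟩) hp
      · obtain ⟨hu', -⟩ := hN.corner hpN hu hw hlt
        rw [diagU_add]
        refine lt_val2_add hN.1 ?_
        rcases (abs_eq (by positivity)).1 hu' with h | h <;> rw [h]
        · exact val2_pow m
        · rw [val2_neg]; exact val2_pow m
    have hloc : ∀ r, ∀ᶠ N in (hyperfilter ℕ : Filter ℕ),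
        (r + (q + dir k) + v N ∈ balanced ↔ r ∈ balanced) := by
      intro r
      obtain ⟨n, hn⟩ : ∃ n, m₀ ≤ n ∧ |diagU r| < 2 ^ (n + 1) ∧ |diagW r| < 2 ^ (n + 1) := by
        have hbig : ∀ x : ℤ, ∃ n : ℕ, ∀ j ≥ n, |x| < 2 ^ (j + 1) := by
          intro x
          refine ⟨x.natAbs, fun j hj => ?_⟩
          have := Nat.lt_two_pow_self (n := x.natAbs)
          have h2 : 2 ^ x.natAbs ≤ 2 ^ (j + 1) := Nat.pow_le_pow_right (by norm_num) (by omega)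
          rw [Int.abs_eq_natAbs]
          exact_mod_cast this.trans_le h2
        obtain ⟨a, ha⟩ := hbig (diagU r)
        obtain ⟨b, hb⟩ := hbig (diagW r)
        exact ⟨max m₀ (max a b), by omega, ha _ (by omega), hb _ (by omega)⟩
      filter_upwards [hval n hn.1, hmem hpT] with N hN hpN
      rw [show r + (q + dir k) + v N = q + dir k + v N + r by abel]
      exact add_mem_balanced_iff_of_le hpN hN hn.2.1 hn.2.2
    have heq : T.shift (q + dir k) hpT = kenyon := by
      refine ext_of_isInduced (shift_isInduced (hull_isInduced hT)) kenyonGraph_isInduced ?_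
      intro r
      rw [mem_shift]
      constructor
      · intro hr
        obtain ⟨N, h1, h2⟩ := ((hmem hr).and (hloc r)).exists
        exact mem_kenyonGraph.2 (h2.1 h1)
      · intro hr
        obtain ⟨n, hn⟩ := exists_height_lt hr
        clear hr
        induction n generalizing r with
        | zero => exact absurd hn not_height_lt_zero
        | succ n ih =>
          rcases height_lt_succ.1 hn with rfl | ⟨u, hu, hur⟩
          · rwa [zero_add]
          · refine hadj (ih u hu) ?_ ?_
            · obtain ⟨j, rfl⟩ := gridGraph_adj.1 (kenyon.graph.adj_sub hur)
              exact gridGraph_adj.2 ⟨j, by abel⟩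
            · filter_upwards [hloc r] with N hN
              exact hN.2 (mem_kenyonGraph.1 (kenyon.graph.edge_vert hur.symm))
    have := translationRel_shift hpT
    rw [heq] at this
    exact translationRel.symm this

theorem dir_two_eq : dir 2 = -dir 0 := dir_add_two 0

/-- Apart from the translates of the Kenyon tree, the points of its hull are the coded trees and
their translates at the neighbour `dir 2` of the root. Indeed, of the vertices of the Kenyon tree by
which such a point is approximated, infinitely many have level zero, or almost all have positive
level, and then their neighbours in the direction `dir 0` are vertices of level zero. -/
theorem hull_classification {T : RootedGraph} (hT : T ∈ hull) :
    translationRel kenyon T ∨ (∃ α, T = codedTree α) ∨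
      ∃ α, ∃ h : dir 2 ∈ (codedTree α).graph.verts, T = (codedTree α).shift (dir 2) h := by
  choose v hv hball using mem_hull_iff.1 hT
  by_cases hfreq : ∀ N, ∃ M ≥ N, Odd (diagU (v M))
  · have := translationRel_or_codedTree_of_approx hT fun N => by
      obtain ⟨M, hM, hodd⟩ := hfreq N
      exact ⟨v M, hv M, hodd, openBall_eq_mono hM (hball M)⟩
    rcases this with h | h
    · exact Or.inl h
    · exact Or.inr (Or.inl h)
  · push Not at hfreq
    obtain ⟨N₀, hN₀⟩ := hfreq
    have hodd : ∀ N ≥ N₀, Odd (diagU (v N + dir 0)) := fun N hN =>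
      diagU_add_dir_odd.2 (Int.not_odd_iff_even.1 (hN₀ N hN))
    have hmem : ∀ N ≥ N₀, dir 0 ∈ (kenyonAt (v N) (hv N)).graph.verts := by
      intro N hN
      rw [mem_kenyonAt, add_comm]
      exact (isCenter_zero_iff.2 (hodd N hN)).mem_balanced
    have hadj : T.graph.Adj 0 (dir 0) := by
      rw [adj_iff_of_openBall_eq (hball (N₀ + 1)) (by rw [height_zero]; exact_mod_cast (by omega))]
      exact kenyonAt_isInduced _ _ (RootedGraph.zero_mem _) (hmem _ (by omega))
        (gridGraph_adj.2 ⟨0, (zero_add _).symm⟩)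
    have h0 : dir 0 ∈ T.graph.verts := T.graph.edge_vert hadj.symm
    have hheight : T.height (dir 0) ≤ (1 : ℕ) := by
      rw [Nat.cast_one]
      exact le_of_eq (SimpleGraph.edist_eq_one_iff_adj.2 (by simpa using hadj))
    have hcases := translationRel_or_codedTree_of_approx (shift_mem_hull hT h0) fun N => by
      have hN : N₀ ≤ max (N + 1) N₀ := le_max_right _ _
      have hb := openBall_eq_mono (le_max_left (N + 1) N₀) (hball (max (N + 1) N₀))
      have h1 := hmem _ hN
      refine ⟨dir 0 + v (max (N + 1) N₀), mem_kenyonAt.1 h1, ?_, ?_⟩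
      · rw [add_comm]; exact hodd _ hN
      · rw [shift_openBall_eq (hv' := h1) hheight hb]
        exact congrArg (fun S => S.openBall N) (shift_shift _ _)
    rcases hcases with h | ⟨α, h⟩
    · exact Or.inl (translationRel.trans h (translationRel.symm (translationRel_shift h0)))
    · right; right
      have h2 : dir 2 ∈ (T.shift (dir 0) h0).graph.verts := by
        rw [mem_shift, dir_two_eq, neg_add_cancel]; exact T.zero_mem
      refine ⟨α, h ▸ h2, ?_⟩
      have e1 : (T.shift (dir 0) h0).shift (dir 2) h2 = T := by
        rw [shift_shift, shift_congr (w := 0) (by rw [dir_two_eq, neg_add_cancel]), shift_zero]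
      refine e1.symm.trans ?_
      congr 1

/-! ### The codes of the trees which contain a given neighbour of the root -/

theorem skeleton_of_zero {α : Seq4} {n : ℕ} (h : ∀ j < n, α j = 0) :
    skeleton α n = (2 ^ n - 1 : ℤ) • dir 0 := by
  induction n with
  | zero => simp [skeleton]
  | succ n ih =>
    rw [skeleton, ih fun j hj => h j (by omega), h n (Nat.lt_succ_self n), ← add_smul]
    congr 1; ring

/-- The point `dir 2 = -dir 0` belongs to the coded tree of `α` when, for some `k`, it is the centre
`x_{k+1}`. If `k` is the first index with `α k ≠ 0`, the other two values of `α k` give to one of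
the diagonal coordinates the valuation `k + 1` and to the other one a higher valuation. -/
theorem dir_two_mem_codedTree_iff {α : Seq4} :
    dir 2 ∈ (codedTree α).graph.verts ↔ ∃ k, (∀ j < k, α j = 0) ∧ α k = 2 := by
  constructor
  · intro hmem
    have hsub : ∀ {k}, (∀ j < k, α j = 0) → dir 2 - skeleton α k = -((2 ^ k : ℤ) • dir 0) := by
      intro k hk
      rw [skeleton_of_zero hk, dir_two_eq, sub_smul, one_smul]; abel
    obtain ⟨m, hm⟩ := eventually_mem_diamond hmem
    have hex : ∃ n, α n ≠ 0 := by
      by_contra hno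
      push Not at hno
      have h := hm m le_rfl
      rw [hsub fun j _ => hno j] at h
      have h1 := h.1
      rw [diagU_neg, diagU_smul, abs_neg, show diagU (dir 0) = 1 from rfl, mul_one,
        abs_of_nonneg (by positivity)] at h1
      exact lt_irrefl _ h1
    classical
    obtain ⟨k, hk, hmin⟩ : ∃ k, α k ≠ 0 ∧ ∀ j < k, α j = 0 :=
      ⟨Nat.find hex, Nat.find_spec hex, fun j hj => not_not.1 (Nat.find_min hex hj)⟩
    refine ⟨k, hmin, ?_⟩
    by_contra hk2
    set M := max m (k + 2) with hM
    have hb : val2 (diagU (dir 2 - skeleton α M)) = val2 (diagW (dir 2 - skeleton α M)) :=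
      (hm M (by omega)).2.2
    have hc := isCenter_sub_skeleton α (show k + 1 < M by omega)
    have hsplit : dir 2 - skeleton α M = -((2 ^ k : ℤ) • (dir 0 + dir (α k)))
        + (skeleton α (k + 1) - skeleton α M) := by
      rw [skeleton, smul_add]
      linear_combination (exp := 1) hsub hmin
    have h2 : (2 : ℤ) ^ k * 2 = 2 ^ (k + 1) := by ring
    have hle : ((k + 2 : ℕ) : ℕ∞) ≤ ((k + 1 : ℕ) : ℕ∞) → False := by
      intro h
      have : k + 2 ≤ k + 1 := by exact_mod_cast h
      omega
    have hcase : α k = 1 ∨ α k = 3 := by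
      generalize α k = a at hk hk2
      revert a; decide
    rw [hsplit, diagU_add, diagW_add, diagU_neg, diagW_neg, diagU_smul, diagW_smul] at hb
    rcases hcase with h | h
    · rw [h, show diagU (dir 0 + dir 1) = 2 from rfl, show diagW (dir 0 + dir 1) = 0 from rfl,
        mul_zero, neg_zero, zero_add, hc.2, h2] at hb
      have := lt_val2_add (x := -2 ^ (k + 1)) (by rw [val2_neg]; exact val2_pow _) hc.1
      rw [hb] at this
      exact hle this
    · rw [h, show diagU (dir 0 + dir 3) = 0 from rfl, show diagW (dir 0 + dir 3) = 2 from rfl,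
        mul_zero, neg_zero, zero_add, hc.1, h2] at hb
      have := lt_val2_add (x := -2 ^ (k + 1)) (by rw [val2_neg]; exact val2_pow _) hc.2
      rw [← hb] at this
      exact hle this
  · rintro ⟨k, hk, hk2⟩
    refine mem_codedTree.2 ⟨k + 1, ?_⟩
    have : dir 2 - skeleton α (k + 1) = 0 := by
      rw [skeleton, skeleton_of_zero hk, hk2, dir_two_eq, sub_smul, one_smul, smul_neg]; abel
    rw [this]
    exact zero_mem_diamond _

/-! ### The Borel structure of the hull -/

theorem openBall_eq_iff {T T' : RootedGraph} {N : ℕ} : T.openBall N = T'.openBall N ↔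
    (∀ v, T.height v < N ↔ T'.height v < N) ∧
      ∀ v, T'.height v < N → ∀ p, T.graph.Adj v p ↔ T'.graph.Adj v p := by
  constructor
  · intro h
    exact ⟨height_lt_iff_of_openBall_eq h, fun v hv p =>
      adj_iff_of_openBall_eq h ((height_lt_iff_of_openBall_eq h v).2 hv) p⟩
  · rintro ⟨h1, h2⟩
    exact openBall_eq_of_adj_iff {v | T.height v < N} (fun _ h => h)
      fun v hv p => h2 v ((h1 v).1 hv) p

theorem measurable_mem_verts (p : ℤ × ℤ) :
    Measurable fun T : hull => p ∈ (T : RootedGraph).graph.verts := by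
  rw [← measurableSet_setOfPred]
  refine IsOpen.measurableSet (Metric.isOpen_iff.2 fun T hT => ?_)
  obtain ⟨n, hn⟩ := exists_height_lt hT
  refine ⟨Real.exp (-(n : ℝ)), Real.exp_pos _, fun T' hT' => ?_⟩
  exact mem_verts_of_height_lt
    ((height_lt_iff_of_openBall_eq (openBall_eq_of_dist_lt hT') p).2 hn)

/-- A map to the hull is measurable if it is so for the vertex set, seen as a point of the product
space of the families of truth values indexed by `ℤ²`: the balls about the translates of the Kenyon
tree form a countable basis of the hull, and they are described by countably many conditions on
edges. -/
theorem measurable_of_mem_verts {X : Type*} [MeasurableSpace X] {f : X → hull}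
    (hf : ∀ p, Measurable fun x => p ∈ (f x : RootedGraph).graph.verts) : Measurable f := by
  have hadj : ∀ p q, Measurable fun x => (f x : RootedGraph).graph.Adj p q := by
    intro p q
    simp only [adj_iff_of_isInduced (hull_isInduced (Subtype.coe_prop (f _)))]
    exact (hf p).and ((hf q).and measurable_const)
  have hheight : ∀ (n : ℕ) (v : ℤ × ℤ),
      Measurable fun x => (f x : RootedGraph).height v < n := by
    intro n
    induction n with
    | zero =>
      intro v
      simp only [iff_false_intro not_height_lt_zero]
      exact measurable_const
    | succ n ih =>
      intro v
      simp only [height_lt_succ]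
      exact measurable_const.or (Measurable.exists fun u => (ih u).and (hadj u v))
  have hball : ∀ (T : RootedGraph) (N : ℕ),
      MeasurableSet {x | (f x : RootedGraph).openBall N = T.openBall N} := by
    intro T N
    rw [measurableSet_setOfPred]
    simp only [openBall_eq_iff]
    exact (Measurable.forall fun v => (hheight N v).iff measurable_const).and
      (Measurable.forall fun v => measurable_const.imp
        (Measurable.forall fun p => (hadj v p).iff measurable_const))
  refine measurable_of_isOpen fun U hU => ?_
  have hcover : f ⁻¹' U = ⋃ i ∈ {i : ℕ × balanced | ∀ T : hull,
      (T : RootedGraph).openBall i.1 = (kenyonAt i.2 i.2.2).openBall i.1 → T ∈ U},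
      {x | (f x : RootedGraph).openBall i.1 = (kenyonAt i.2 i.2.2).openBall i.1} := by
    ext x
    rw [mem_iUnion₂]
    constructor
    · intro hx
      obtain ⟨e, he, hsub⟩ := Metric.isOpen_iff.1 hU _ hx
      obtain ⟨n, hn⟩ := exists_nat_gt (-Real.log e)
      obtain ⟨v, hv, hb⟩ := mem_hull_iff.1 (f x).2 (n + 1)
      refine ⟨(n + 1, ⟨v, hv⟩), fun T hT => hsub ?_, hb⟩
      refine (dist_le_of_openBall_eq (by omega) (hT.trans hb.symm)).trans_lt ?_
      rw [← Real.lt_log_iff_exp_lt he]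
      push_cast
      linarith
    · rintro ⟨i, hi, hx⟩
      exact hi _ hx
  rw [hcover]
  exact MeasurableSet.biUnion (to_countable _) fun i _ => hball _ _

/-- The vertex set of a point of the hull, as a family of truth values. -/
def hullVerts (T : hull) : ℤ × ℤ → Prop := fun p => p ∈ (T : RootedGraph).graph.verts

theorem measurable_hullVerts : Measurable hullVerts :=
  measurable_pi_iff.2 measurable_mem_verts

theorem hullVerts_injective : Function.Injective hullVerts := by
  intro T T' h
  exact Subtype.ext (ext_of_isInduced (hull_isInduced T.2) (hull_isInduced T'.2)
    fun p => iff_of_eq (congrFun h p))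

/-! ### Marked codes -/

open Classical in
/-- The tree of a code, seen from its root or, if the mark is `1`, from the neighbour `dir 2` of its
root (if there is one). -/
noncomputable def markedTree (x : Seq4 × Fin 2) : hull :=
  ⟨if h : x.2 = 1 ∧ dir 2 ∈ (codedTree x.1).graph.verts then (codedTree x.1).shift (dir 2) h.2
    else codedTree x.1, by
    split_ifs with h
    · exact shift_mem_hull (codedTree_mem_hull _) _
    · exact codedTree_mem_hull _⟩

/-- The marked codes whose mark, if it is `1`, designates a vertex of the coded tree. -/
def markedCodes : Set (Seq4 × Fin 2) := {x | x.2 = 1 → dir 2 ∈ (codedTree x.1).graph.verts}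

theorem markedTree_zero (α : Seq4) : (markedTree (α, 0) : RootedGraph) = codedTree α := by
  simp [markedTree]

theorem markedTree_one {α : Seq4} (h : dir 2 ∈ (codedTree α).graph.verts) :
    (markedTree (α, 1) : RootedGraph) = (codedTree α).shift (dir 2) h := by
  simp [markedTree, h]

theorem mem_markedCodes_zero (α : Seq4) : (α, (0 : Fin 2)) ∈ markedCodes := by
  simp [markedCodes]

theorem mem_markedCodes_one {α : Seq4} :
    (α, (1 : Fin 2)) ∈ markedCodes ↔ dir 2 ∈ (codedTree α).graph.verts := by
  simp [markedCodes]

theorem codedTree_rel_markedTree (x : Seq4 × Fin 2) :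
    translationRel (codedTree x.1) (markedTree x) := by
  unfold markedTree
  dsimp only
  split_ifs with h
  · exact translationRel_shift h.2
  · exact translationRel.refl _

/-- The coded trees are equivalent exactly when their codes are cofinal. -/
theorem translationRel_codedTree_iff {α β : Seq4} :
    translationRel (codedTree α) (codedTree β) ↔ cofinalRel α β := by
  constructor
  · intro h
    obtain ⟨v, hv, h⟩ := translationRel_iff.1 h
    have heven : Even (diagU v) := by
      rw [← Int.not_odd_iff_even]
      intro hodd
      refine not_valency_le_two (codedTree_isInduced β) (fun k => ?_) (valency_codedTree_le β)
      rw [h, mem_shift, add_comm]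
      exact add_dir_mem_codedTree hv hodd k
    obtain ⟨γ, hγ, hγ'⟩ := exists_cofinal_of_even hv heven
    rw [← h] at hγ'
    rwa [codedTree_injective hγ'] at hγ
  · rintro ⟨n, hn⟩
    obtain ⟨hv, h⟩ := codedTree_shift_of_cofinal hn
    rw [h]
    exact translationRel_shift hv

theorem markedTree_rel_iff {x y : Seq4 × Fin 2} :
    translationRel (markedTree x) (markedTree y) ↔ cofinalRel x.1 y.1 := by
  rw [← translationRel_codedTree_iff]
  have hx := codedTree_rel_markedTree x
  have hy := codedTree_rel_markedTree y
  exact ⟨fun h => translationRel.trans hx (translationRel.trans h (translationRel.symm hy)),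
    fun h => translationRel.trans (translationRel.symm hx) (translationRel.trans h hy)⟩

theorem not_rel_markedTree (x : Seq4 × Fin 2) : ¬ translationRel kenyon (markedTree x) := fun h =>
  not_translationRel_codedTree x.1
    (translationRel.trans h (translationRel.symm (codedTree_rel_markedTree x)))

theorem not_valency_markedTree_one {α : Seq4} (h : dir 2 ∈ (codedTree α).graph.verts) :
    ¬ (markedTree (α, 1) : RootedGraph).valency ≤ 2 := by
  rw [markedTree_one h]
  refine not_valency_le_two (isInduced_shift_codedTree h) fun k => ?_
  rw [mem_shift, add_comm]
  exact add_dir_mem_codedTree h (by decide) k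

theorem fin_two_cases (i : Fin 2) : i = 0 ∨ i = 1 := by
  revert i; decide

theorem markedTree_injOn : InjOn markedTree markedCodes := by
  rintro ⟨α, i⟩ hα ⟨β, j⟩ hβ h
  have h' := congrArg (Subtype.val : hull → RootedGraph) h
  rcases fin_two_cases i with rfl | rfl <;> rcases fin_two_cases j with rfl | rfl
  · rw [markedTree_zero, markedTree_zero] at h'
    rw [codedTree_injective h']
  · have h2 := not_valency_markedTree_one (mem_markedCodes_one.1 hβ)
    rw [← h', markedTree_zero] at h2
    exact absurd (valency_codedTree_le α) h2
  · have h2 := not_valency_markedTree_one (mem_markedCodes_one.1 hα)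
    rw [h', markedTree_zero] at h2
    exact absurd (valency_codedTree_le β) h2
  · rw [markedTree_one (mem_markedCodes_one.1 hα), markedTree_one (mem_markedCodes_one.1 hβ)] at h'
    have : codedTree α = codedTree β := by
      refine ext_of_isInduced (codedTree_isInduced α) (codedTree_isInduced β) fun p => ?_
      have hp : p - dir 2 ∈ ((codedTree α).shift (dir 2) (mem_markedCodes_one.1 hα)).graph.verts ↔
        p - dir 2 ∈ ((codedTree β).shift (dir 2) (mem_markedCodes_one.1 hβ)).graph.verts := by
        rw [h']
      rwa [mem_shift, mem_shift, sub_add_cancel] at hp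
    rw [codedTree_injective this]

/-- Every point of the hull which is not equivalent to the Kenyon tree is the tree of a marked
code. -/
theorem exists_markedTree {T : hull} (hT : ¬ translationRel kenyon T) :
    ∃ x ∈ markedCodes, markedTree x = T := by
  rcases hull_classification T.2 with h | ⟨α, h⟩ | ⟨α, h2, h⟩
  · exact absurd h hT
  · exact ⟨(α, 0), mem_markedCodes_zero α, Subtype.ext ((markedTree_zero α).trans h.symm)⟩
  · exact ⟨(α, 1), mem_markedCodes_one.2 h2, Subtype.ext ((markedTree_one h2).trans h.symm)⟩

theorem measurable_skeleton (n : ℕ) : Measurable fun α : Seq4 => skeleton α n := by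
  induction n with
  | zero => exact measurable_const
  | succ n ih =>
    have : Measurable fun k : Fin 4 => (2 ^ n : ℤ) • dir k := measurable_from_top
    exact ih.add (this.comp (measurable_pi_apply n))

theorem measurable_mem_codedTree (p : ℤ × ℤ) :
    Measurable fun α : Seq4 => p ∈ (codedTree α).graph.verts := by
  simp only [mem_codedTree]
  refine Measurable.exists fun n => ?_
  have : Measurable fun q : ℤ × ℤ => p - q ∈ diamond n := measurable_of_countable _
  exact this.comp (measurable_skeleton n)

theorem measurableSet_markedCodes : MeasurableSet markedCodes := by
  refine measurableSet_setOfPred.2 (Measurable.imp ?_ ?_)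
  · exact (measurable_of_countable fun i : Fin 2 => i = 1).comp measurable_snd
  · exact (measurable_mem_codedTree _).comp measurable_fst

theorem mem_markedTree {x : Seq4 × Fin 2} {p : ℤ × ℤ} :
    p ∈ (markedTree x : RootedGraph).graph.verts ↔
      ((x.2 = 1 ∧ dir 2 ∈ (codedTree x.1).graph.verts) ∧ p + dir 2 ∈ (codedTree x.1).graph.verts) ∨
      (¬ (x.2 = 1 ∧ dir 2 ∈ (codedTree x.1).graph.verts) ∧ p ∈ (codedTree x.1).graph.verts) := by
  unfold markedTree
  dsimp only
  split_ifs with h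
  · simp only [h, and_self, true_and, not_true_eq_false, false_and, or_false]
    exact mem_shift
  · simp only [h, false_and, not_false_eq_true, true_and, false_or]

theorem measurable_markedTree : Measurable markedTree := by
  refine measurable_of_mem_verts fun p => ?_
  simp only [mem_markedTree]
  have h1 : ∀ q, Measurable fun x : Seq4 × Fin 2 => q ∈ (codedTree x.1).graph.verts := fun q =>
    (measurable_mem_codedTree q).comp measurable_fst
  have h2 : Measurable fun x : Seq4 × Fin 2 => x.2 = 1 :=
    (measurable_of_countable fun i : Fin 2 => i = 1).comp measurable_snd
  have h3 := h2.and (h1 (dir 2))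
  exact (h3.and (h1 _)).or (h3.not.and (h1 p))

/-! ### The hull is a standard Borel space -/

theorem countable_kenyonClass : {T : hull | translationRel kenyon T}.Countable := by
  refine (countable_range fun v : balanced =>
    (⟨kenyonAt v v.2, mem_hull_iff.2 fun N => ⟨v, v.2, rfl⟩⟩ : hull)).mono ?_
  intro T hT
  obtain ⟨v, hv, h⟩ := translationRel_kenyon_iff.1 hT
  exact ⟨⟨v, hv⟩, Subtype.ext h.symm⟩

theorem standardBorelSpace_of_measurableEquiv {X Y : Type*} [MeasurableSpace X] [MeasurableSpace Y]
    [StandardBorelSpace Y] (e : X ≃ᵐ Y) : StandardBorelSpace X := by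
  let := upgradeStandardBorel Y
  let τ : TopologicalSpace X := TopologicalSpace.induced e inferInstance
  have hind : Topology.IsInducing e := ⟨rfl⟩
  refine ⟨⟨τ, ⟨?_⟩, ?_⟩⟩
  · rw [borel_comap, ← BorelSpace.measurable_eq (α := Y)]
    exact e.measurableEmbedding.comap_eq.symm
  · exact (e.toEquiv.toHomeomorphOfIsInducing hind).isClosedEmbedding.polishSpace

/-- The hull is standard Borel: the vertex set identifies it with a Borel subset of a product of
discrete spaces, which is the union of a countable set and of the injective image of the marked
codes. -/
instance standardBorelSpace_hull : StandardBorelSpace hull := by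
  have hsplit : (univ : Set hull) = markedTree '' markedCodes ∪ {T | translationRel kenyon T} := by
    refine (eq_univ_of_forall fun T => ?_).symm
    by_cases h : translationRel kenyon T
    · exact Or.inr h
    · exact Or.inl (exists_markedTree h)
  have hrange : MeasurableSet (range hullVerts) := by
    rw [← image_univ, hsplit, image_union, ← image_comp]
    refine MeasurableSet.union ?_ (countable_kenyonClass.image _).measurableSet
    exact measurableSet_markedCodes.image_of_measurable_injOn
      (measurable_hullVerts.comp measurable_markedTree)
      (hullVerts_injective.injOn.comp markedTree_injOn fun _ _ => mem_univ _)
  have hcomap : MeasurableSpace.comap hullVerts inferInstance = (inferInstance :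
      MeasurableSpace hull) := by
    refine le_antisymm measurable_hullVerts.comap_le ?_
    have h : @Measurable hull hull (MeasurableSpace.comap hullVerts inferInstance) _ id := by
      refine @measurable_of_mem_verts hull (MeasurableSpace.comap hullVerts inferInstance) _ ?_
      intro p
      exact (measurable_pi_apply p).comp (comap_measurable hullVerts)
    intro s hs
    exact h hs
  have hemb : MeasurableEmbedding hullVerts :=
    MeasurableEmbedding.iff_comap_eq.2 ⟨hullVerts_injective, hcomap, hrange⟩
  have := hrange.standardBorel
  exact standardBorelSpace_of_measurableEquiv hemb.equivRange

open scoped ENNReal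

/-! ### Translations of the space of codes -/

instance isProbabilityMeasure_mu4 : IsProbabilityMeasure mu4 := by
  unfold mu4; infer_instance

theorem map_add_left_uniform (a : Fin 4) :
    (PMF.uniformOfFintype (Fin 4)).toMeasure.map (a + ·) =
      (PMF.uniformOfFintype (Fin 4)).toMeasure := by
  refine Measure.ext_of_singleton fun b => ?_
  rw [Measure.map_apply (Measurable.of_discrete) (measurableSet_singleton b)]
  have : (a + ·) ⁻¹' {b} = ({-a + b} : Set (Fin 4)) := by
    ext x
    simp only [mem_preimage, mem_singleton_iff]
    constructor
    · rintro rfl; abel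
    · rintro rfl; abel
  rw [this, PMF.toMeasure_apply_singleton _ _ (measurableSet_singleton _),
    PMF.toMeasure_apply_singleton _ _ (measurableSet_singleton _)]
  simp

instance isAddLeftInvariant_mu4 : mu4.IsAddLeftInvariant := by
  refine ⟨fun c => ?_⟩
  have := Measure.infinitePi_map_pi (f := fun i x => c i + x)
    (fun _ : ℕ => (PMF.uniformOfFintype (Fin 4)).toMeasure) (fun _ => Measurable.of_discrete)
  simp only [map_add_left_uniform] at this
  exact this

theorem measure_cylinder_mu4 (s : Finset ℕ) (a : Seq4) :
    mu4 {α | ∀ j ∈ s, α j = a j} = (4⁻¹ : ℝ≥0∞) ^ s.card := by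
  have h : {α : Seq4 | ∀ j ∈ s, α j = a j} = (s : Set ℕ).pi fun j => {a j} := by
    ext α; simp [Set.mem_pi]
  rw [h, mu4, Measure.infinitePi_pi _ fun _ _ => measurableSet_singleton _]
  simp only [PMF.toMeasure_apply_singleton _ _ (measurableSet_singleton _),
    PMF.uniformOfFintype_apply, Fintype.card_fin, Finset.prod_const]
  norm_num

/-- A finite measure on the space of codes which is invariant under the translations by the
finitely supported sequences is a multiple of the uniform measure. The measure of a cylinder is
computed by integrating the measures of its translates. -/
theorem eq_smul_mu4 (ρ : Measure Seq4) [IsFiniteMeasure ρ]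
    (h : ∀ c, cofinalRel c 0 → ∀ E, MeasurableSet E → ρ ((c + ·) ⁻¹' E) = ρ E) :
    ρ = ρ univ • mu4 := by
  have key : ∀ (s : Finset ℕ) (t : ℕ → Set (Fin 4)),
      ρ ((s : Set ℕ).pi t) = ρ univ * mu4 ((s : Set ℕ).pi t) := by
    intro s t
    set A := (s : Set ℕ).pi t with hA
    have hAm : MeasurableSet A :=
      MeasurableSet.pi s.countable_toSet fun _ _ => MeasurableSet.of_discrete
    have hm : MeasurableSet {z : Seq4 × Seq4 | z.1 + z.2 ∈ A} :=
      (measurable_fst.add measurable_snd) hAm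
    have h1 : (mu4.prod ρ) {z : Seq4 × Seq4 | z.1 + z.2 ∈ A} = ρ A := by
      rw [Measure.prod_apply hm]
      have : ∀ y : Seq4, ρ (Prod.mk y ⁻¹' {z : Seq4 × Seq4 | z.1 + z.2 ∈ A}) = ρ A := by
        intro y
        classical
        let c : Seq4 := fun j => if j ∈ s then y j else 0
        rw [← h c ?_ A hAm]
        · congr 1
          ext x
          simp only [mem_preimage, mem_ofPred_eq, hA, Set.mem_pi]
          refine forall₂_congr fun j hj => ?_
          have : c j = y j := if_pos hj
          rw [Pi.add_apply, Pi.add_apply, this]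
        · obtain ⟨n, hn⟩ := s.exists_nat_subset_range
          refine ⟨n, fun j hj => if_neg fun hjs => ?_⟩
          have := Finset.mem_range.1 (hn hjs)
          omega
      simp only [this, lintegral_const, measure_univ, mul_one]
    have h2 : (mu4.prod ρ) {z : Seq4 × Seq4 | z.1 + z.2 ∈ A} = mu4 A * ρ univ := by
      rw [Measure.prod_apply_symm hm]
      have : ∀ x : Seq4, mu4 ((fun y => (y, x)) ⁻¹' {z : Seq4 × Seq4 | z.1 + z.2 ∈ A}) = mu4 A := by
        intro x
        rw [← measure_preimage_add mu4 x A]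
        congr 1
        ext y
        simp only [mem_preimage, mem_ofPred_eq, add_comm]
      simp only [this, lintegral_const]
    rw [← h1, h2, mul_comm]
  by_cases h0 : ρ univ = 0
  · rw [h0, zero_smul]; exact Measure.measure_univ_eq_zero.1 h0
  · have htop : ρ univ ≠ ⊤ := measure_ne_top ρ univ
    have : (ρ univ)⁻¹ • ρ = mu4 := by
      refine Measure.eq_infinitePi _ fun s t ht => ?_
      rw [Measure.smul_apply, key, smul_eq_mul, ← mul_assoc, ENNReal.inv_mul_cancel h0 htop,
        one_mul, mu4, Measure.infinitePi_pi _ fun i _ => ht i]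
    rw [← this, smul_smul, ENNReal.mul_inv_cancel h0 htop, one_smul]

/-- The product of the uniform measure on codes and of the counting measure on marks. -/
noncomputable def markedMeasure : Measure (Seq4 × Fin 2) := mu4.prod Measure.count

instance isAddLeftInvariant_markedMeasure : markedMeasure.IsAddLeftInvariant := by
  have : (Measure.count : Measure (Fin 2)).IsAddLeftInvariant := inferInstance
  have : MeasurableAdd Seq4 := inferInstance
  have : MeasurableAdd (Fin 2) := inferInstance
  exact Measure.prod.instIsAddLeftInvariant

theorem markedMeasure_apply {E : Set (Seq4 × Fin 2)} (hE : MeasurableSet E) :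
    markedMeasure E = mu4 {α | (α, 0) ∈ E} + mu4 {α | (α, 1) ∈ E} := by
  rw [markedMeasure, Measure.prod_apply_symm hE, lintegral_count, tsum_fintype, Fin.sum_univ_two]
  rfl

theorem measure_dir_two_mem :
    mu4 {α | dir 2 ∈ (codedTree α).graph.verts} = 3⁻¹ := by
  have hset : {α | dir 2 ∈ (codedTree α).graph.verts} =
      ⋃ k : ℕ, {α : Seq4 | ∀ j ∈ Finset.range (k + 1), α j = if j < k then 0 else 2} := by
    ext α
    rw [mem_iUnion]
    refine dir_two_mem_codedTree_iff.trans (exists_congr fun k => ?_)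
    constructor
    · rintro ⟨h0, h2⟩ j hj
      split_ifs with hjk
      · exact h0 j hjk
      · have := Finset.mem_range.1 hj
        rwa [show j = k by omega]
    · intro h
      refine ⟨fun j hj => ?_, ?_⟩
      · rw [h j (Finset.mem_range.2 (by omega)), if_pos hj]
      · rw [h k (Finset.mem_range.2 (by omega)), if_neg (lt_irrefl k)]
  rw [hset, measure_iUnion]
  · simp only [measure_cylinder_mu4, Finset.card_range]
    rw [ENNReal.tsum_geometric_add_one]
    have h : (1 - 4⁻¹ : ℝ≥0∞) = 3 / 4 := by
      refine ENNReal.sub_eq_of_eq_add (by norm_num) ?_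
      rw [← one_div, ENNReal.div_add_div_same]
      norm_num
      exact (ENNReal.div_self (by norm_num) (by norm_num)).symm
    rw [h, ENNReal.inv_div (by norm_num) (by norm_num), ENNReal.div_eq_inv_mul, mul_comm (3⁻¹),
      ← mul_assoc, ENNReal.inv_mul_cancel (by norm_num) (by norm_num), one_mul]
  · intro k l hkl
    refine Set.disjoint_left.2 fun α hk hl => ?_
    have aux : ∀ {k l : ℕ}, k < l → (∀ j ∈ Finset.range (k + 1), α j = if j < k then 0 else 2) →
        (∀ j ∈ Finset.range (l + 1), α j = if j < l then 0 else 2) → False := by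
      intro k l hkl hk hl
      have h1 := hk k (Finset.mem_range.2 (by omega))
      have h2 := hl k (Finset.mem_range.2 (by omega))
      rw [if_neg (lt_irrefl k)] at h1
      rw [if_pos hkl, h1] at h2
      exact absurd h2 (by decide)
    rcases lt_or_gt_of_ne hkl with h | h
    · exact aux h hk hl
    · exact aux h hl hk
  · intro k
    have : {α : Seq4 | ∀ j ∈ Finset.range (k + 1), α j = if j < k then 0 else 2}
        = (Finset.range (k + 1) : Set ℕ).pi fun j => {if j < k then 0 else 2} := by
      ext α; simp [Set.mem_pi]
    rw [this]
    exact MeasurableSet.pi (Finset.countable_toSet _) fun _ _ => MeasurableSet.of_discrete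

theorem markedMeasure_markedCodes : markedMeasure markedCodes = 4 / 3 := by
  rw [markedMeasure_apply measurableSet_markedCodes]
  simp only [mem_markedCodes_zero, mem_markedCodes_one, measure_dir_two_mem]
  rw [Set.ofPred_true, measure_univ, ← ENNReal.div_self (a := 3) (by norm_num) (by norm_num),
    ← one_div, ENNReal.div_add_div_same]
  norm_num

theorem countable_cofinal_zero : {c : Seq4 | cofinalRel c 0}.Countable := by
  have : {c : Seq4 | cofinalRel c 0} ⊆
      ⋃ n : ℕ, range fun (w : Fin n → Fin 4) (j : ℕ) => if h : j < n then w ⟨j, h⟩ else 0 := by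
    rintro c ⟨n, hn⟩
    refine mem_iUnion.2 ⟨n, fun j => c j, ?_⟩
    ext j
    by_cases h : j < n
    · simp [h]
    · simp [h, hn j (not_lt.1 h)]
  exact (countable_iUnion fun n => countable_range _).mono this

theorem cofinalRel_add_left {c : Seq4} (hc : cofinalRel c 0) (α : Seq4) :
    cofinalRel α (c + α) := by
  obtain ⟨n, hn⟩ := hc
  refine ⟨n, fun j hj => ?_⟩
  rw [Pi.add_apply, hn j hj, Pi.zero_apply, zero_add]

theorem cofinalRel_sub {α β : Seq4} (h : cofinalRel α β) : cofinalRel (β - α) 0 := by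
  obtain ⟨n, hn⟩ := h
  refine ⟨n, fun j hj => ?_⟩
  rw [Pi.sub_apply, hn j hj, sub_self, Pi.zero_apply]

/-! ### Invariant measures -/

/-- An invariant measure gives the same mass to two Borel sets with injective parametrisations by
the same standard Borel space such that corresponding points are equivalent. -/
theorem IsInvariantMeasure.measure_image_eq {Y X : Type*} [MeasurableSpace Y]
    [MeasurableSpace.CountablySeparated Y] [MeasurableSpace X] [StandardBorelSpace X]
    {r : Setoid Y} {ν : Measure Y} (hν : IsInvariantMeasure r ν) {E : Set X} (hE : MeasurableSet E)
    {F G : X → Y} (hF : Measurable F) (hG : Measurable G) (hFi : InjOn F E) (hGi : InjOn G E)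
    (hr : ∀ x ∈ E, r (F x) (G x)) : ν (F '' E) = ν (G '' E) := by
  have := hE.standardBorel
  have eF : MeasurableEmbedding fun x : E => F x :=
    (hF.comp measurable_subtype_coe).measurableEmbedding (injOn_iff_injective.1 hFi)
  have eG : MeasurableEmbedding fun x : E => G x :=
    (hG.comp measurable_subtype_coe).measurableEmbedding (injOn_iff_injective.1 hGi)
  have h := hν _ _ eF.measurableSet_range eG.measurableSet_range
    (eF.equivRange.symm.trans eG.equivRange) (by
      intro a
      obtain ⟨x, rfl⟩ := eF.equivRange.surjective a
      rw [MeasurableEquiv.trans_apply, MeasurableEquiv.symm_apply_apply]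
      change r ((eF.equivRange x : range _) : Y) (eG.equivRange x : range _)
      rw [MeasurableEmbedding.equivRange_apply, MeasurableEmbedding.equivRange_apply]
      exact hr x x.2) _ eG.measurableSet_range le_rfl
  rw [image_eq_range, image_eq_range, ← h]
  congr 1
  ext y
  exact ⟨fun hy => ⟨hy, Subtype.coe_prop _⟩, fun hy => hy.1⟩

/-- An invariant finite measure does not charge the class of the Kenyon tree, which is infinite. -/
theorem measure_kenyonClass {ν : Measure hull} [IsFiniteMeasure ν]
    (hν : IsInvariantMeasure hullRel ν) : ν {T | translationRel kenyon T} = 0 := by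
  have hsing : ∀ a b : hull, translationRel a b → ν {a} = ν {b} := by
    intro a b hab
    have := hν.measure_image_eq (X := Unit) (E := univ) MeasurableSet.univ (F := fun _ => a)
      (G := fun _ => b) measurable_const measurable_const (by intro x _ y _ _; rfl)
      (by intro x _ y _ _; rfl) (fun _ _ => hab)
    simpa using this
  have hb : ∀ n : ℕ, (2 ^ n : ℤ) • dir 0 ∈ balanced := fun n => (isCenter_smul_dir n 0).mem_balanced
  let a : ℕ → hull := fun n => ⟨kenyonAt _ (hb n), mem_hull_iff.2 fun N => ⟨_, hb n, rfl⟩⟩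
  have ha : ∀ n, translationRel kenyon (a n) := fun n =>
    translationRel_kenyon_iff.2 ⟨_, hb n, rfl⟩
  have hinj : Function.Injective a := by
    intro m n h
    have h1 := kenyonAt_injective (hv := hb m) (hw := hb n)
      (congrArg (Subtype.val : hull → RootedGraph) h)
    have h2 := congrArg Prod.fst h1
    simpa [dir] using h2
  have h0 : ν {a 0} = 0 := by
    by_contra hne
    have h1 : ν (⋃ n, {a n}) = ∑' n, ν {a n} := by
      refine measure_iUnion (fun m n hmn => ?_) fun n => measurableSet_singleton _
      exact disjoint_singleton.2 fun h => hmn (hinj h)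
    have h2 : ∀ n, ν {a n} = ν {a 0} := fun n =>
      hsing _ _ (translationRel.trans (translationRel.symm (ha n)) (ha 0))
    simp only [h2] at h1
    rw [ENNReal.tsum_const_eq_top_of_ne_zero hne] at h1
    exact measure_ne_top ν _ h1
  rw [← biUnion_of_singleton {T : hull | translationRel kenyon T},
    measure_biUnion_null_iff countable_kenyonClass]
  intro T hT
  rw [← hsing (a 0) T (translationRel.trans (translationRel.symm (ha 0)) hT), h0]

/-- The invariant measure of the hull: the normalised image of the measure on marked codes. -/
noncomputable def hullMeasure : Measure hull :=
  (3 / 4 : ℝ≥0∞) • (markedMeasure.restrict markedCodes).map markedTree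

theorem hullMeasure_apply {B : Set hull} (hB : MeasurableSet B) :
    hullMeasure B = 3 / 4 * markedMeasure (markedTree ⁻¹' B ∩ markedCodes) := by
  rw [hullMeasure, Measure.smul_apply, Measure.map_apply measurable_markedTree hB,
    Measure.restrict_apply (measurable_markedTree hB), smul_eq_mul]

theorem three_quarters_mul : (3 / 4 : ℝ≥0∞) * (4 / 3) = 1 := by
  rw [← ENNReal.inv_div (a := 3) (b := 4) (by norm_num) (by norm_num)]
  exact ENNReal.mul_inv_cancel (by simp) (ENNReal.div_ne_top (by norm_num) (by norm_num))

instance isProbabilityMeasure_hullMeasure : IsProbabilityMeasure hullMeasure := by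
  refine ⟨?_⟩
  rw [hullMeasure_apply MeasurableSet.univ, preimage_univ, univ_inter, markedMeasure_markedCodes,
    three_quarters_mul]

/-- The measure `hullMeasure` is invariant: in terms of marked codes, a partial isomorphism whose
graph is contained in the equivalence relation is piecewise, for a countable partition, a
translation by a finitely supported sequence and a mark. -/
theorem isInvariantMeasure_hullMeasure : IsInvariantMeasure hullRel hullMeasure := by
  intro A B hA hB e hr B' hB' hsub
  classical
  set A' : Set hull := {x | ∃ h : x ∈ A, (e ⟨x, h⟩ : hull) ∈ B'} with hA'
  have hA'm : MeasurableSet A' := by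
    have : A' = Subtype.val '' ((fun a : A => (e a : hull)) ⁻¹' B') := by
      ext x
      constructor
      · rintro ⟨h, hx⟩; exact ⟨⟨x, h⟩, hx, rfl⟩
      · rintro ⟨⟨y, hy⟩, hx, rfl⟩; exact ⟨hy, hx⟩
    rw [this]
    exact hA.subtype_image ((measurable_subtype_coe.comp e.measurable) hB')
  let f : hull → hull := fun x => if h : x ∈ A then (e ⟨x, h⟩ : hull) else x
  have hf : Measurable f :=
    Measurable.dite (f := fun a : A => (e a : hull)) (g := fun a : ↥Aᶜ => (a : hull))
      (measurable_subtype_coe.comp e.measurable) measurable_subtype_coe hA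
  have hfA : ∀ x (h : x ∈ A), f x = e ⟨x, h⟩ := fun x h => dif_pos h
  let D : Set (Seq4 × Fin 2) := {c | cofinalRel c.1 0}
  have hD : D.Countable := by
    have : D = {c : Seq4 | cofinalRel c 0} ×ˢ univ := by ext c; simp [D]
    rw [this]
    exact countable_cofinal_zero.prod (to_countable _)
  let E : Seq4 × Fin 2 → Set (Seq4 × Fin 2) := fun c => {x | x ∈ markedCodes ∧
    markedTree x ∈ A' ∧ c + x ∈ markedCodes ∧ f (markedTree x) = markedTree (c + x)}
  have hE : ∀ c, MeasurableSet (E c) := by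
    intro c
    have hadd : Measurable fun x : Seq4 × Fin 2 => c + x := measurable_const_add c
    exact measurableSet_markedCodes.inter ((measurable_markedTree hA'm).inter
      ((hadd measurableSet_markedCodes).inter (measurableSet_eq_fun
        (hf.comp measurable_markedTree) (measurable_markedTree.comp hadd))))
  have hmem : ∀ {x y : Seq4 × Fin 2}, x ∈ markedCodes → y ∈ markedCodes →
      ∀ (h : markedTree x ∈ A), (e ⟨_, h⟩ : hull) ∈ B' → (e ⟨_, h⟩ : hull) = markedTree y →
      y - x ∈ D ∧ x ∈ E (y - x) := by
    intro x y hx hy h hB'x hxy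
    have hrel := hr ⟨_, h⟩
    rw [hxy] at hrel
    refine ⟨cofinalRel_sub (markedTree_rel_iff.1 hrel), hx, ⟨h, hB'x⟩, ?_, ?_⟩
    · rwa [sub_add_cancel]
    · rw [sub_add_cancel, hfA _ h, hxy]
  have h1 : markedTree ⁻¹' A' ∩ markedCodes = ⋃ c ∈ D, E c := by
    ext x
    rw [mem_iUnion₂]
    constructor
    · rintro ⟨⟨h, hx'⟩, hx⟩
      have hne : ¬ translationRel kenyon (e ⟨_, h⟩ : hull) := fun hk =>
        not_rel_markedTree x (translationRel.trans hk (translationRel.symm (hr ⟨_, h⟩)))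
      obtain ⟨y, hy, hxy⟩ := exists_markedTree hne
      obtain ⟨h1, h2⟩ := hmem hx hy h hx' hxy.symm
      exact ⟨_, h1, h2⟩
    · rintro ⟨c, -, hx, hxA, -⟩
      exact ⟨hxA, hx⟩
  have h2 : markedTree ⁻¹' B' ∩ markedCodes = ⋃ c ∈ D, (-c + ·) ⁻¹' E c := by
    ext y
    rw [mem_iUnion₂]
    constructor
    · rintro ⟨hyB', hy⟩
      have hyB := hsub hyB'
      obtain ⟨⟨T, hT⟩, hTe⟩ := e.surjective ⟨_, hyB⟩
      have hval : (e ⟨T, hT⟩ : hull) = markedTree y := congrArg Subtype.val hTe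
      have hne : ¬ translationRel kenyon T := by
        intro hk
        have := hr ⟨T, hT⟩
        rw [hval] at this
        exact not_rel_markedTree y (translationRel.trans hk this)
      obtain ⟨x, hx, rfl⟩ := exists_markedTree hne
      obtain ⟨h1, h2⟩ := hmem hx hy hT (by rw [hval]; exact hyB') hval
      refine ⟨_, h1, ?_⟩
      have : -(y - x) + y = x := by abel
      rwa [mem_preimage, this]
    · rintro ⟨c, -, -, ⟨h, hB'x⟩, hy, hxy⟩
      rw [add_neg_cancel_left] at hy hxy
      refine ⟨?_, hy⟩
      rw [mem_preimage, ← hxy, hfA _ h]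
      exact hB'x
  have hdisj1 : D.PairwiseDisjoint E := by
    intro c _ d _ hcd
    refine Set.disjoint_left.2 fun x hc hd => hcd ?_
    have := markedTree_injOn hc.2.2.1 hd.2.2.1 (hc.2.2.2.symm.trans hd.2.2.2)
    exact add_right_cancel this
  have hdisj2 : D.PairwiseDisjoint fun c => (-c + ·) ⁻¹' E c := by
    intro c _ d _ hcd
    refine Set.disjoint_left.2 fun y hc hd => hcd ?_
    obtain ⟨hc1, ⟨hcA, -⟩, -, hc2⟩ := hc
    obtain ⟨hd1, ⟨hdA, -⟩, -, hd2⟩ := hd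
    rw [add_neg_cancel_left, hfA _ hcA] at hc2
    rw [add_neg_cancel_left, hfA _ hdA] at hd2
    have h3 := congrArg Subtype.val (e.injective (Subtype.ext (hc2.trans hd2.symm)))
    have h4 := markedTree_injOn hc1 hd1 h3
    exact neg_injective (add_right_cancel h4)
  rw [hullMeasure_apply hA'm, hullMeasure_apply hB', h1, h2,
    measure_biUnion hD hdisj1 fun c _ => hE c,
    measure_biUnion hD hdisj2 fun c _ => (measurable_const_add (-c)) (hE c)]
  congr 1
  exact tsum_congr fun c => (measure_preimage_add markedMeasure _ _).symm

/-- An invariant probability measure is determined by its restriction to the coded trees, since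
the other trees, apart from a null set, are translates of coded trees at a given neighbour of the
root; and this restriction is a multiple of the image of the uniform measure. -/
theorem eq_hullMeasure {ν : Measure hull} [IsProbabilityMeasure ν]
    (hν : IsInvariantMeasure hullRel ν) : ν = hullMeasure := by
  have hm : ∀ i : Fin 2, Measurable fun α : Seq4 => markedTree (α, i) := fun i =>
    measurable_markedTree.comp (measurable_id.prodMk measurable_const)
  have hinj : Function.Injective fun α : Seq4 => markedTree (α, 0) := fun α β h =>
    congrArg Prod.fst (markedTree_injOn (mem_markedCodes_zero α) (mem_markedCodes_zero β) h)
  have hemb := (hm 0).measurableEmbedding hinj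
  set ρ := ν.comap fun α : Seq4 => markedTree (α, 0) with hρ
  have hρa : ∀ E, ρ E = ν ((fun α : Seq4 => markedTree (α, 0)) '' E) := fun E =>
    hemb.comap_apply _ _
  have : IsFiniteMeasure ρ := ⟨by rw [hρa]; exact measure_lt_top _ _⟩
  have hρ' : ρ = ρ univ • mu4 := by
    refine eq_smul_mu4 ρ fun c hc E hE => ?_
    rw [hρa, hρa]
    have hadd : Measurable fun α : Seq4 => c + α := measurable_const_add c
    rw [hν.measure_image_eq (hadd hE) (hm 0) ((hm 0).comp hadd) hinj.injOn
      (hinj.comp (add_right_injective c)).injOn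
      (fun α _ => markedTree_rel_iff.2 (cofinalRel_add_left hc α)), image_comp]
    congr 2
    exact image_preimage_eq _ (fun α => ⟨-c + α, add_neg_cancel_left c α⟩)
  have key : ∀ B, MeasurableSet B →
      ν B = ρ univ * markedMeasure (markedTree ⁻¹' B ∩ markedCodes) := by
    intro B hB
    set F := markedTree ⁻¹' B ∩ markedCodes with hF
    have hFm : MeasurableSet F := (measurable_markedTree hB).inter measurableSet_markedCodes
    have hFi : ∀ i : Fin 2, MeasurableSet {α : Seq4 | (α, i) ∈ F} := fun i =>
      (measurable_id.prodMk measurable_const) hFm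
    have hinj1 : InjOn (fun α : Seq4 => markedTree (α, 1)) {α | (α, 1) ∈ F} := fun α hα β hβ h =>
      congrArg Prod.fst (markedTree_injOn hα.2 hβ.2 h)
    have hsplit : B \ {T | translationRel kenyon T} =
        (fun α : Seq4 => markedTree (α, 0)) '' {α | (α, 0) ∈ F} ∪
          (fun α : Seq4 => markedTree (α, 1)) '' {α | (α, 1) ∈ F} := by
      ext T
      constructor
      · rintro ⟨hT, hk⟩
        obtain ⟨⟨α, i⟩, hx, rfl⟩ := exists_markedTree hk
        rcases fin_two_cases i with rfl | rfl
        · exact Or.inl ⟨α, ⟨hT, hx⟩, rfl⟩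
        · exact Or.inr ⟨α, ⟨hT, hx⟩, rfl⟩
      · rintro (⟨α, hα, rfl⟩ | ⟨α, hα, rfl⟩)
        · exact ⟨hα.1, not_rel_markedTree _⟩
        · exact ⟨hα.1, not_rel_markedTree _⟩
    have hdisj : Disjoint ((fun α : Seq4 => markedTree (α, 0)) '' {α | (α, 0) ∈ F})
        ((fun α : Seq4 => markedTree (α, 1)) '' {α | (α, 1) ∈ F}) := by
      refine Set.disjoint_left.2 ?_
      rintro _ ⟨α, hα, rfl⟩ ⟨β, hβ, h⟩
      have := congrArg Prod.snd (markedTree_injOn hβ.2 hα.2 h)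
      exact absurd this (show (1 : Fin 2) ≠ 0 by decide)
    have hnull := measure_kenyonClass hν
    rw [← measure_sdiff_null hnull, hsplit, measure_union hdisj
        ((hFi 1).image_of_measurable_injOn (hm 1) hinj1),
      ← hν.measure_image_eq (hFi 1) (hm 0) (hm 1) hinj.injOn hinj1
        (fun α _ => markedTree_rel_iff.2 (cofinalRel.refl _)), ← hρa, ← hρa, hρ',
      markedMeasure_apply hFm, mul_add]
    simp only [Measure.smul_apply, smul_eq_mul, measure_univ, mul_one]
  have hconst : ρ univ = 3 / 4 := by
    have h1 := key univ MeasurableSet.univ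
    rw [measure_univ, preimage_univ, univ_inter, markedMeasure_markedCodes] at h1
    have h2 := congrArg (· * (3 / 4 : ℝ≥0∞)) h1
    rw [one_mul, mul_assoc, mul_comm (4 / 3 : ℝ≥0∞), three_quarters_mul, mul_one] at h2
    exact h2.symm
  ext B hB
  rw [key B hB, hconst, hullMeasure_apply hB]

/-! ### Discreteness of the two relations -/

theorem isDiscreteMeasurable_cofinalRel : IsDiscreteMeasurable cofinalRel where
  standardBorel := inferInstance
  countable_class := by
    intro α
    refine (countable_cofinal_zero.image (· + α)).mono fun β hβ => ?_
    exact ⟨β - α, cofinalRel_sub hβ, sub_add_cancel β α⟩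
  measurableSet_graph := by
    refine measurableSet_setOfPred.2 (Measurable.exists fun n => Measurable.forall fun m =>
      measurable_const.imp ?_)
    rw [← measurableSet_setOfPred]
    exact measurableSet_eq_fun ((measurable_pi_apply m).comp measurable_fst)
      ((measurable_pi_apply m).comp measurable_snd)

theorem hullRel_iff {T T' : hull} : hullRel T T' ↔ ∃ v, v ∈ (T : RootedGraph).graph.verts ∧
    ∀ p, p ∈ (T' : RootedGraph).graph.verts ↔ p + v ∈ (T : RootedGraph).graph.verts := by
  refine Iff.trans (translationRel_iff (T := T) (T' := T')) (exists_congr fun v => ?_)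
  constructor
  · rintro ⟨hv, h⟩
    refine ⟨hv, fun p => ?_⟩
    rw [h, mem_shift]
  · rintro ⟨hv, h⟩
    refine ⟨hv, ext_of_isInduced (hull_isInduced T'.2) (shift_isInduced (hull_isInduced T.2))
      fun p => ?_⟩
    rw [mem_shift, h]

theorem isDiscreteMeasurable_hullRel : IsDiscreteMeasurable hullRel where
  standardBorel := inferInstance
  countable_class := by
    intro T
    refine (countable_range fun v : (T : RootedGraph).graph.verts =>
      (⟨(T : RootedGraph).shift v v.2, shift_mem_hull T.2 v.2⟩ : hull)).mono ?_
    intro T' hT'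
    obtain ⟨v, hv, h⟩ := translationRel_iff.1 (show translationRel T T' from hT')
    exact ⟨⟨v, hv⟩, Subtype.ext h.symm⟩
  measurableSet_graph := by
    refine measurableSet_setOfPred.2 ?_
    simp only [hullRel_iff]
    exact Measurable.exists fun v => ((measurable_mem_verts v).comp measurable_fst).and
      (Measurable.forall fun p => ((measurable_mem_verts p).comp measurable_snd).iff
        ((measurable_mem_verts (p + v)).comp measurable_fst))

/-! ### The coding map -/

/-- The coding map `Φ`, with values in the trees of valency at most two at the root which are not
equivalent to the Kenyon tree. -/
noncomputable def codingMap (α : Seq4) : codingRange :=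
  ⟨markedTree (α, 0), not_rel_markedTree _, by
    change (markedTree (α, 0) : RootedGraph).valency ≤ 2
    rw [markedTree_zero]
    exact valency_codedTree_le α⟩

theorem coe_codingMap (α : Seq4) : ((codingMap α : hull) : RootedGraph) = codedTree α :=
  markedTree_zero α

theorem codingMap_injective : Function.Injective codingMap := fun α β h =>
  codedTree_injective (by rw [← coe_codingMap, h, coe_codingMap])

theorem codingMap_surjective : Function.Surjective codingMap := by
  rintro ⟨T, hT, hle⟩
  obtain ⟨⟨α, i⟩, hx, rfl⟩ := exists_markedTree hT
  rcases fin_two_cases i with rfl | rfl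
  · exact ⟨α, rfl⟩
  · exact absurd hle (not_valency_markedTree_one (mem_markedCodes_one.1 hx))

theorem measurable_codingMap : Measurable codingMap :=
  (measurable_markedTree.comp (measurable_id.prodMk measurable_const)).subtype_mk

theorem measurableEmbedding_coe_codingMap :
    MeasurableEmbedding fun α : Seq4 => (codingMap α : hull) :=
  (measurable_subtype_coe.comp measurable_codingMap).measurableEmbedding
    (Subtype.val_injective.comp codingMap_injective)

theorem measurableSet_codingRange : MeasurableSet codingRange := by
  have : codingRange = range fun α : Seq4 => (codingMap α : hull) := by
    rw [range_comp' Subtype.val codingMap, codingMap_surjective.range_eq, image_univ,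
      Subtype.range_coe]
  rw [this]
  exact measurableEmbedding_coe_codingMap.measurableSet_range

/-- The coding map as a Borel isomorphism. -/
noncomputable def codingEquiv : Seq4 ≃ᵐ codingRange where
  toEquiv := Equiv.ofBijective codingMap ⟨codingMap_injective, codingMap_surjective⟩
  measurable_toFun := measurable_codingMap
  measurable_invFun := fun s hs => by
    rw [← Equiv.image_eq_preimage_symm]
    exact (measurable_codingMap.measurableEmbedding codingMap_injective).measurableSet_image.2 hs

theorem hullMeasure_kenyonClass : hullMeasure {T | translationRel kenyon T} = 0 :=
  measure_kenyonClass isInvariantMeasure_hullMeasure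

/-- On the trees of valency at most two, only the mark `0` contributes to the invariant measure. -/
theorem hullMeasure_image_codingRange {B : Set codingRange} (hB : MeasurableSet B) :
    hullMeasure (Subtype.val '' B) = 3 / 4 * mu4 (codingMap ⁻¹' B) := by
  have hBm := measurableSet_codingRange.subtype_image hB
  rw [hullMeasure_apply hBm,
    markedMeasure_apply ((measurable_markedTree hBm).inter measurableSet_markedCodes)]
  have h0 : {α | (α, (0 : Fin 2)) ∈ markedTree ⁻¹' (Subtype.val '' B) ∩ markedCodes} =
      codingMap ⁻¹' B := by
    ext α
    constructor
    · rintro ⟨⟨T, hT, h⟩, -⟩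
      have : T = codingMap α := Subtype.ext h
      rwa [mem_preimage, ← this]
    · exact fun h => ⟨⟨_, h, rfl⟩, mem_markedCodes_zero α⟩
  have h1 : {α | (α, (1 : Fin 2)) ∈ markedTree ⁻¹' (Subtype.val '' B) ∩ markedCodes} = ∅ := by
    refine eq_empty_of_forall_notMem fun α => ?_
    rintro ⟨⟨T, hT, h⟩, hα⟩
    refine not_valency_markedTree_one (mem_markedCodes_one.1 hα) ?_
    rw [← h]
    exact T.2.2
  rw [h0, h1, measure_empty, add_zero]

theorem hullMeasure_hullLe2 : hullMeasure hullLe2 = 3 / 4 := by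
  have h : hullMeasure hullLe2 = hullMeasure codingRange := by
    rw [← measure_sdiff_null hullMeasure_kenyonClass]
    congr 1
    ext T
    exact and_comm
  have h' := hullMeasure_image_codingRange MeasurableSet.univ
  rw [image_univ, Subtype.range_coe, preimage_univ, measure_univ, mul_one] at h'
  rw [h, h']

theorem map_codingMap :
    mu4.map codingMap = (4 / 3 : ℝ≥0∞) • hullMeasure.comap ((↑) : codingRange → hull) := by
  ext B hB
  rw [Measure.map_apply measurable_codingMap hB, Measure.smul_apply,
    (MeasurableEmbedding.subtype_coe measurableSet_codingRange).comap_apply,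
    hullMeasure_image_codingRange hB, smul_eq_mul, ← mul_assoc, mul_comm (4 / 3 : ℝ≥0∞),
    three_quarters_mul, one_mul]

/-! ### The stable orbit equivalence -/

theorem hullMeasure_compl_saturation : hullMeasure (saturation hullRel codingRange)ᶜ = 0 := by
  refine measure_mono_null (fun T hT => ?_) hullMeasure_kenyonClass
  by_contra hk
  obtain ⟨⟨α, i⟩, -, rfl⟩ := exists_markedTree hk
  exact hT ⟨codingMap α, (codingMap α).2, markedTree_rel_iff.2 (cofinalRel.refl α)⟩

theorem codingMap_rel_iff {α β : Seq4} :
    hullRel (codingMap α) (codingMap β) ↔ cofinalRel α β :=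
  markedTree_rel_iff (x := (α, 0)) (y := (β, 0))

theorem isOrbitEquivalence_codingMap :
    IsOrbitEquivalence (cofinalRel.comap ((↑) : ↥(univ : Set Seq4) → Seq4)) (mu4.comap (↑))
      (hullRel.comap ((↑) : codingRange → hull)) (hullMeasure.comap (↑))
      fun α => codingMap α := by
  let e : ↥(univ : Set ↥(univ : Set Seq4)) ≃ᵐ ↥(univ : Set codingRange) :=
    ((MeasurableEquiv.Set.univ _).trans (MeasurableEquiv.Set.univ _)).trans
      (codingEquiv.trans (MeasurableEquiv.Set.univ _).symm)
  have hmap : ((mu4.comap ((↑) : ↥(univ : Set Seq4) → Seq4)).comap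
      ((↑) : ↥(univ : Set ↥(univ : Set Seq4)) → ↥(univ : Set Seq4))).map e =
      (4 / 3 : ℝ≥0∞) • (hullMeasure.comap ((↑) : codingRange → hull)).comap
        ((↑) : ↥(univ : Set codingRange) → codingRange) := by
    ext B hB
    have hB' : MeasurableSet (Subtype.val '' B) := MeasurableSet.univ.subtype_image hB
    rw [e.map_apply, Measure.smul_apply,
      (MeasurableEmbedding.subtype_coe MeasurableSet.univ).comap_apply,
      (MeasurableEmbedding.subtype_coe MeasurableSet.univ).comap_apply,
      (MeasurableEmbedding.subtype_coe MeasurableSet.univ).comap_apply, ← Measure.smul_apply,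
      ← map_codingMap, Measure.map_apply measurable_codingMap hB']
    congr 1
    ext α
    constructor
    · rintro ⟨_, ⟨z, hz, rfl⟩, rfl⟩
      exact ⟨_, hz, rfl⟩
    · rintro ⟨T, hT, h⟩
      refine ⟨⟨α, mem_univ α⟩, ⟨⟨_, mem_univ _⟩, ?_, rfl⟩, rfl⟩
      have : T = ⟨codingMap α, mem_univ _⟩ := Subtype.ext h
      rwa [this] at hT
  refine ⟨univ, univ, e,
    MeasurableSet.univ, eq_univ_of_forall fun x => ⟨x, mem_univ x, Setoid.refl' _ x⟩, by simp,
    MeasurableSet.univ, eq_univ_of_forall fun x => ⟨x, mem_univ x, Setoid.refl' _ x⟩, by simp,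
    fun z => rfl, Filter.Eventually.of_forall fun α _ => ?_, ?_, ?_⟩
  · ext T
    constructor
    · rintro ⟨β, hβ, rfl⟩
      exact codingMap_rel_iff.2 hβ
    · intro hT
      obtain ⟨β, rfl⟩ := codingMap_surjective T
      exact ⟨⟨β, mem_univ β⟩, codingMap_rel_iff.1 hT, rfl⟩
  · rw [hmap]
    exact Measure.smul_absolutelyContinuous
  · rw [hmap]
    exact Measure.AbsolutelyContinuous.rfl.smul_right (by simp)

end GhysKenyon

open GhysKenyon

theorem mainTheorem3 :
    ∃ Φ : Seq4 → codingRange,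
      (∀ α : Seq4, ((Φ α : hull) : RootedGraph) = codedTree α) ∧
      ∃ μ : Measure hull,
        (IsProbabilityMeasure μ ∧ IsInvariantMeasure hullRel μ) ∧
        (∀ ν : Measure hull, IsProbabilityMeasure ν → IsInvariantMeasure hullRel ν → ν = μ) ∧
        μ hullLe2 = 3 / 4 ∧
        mu4.map Φ = (4 / 3 : ENNReal) • μ.comap ((↑) : codingRange → hull) ∧
        IsStableOrbitEquivalence cofinalRel mu4 hullRel μ
          (Y := Set.univ) (Y' := codingRange) (fun α => Φ α) := by
  refine ⟨codingMap, coe_codingMap, hullMeasure,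
    ⟨isProbabilityMeasure_hullMeasure, isInvariantMeasure_hullMeasure⟩,
    fun ν _ hν => eq_hullMeasure hν, hullMeasure_hullLe2, map_codingMap, ?_⟩
  exact {
    discrete_left := isDiscreteMeasurable_cofinalRel
    discrete_right := isDiscreteMeasurable_hullRel
    measurableSet_left := MeasurableSet.univ
    measurableSet_right := measurableSet_codingRange
    saturation_left := by
      have : saturation cofinalRel univ = univ :=
        eq_univ_of_forall fun α => ⟨α, mem_univ α, cofinalRel.refl α⟩
      rw [this, compl_univ, measure_empty]
    saturation_right := hullMeasure_compl_saturation
    orbitEquivalence := isOrbitEquivalence_codingMap }
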